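/- Let $\alpha>-1$, $c>0$, $n\in\{0,1,2,\dots\}$, and let $\omega_\alpha(y)=(1-y^2)^\alpha$. Consider on $C^2([-1,1])$ the operator $$\mathcal L_c\varphi(x)=(1-x^2)\varphi''(x)-(2\alpha+2)x\varphi'(x)-c^2x^2\varphi(x).$$ Let $\psi=\psi_{n,c}^{(\alpha)}$ be the $n$-th generalized prolate spheroidal wave function (GPSWF), i.e. a real eigenfunction in $C^2([-1,1])$ of $-\mathcal L_c$ whose eigenvalue has exactly $n$ eigenvalues of $-\mathcal L_c$ below it, normalized by $\int_{-1}^1\psi^2\omega_\alpha=1$. Let $P_k^{(\alpha,\alpha)}$ be the Jacobi polynomials, let $$h_k=\frac{2^{2\alpha+1}\Gamma(k+\alpha+1)^2}{k!\,(2k+2\alpha+1)\,\Gamma(k+2\alpha+1)}$$ (for $k=0$ the product $(2\alpha+1)\Gamma(2\alpha+1)$ is read as $\Gamma(2\alpha+2)$), and let $\beta_k^n=h_k^{-1/2}\int_{-1}^1P_k^{(\alpha,\alpha)}\,\psi\,\omega_\alpha\,dy$ be the Gegenbauer coefficients of $\psi$. Let $J_\nu$ be the Bessel function of the first kind. Then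 $\psi$ is an eigenfunction of the weighted finite Fourier transform: there is $\mu=\mu_n^{(\alpha)}(c)\in\mathbb C\setminus\{0\}$ with $$\int_{-1}^1e^{icxy}\psi(y)\,\omega_\alpha(y)\,dy=\mu\,\psi(x),\qquad x\in[-1,1],$$ and the following hold. (1) $\psi$ extends to a real analytic function on $\mathbb R$, still denoted $\psi$, and $$\psi(x)=\frac{\sqrt\pi\,2^{\alpha+1/2}}{|\mu|}\sum_{k\ge0}i^{k-n}\beta_k^n\,\frac{\Gamma(k+\alpha+1)}{\sqrt{h_k}\,k!}\,\frac{J_{k+\alpha+1/2}(cx)}{(cx)^{\alpha+1/2}}\qquad\text{for all real }x\neq0,$$ where the series converges absolutely and, for $x<0$, the powers are taken with their principal branch in both numerator and denominator. (2) The eigenvalue is given by $$\mu=i^n\sqrt\pi\left(\frac2c\right)^{\alpha+1/2}\;\frac{\displaystyle\sum_{k\ge0}i^{k-n}\beta_k^n\,\frac{\Gamma(k+\alpha+1)}{\sqrt{h_k}\,k!}\,J_{k+\alpha+1/2}(c)}{\displaystyle\sum_{k\ge0}\frac{\beta_k^n}{\sqrt{h_k}}\binom{k+\alpha}{k}},\qquad\binom{k+\alpha}{k}=\frac{\Gamma(k+\alpha+1)}{k!\,\Gamma(\alpha+1)},$$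 where the denominator is nonzero and both series converge faster than every geometric series: for each $r>0$ their $k$-th terms are $O(r^k)$ as $k\to\infty$. -/

import Mathlib

open Set Filter Asymptotics

noncomputable section

/-- The Gegenbauer weight `ω_α(y) = (1 - y²)^α`. -/
def gegWeight (α y : ℝ) : ℝ := (1 - y ^ 2) ^ α

/-- The Jacobi polynomials `P_k^{(α,β)}`, by their three term recursion. -/
def jacobiP (α β : ℝ) : ℕ → ℝ → ℝ
  | 0, _ => 1
  | 1, x => (α + β + 2) / 2 * x + (α - β) / 2
  | k + 2, x =>
    let m : ℝ := (k : ℝ) + 1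
    ((2 * m + α + β + 1) * (2 * m + α + β + 2) / (2 * (m + 1) * (m + α + β + 1)) * x
        + (α ^ 2 - β ^ 2) * (2 * m + α + β + 1)
          / (2 * (m + 1) * (m + α + β + 1) * (2 * m + α + β))) * jacobiP α β (k + 1) x
      - (m + α) * (m + β) * (2 * m + α + β + 2)
          / ((m + 1) * (m + α + β + 1) * (2 * m + α + β)) * jacobiP α β k x

/-- The normalization constants
`h_k = 2^{2α+1} Γ(k+α+1)² / (k! (2k+2α+1) Γ(k+2α+1))` of the polynomials `P_k^{(α,α)}`.
For `k = 0` the product `(2α+1) Γ(2α+1)` is written `Γ(2α+2)`, which is also its value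
by continuity at `α = -1/2`. -/
def gegH (α : ℝ) : ℕ → ℝ
  | 0 => 2 ^ (2 * α + 1) * Real.Gamma (α + 1) ^ 2 / Real.Gamma (2 * α + 2)
  | k + 1 =>
    let m : ℝ := (k : ℝ) + 1
    2 ^ (2 * α + 1) * Real.Gamma (m + α + 1) ^ 2
      / (((k + 1).factorial : ℝ) * (2 * m + 2 * α + 1) * Real.Gamma (m + 2 * α + 1))

/-- The normalized polynomials `P_k^{(α,α)} / √h_k`. -/
def gegP (α : ℝ) (k : ℕ) (x : ℝ) : ℝ := jacobiP α α k x / √(gegH α k)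

/-- The Bessel function of the first kind of order `ν`, with the principal branch of `(z/2)^ν`. -/
def besselJ (ν z : ℂ) : ℂ :=
  (z / 2) ^ ν * ∑' m : ℕ, (-1) ^ m / ((m.factorial : ℂ) * Complex.Gamma (m + ν + 1))
    * (z / 2) ^ (2 * m)

/-- The differential operator
`L_c φ (x) = (1 - x²) φ''(x) - (2α + 2) x φ'(x) - c² x² φ(x)` on `[-1, 1]`. -/
def gegOp (α c : ℝ) (φ : ℝ → ℝ) (x : ℝ) : ℝ :=
  (1 - x ^ 2) * iteratedDerivWithin 2 φ (Icc (-1) 1) x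
    - (2 * α + 2) * x * derivWithin φ (Icc (-1) 1) x - c ^ 2 * x ^ 2 * φ x

/-- `φ` is a solution in `C²([-1, 1])` of `-L_c φ = χ φ`. -/
def IsGegEigen (α c χ : ℝ) (φ : ℝ → ℝ) : Prop :=
  ContDiffOn ℝ 2 φ (Icc (-1) 1) ∧ ∀ x ∈ Icc (-1 : ℝ) 1, -gegOp α c φ x = χ * φ x

/-- The set of the eigenvalues of `-L_c` on `C²([-1, 1])`. -/
def gegSpectrum (α c : ℝ) : Set ℝ :=
  {χ | ∃ φ : ℝ → ℝ, IsGegEigen α c χ φ ∧ ∃ x ∈ Icc (-1 : ℝ) 1, φ x ≠ 0}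

/-- `ψ` (restricted to `[-1, 1]`) is an `n`-th generalized prolate spheroidal wave function:
an eigenfunction of `-L_c` of norm one in `L²([-1, 1], ω_α)` whose eigenvalue `χ_n(c)` has
exactly `n` eigenvalues below it (the eigenvalues are simple). -/
def IsGPSWF (α c : ℝ) (n : ℕ) (ψ : ℝ → ℝ) : Prop :=
  (∃ χ : ℝ, IsGegEigen α c χ ψ ∧ {χ' ∈ gegSpectrum α c | χ' < χ}.encard = n) ∧
    ∫ t in (-1 : ℝ)..1, ψ t ^ 2 * gegWeight α t = 1

/-- The weighted finite Fourier transform `∫_{-1}^1 e^{icxy} f(y) ω_α(y) dy`. -/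
def weightedFourier (α c : ℝ) (f : ℝ → ℝ) (x : ℝ) : ℂ :=
  ∫ y in (-1 : ℝ)..1, Complex.exp (Complex.I * c * x * y) * f y * gegWeight α y

/-- The Gegenbauer coefficients `β_k = ∫_{-1}^1 P̃_k(y) ψ(y) ω_α(y) dy` of `ψ`. -/
def gegCoeff (α : ℝ) (ψ : ℝ → ℝ) (k : ℕ) : ℝ :=
  ∫ y in (-1 : ℝ)..1, gegP α k y * ψ y * gegWeight α y

/-- The number `i^{k-n} β_k Γ(k+α+1) / (√h_k k!)`. -/
def gegSeriesCoeff (α : ℝ) (n : ℕ) (ψ : ℝ → ℝ) (k : ℕ) : ℂ :=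
  Complex.I ^ ((k : ℤ) - (n : ℤ)) * gegCoeff α ψ k
    * ((Real.Gamma (k + α + 1) / (√(gegH α k) * k.factorial) : ℝ) : ℂ)

/-- The terms `i^{k-n} β_k Γ(k+α+1) / (√h_k k!) J_{k+α+1/2}(c)` of the numerator of `μ`. -/
def muNumTerm (α c : ℝ) (n : ℕ) (ψ : ℝ → ℝ) (k : ℕ) : ℂ :=
  gegSeriesCoeff α n ψ k * besselJ (k + α + 1 / 2) c

/-- The terms `(β_k / √h_k) (k+α choose k)` of the denominator of `μ`, where
`(k+α choose k) = Γ(k+α+1) / (k! Γ(α+1))`, the value of `P_k^{(α,α)}` at `1`. -/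
def muDenTerm (α : ℝ) (ψ : ℝ → ℝ) (k : ℕ) : ℝ :=
  gegCoeff α ψ k / √(gegH α k)
    * (Real.Gamma (k + α + 1) / (k.factorial * Real.Gamma (α + 1)))

end

/-!
The operator `L_c` is symmetric for the weight `ω_α`, and the kernel `e^{icxy}` is annihilated by
`L_c` in `x` minus `L_c` in `y` (`IsSol.fourierInt_ode`). Hence the weighted finite Fourier transform
maps solutions of `L_c φ = -χ φ` to solutions. Solutions that are `C²` at both singular end points
are unique up to a factor (`IsSol.mul_eq_mul`), since by the vanishing of the Wronskian each is, near
`1`, a multiple of the power series solution `frob`. So every eigenfunction `ψ` of `L_c` is an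
eigenfunction of the transform.

The phase `i^n` of the eigenvalue `μ`, and with it `μ ≠ 0`, needs two facts.

* How often `L_c` has an eigenvalue below `χ` is seen from the point `(u(0), u'(0))` of the plane,
  where `u` is the solution with `u(1) = 1` that is regular at `1`. By the Lagrange identity this
  point turns counterclockwise as `χ` increases (`turnsPositively_frob`). It is in the fourth
  quadrant for `χ ≤ 0`, and `χ` is an eigenvalue exactly if it lies on an axis
  (`mem_gegSpectrum_iff`). At the `n`-th eigenvalue it has therefore reached the half axis that is
  `n` quarter turns away from the positive first axis (`frob_sign_of_encard`).
* The moments of `ψ` satisfy a three term recursion whose middle coefficient changes sign at most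
  once. The high moments have the sign of `ψ(1)`, and so has the lowest one that does not vanish by
  parity (`IsSol.moment_pos`).

At `0` the transform of `ψ` or its derivative is a moment, which gives `μ = i^n r` with `r > 0`
(`IsSol.exists_fourier_eigenvalue`).

The transform is an entire function, so `ψ = μ⁻¹ F(ψ ω_α)` extends to the real line, with real
values by parity. The transform is approximated by its Taylor polynomials of degree below `k`, to
which the `k`-th Gegenbauer polynomial is orthogonal; so the Gegenbauer coefficients of `ψ` decay
faster than every geometric sequence (`exists_gegCoeff_bound`), while the polynomials grow at most
geometrically on `[-1, 1]`. The Gegenbauer expansion of `ψ` therefore converges uniformly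
(`hasSum_gegCoeff_mul_gegP`) and may be transformed term by term. The moments of the Jacobi
polynomials in closed form (`gegMoment_jacobiP`) turn the transform of each term into a Bessel
function (`fourierInt_jacobiP`), which is the series for `ψ`. At `x = 1` it gives the numerator of
the formula for `μ`, and the Gegenbauer expansion itself, whose sum is `ψ(1) ≠ 0`, the denominator.
-/

open MeasureTheory Topology

/-! ### The weight and the Lagrange identity -/

lemma one_sub_sq_pos {x : ℝ} (hx : x ∈ Ioo (-1 : ℝ) 1) : 0 < 1 - x ^ 2 := by
  nlinarith [hx.1, hx.2]

lemma gegWeight_pos (α : ℝ) {x : ℝ} (hx : x ∈ Ioo (-1 : ℝ) 1) : 0 < gegWeight α x :=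
  Real.rpow_pos_of_pos (one_sub_sq_pos hx) α

lemma gegWeight_nonneg (α : ℝ) {x : ℝ} (hx : x ∈ Icc (-1 : ℝ) 1) : 0 ≤ gegWeight α x :=
  Real.rpow_nonneg (by nlinarith [hx.1, hx.2]) α

lemma gegWeight_neg (α x : ℝ) : gegWeight α (-x) = gegWeight α x := by
  simp [gegWeight]

lemma gegWeight_add_one (α : ℝ) {x : ℝ} (hx : x ∈ Ioo (-1 : ℝ) 1) :
    gegWeight (α + 1) x = (1 - x ^ 2) * gegWeight α x := by
  rw [gegWeight, gegWeight, Real.rpow_add_one (one_sub_sq_pos hx).ne', mul_comm]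

lemma continuous_gegWeight_add_one {α : ℝ} (hα : -1 < α) : Continuous (gegWeight (α + 1)) := by
  unfold gegWeight
  exact Continuous.rpow_const (by fun_prop) fun x => Or.inr (by linarith)

lemma gegWeight_add_one_one {α : ℝ} (hα : -1 < α) : gegWeight (α + 1) 1 = 0 := by
  simp [gegWeight, Real.zero_rpow (by linarith : α + 1 ≠ 0)]

lemma gegWeight_add_one_neg_one {α : ℝ} (hα : -1 < α) : gegWeight (α + 1) (-1) = 0 := by
  rw [gegWeight_neg, gegWeight_add_one_one hα]

lemma intervalIntegrable_gegWeight {α : ℝ} (hα : -1 < α) :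
    IntervalIntegrable (gegWeight α) volume (-1) 1 := by
  have h1 : IntervalIntegrable (gegWeight α) volume 0 1 := by
    have h := (intervalIntegral.intervalIntegrable_rpow' (a := 1) (b := 0) hα).comp_sub_left 1
    simp only [sub_self, sub_zero] at h
    have h2 := h.continuousOn_mul (g := fun x : ℝ => (1 + x) ^ α) (by
      refine ContinuousOn.rpow_const (by fun_prop) fun x hx => Or.inl ?_
      rw [uIcc_of_le zero_le_one] at hx
      linarith [hx.1])
    refine h2.congr fun x hx => ?_
    rw [uIoc_of_le zero_le_one] at hx
    simp only [gegWeight]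
    rw [← Real.mul_rpow (by linarith [hx.1]) (by linarith [hx.2])]
    ring_nf
  have h2 : IntervalIntegrable (gegWeight α) volume (-1) 0 := by
    have h := (IntervalIntegrable.iff_comp_neg (f := gegWeight α) (a := 0) (b := 1)).1 h1
    simp only [gegWeight_neg, neg_zero] at h
    exact h.symm
  exact h2.trans h1

section

variable {E : Type*} [NormedAddCommGroup E] [NormedSpace ℝ E]

lemma intervalIntegrable_gegWeight_smul {α : ℝ} (hα : -1 < α) {a b : ℝ} (ha : -1 ≤ a)
    (hab : a ≤ b) (hb : b ≤ 1) {f : ℝ → E} (hf : ContinuousOn f (Icc a b)) :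
    IntervalIntegrable (fun y => gegWeight α y • f y) volume a b := by
  refine IntervalIntegrable.smul_continuousOn ?_ (by rwa [uIcc_of_le hab])
  refine (intervalIntegrable_gegWeight hα).mono_set ?_
  rw [uIcc_of_le hab, uIcc_of_le (by norm_num)]
  exact Icc_subset_Icc ha hb

lemma intervalIntegrable_mul_gegWeight {α : ℝ} (hα : -1 < α) {a b : ℝ} (ha : -1 ≤ a)
    (hab : a ≤ b) (hb : b ≤ 1) {f : ℝ → ℝ} (hf : ContinuousOn f (Icc a b)) :
    IntervalIntegrable (fun y => f y * gegWeight α y) volume a b := by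
  simpa [mul_comm] using intervalIntegrable_gegWeight_smul hα ha hab hb hf

lemma integral_sq_mul_gegWeight_pos {α : ℝ} (hα : -1 < α) {a b x : ℝ} (ha : -1 ≤ a)
    (hb : b ≤ 1) (hx : x ∈ Ioo a b) {φ : ℝ → ℝ} (hφ : ContinuousOn φ (Icc a b)) (hne : φ x ≠ 0) :
    0 < ∫ y in a..b, φ y * φ y * gegWeight α y := by
  have hab : a < b := hx.1.trans hx.2
  have hw : ∀ y ∈ Icc a b, 0 ≤ φ y * φ y * gegWeight α y := fun y hy =>
    mul_nonneg (mul_self_nonneg _) (gegWeight_nonneg α ⟨ha.trans hy.1, hy.2.trans hb⟩)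
  rw [intervalIntegral.integral_pos_iff_support_of_nonneg_ae' ?_
    (intervalIntegrable_mul_gegWeight (f := fun y => φ y * φ y) hα ha hab.le hb (hφ.mul hφ))]
  · refine ⟨hab, ?_⟩
    have ho : IsOpen (Ioo a b ∩ φ ⁻¹' {0}ᶜ) :=
      (hφ.mono Ioo_subset_Icc_self).isOpen_inter_preimage isOpen_Ioo isOpen_compl_singleton
    refine (ho.measure_pos volume ⟨x, hx, hne⟩).trans_le (measure_mono ?_)
    rintro y ⟨hy, hy0⟩
    refine ⟨?_, Ioo_subset_Ioc_self hy⟩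
    exact mul_ne_zero (mul_ne_zero hy0 hy0)
      (gegWeight_pos α ⟨ha.trans_lt hy.1, hy.2.trans_le hb⟩).ne'
  · rw [uIoc_of_le hab.le]
    filter_upwards [ae_restrict_mem measurableSet_Ioc] with y hy
    exact hw y (Ioc_subset_Icc_self hy)

/-- `φ1` and `φ2` are the first two derivatives of `φ` on `s`, one-sided at the end points, and
`φ2` is continuous: `φ` is `C²` on `s` with named derivatives. -/
structure HasC2On (φ φ1 φ2 : ℝ → E) (s : Set ℝ) : Prop where
  deriv1 : ∀ x ∈ s, HasDerivWithinAt φ (φ1 x) s x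
  deriv2 : ∀ x ∈ s, HasDerivWithinAt φ1 (φ2 x) s x
  cont2 : ContinuousOn φ2 s

namespace HasC2On

variable {φ φ1 φ2 : ℝ → E} {s t : Set ℝ}

lemma cont (h : HasC2On φ φ1 φ2 s) : ContinuousOn φ s :=
  fun x hx => (h.deriv1 x hx).continuousWithinAt

lemma cont1 (h : HasC2On φ φ1 φ2 s) : ContinuousOn φ1 s :=
  fun x hx => (h.deriv2 x hx).continuousWithinAt

lemma mono (h : HasC2On φ φ1 φ2 s) (hts : t ⊆ s) : HasC2On φ φ1 φ2 t :=
  ⟨fun x hx => (h.deriv1 x (hts hx)).mono hts, fun x hx => (h.deriv2 x (hts hx)).mono hts,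
    h.cont2.mono hts⟩

lemma hasDerivAt (h : HasC2On φ φ1 φ2 s) {x : ℝ} (hs : s ∈ 𝓝 x) : HasDerivAt φ (φ1 x) x :=
  (h.deriv1 x (mem_of_mem_nhds hs)).hasDerivAt hs

lemma hasDerivAt1 (h : HasC2On φ φ1 φ2 s) {x : ℝ} (hs : s ∈ 𝓝 x) : HasDerivAt φ1 (φ2 x) x :=
  (h.deriv2 x (mem_of_mem_nhds hs)).hasDerivAt hs

lemma of_hasDerivAt (h1 : ∀ x ∈ s, HasDerivAt φ (φ1 x) x) (h2 : ∀ x ∈ s, HasDerivAt φ1 (φ2 x) x)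
    (h3 : ContinuousOn φ2 s) : HasC2On φ φ1 φ2 s :=
  ⟨fun x hx => (h1 x hx).hasDerivWithinAt, fun x hx => (h2 x hx).hasDerivWithinAt, h3⟩

end HasC2On

/-- The self-adjoint form of the leading part of the operator:
`((1 - y²)^{α+1} φ')' = ω_α ((1 - y²) φ'' - (2α + 2) y φ')`. -/
lemma hasDerivAt_gegWeight_smul (α : ℝ) {φ1 φ2 : ℝ → E} {y : ℝ} (hy : y ∈ Ioo (-1 : ℝ) 1)
    (h : HasDerivAt φ1 (φ2 y) y) :
    HasDerivAt (fun y => gegWeight (α + 1) y • φ1 y)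
      (gegWeight α y • ((1 - y ^ 2) • φ2 y - ((2 * α + 2) * y) • φ1 y)) y := by
  have h0 : HasDerivAt (fun y : ℝ => 1 - y ^ 2) (-(2 * y)) y := by
    simpa using (hasDerivAt_pow 2 y).const_sub 1
  have h1 : HasDerivAt (gegWeight (α + 1)) (-(2 * α + 2) * y * gegWeight α y) y := by
    have := h0.rpow_const (p := α + 1) (Or.inl (one_sub_sq_pos hy).ne')
    convert! this using 1
    simp only [gegWeight, add_sub_cancel_right]
    ring
  convert! h1.smul h using 1
  rw [gegWeight_add_one α hy, smul_sub, smul_smul, smul_smul, sub_eq_add_neg, ← neg_smul]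
  congr 2 <;> ring

/-- The Lagrange identity for `φ ↦ (1 - y²) φ'' - (2α + 2) y φ'` in `L²(ω_α)`. -/
lemma integral_lagrange [CompleteSpace E] {α : ℝ} (hα : -1 < α) {a b : ℝ} (ha : -1 ≤ a)
    (hab : a ≤ b) (hb : b ≤ 1) {φ φ1 φ2 : ℝ → ℝ} {g g1 g2 : ℝ → E}
    (hφ : HasC2On φ φ1 φ2 (Icc a b)) (hg : HasC2On g g1 g2 (Icc a b)) :
    ∫ y in a..b, gegWeight α y • (φ y • ((1 - y ^ 2) • g2 y - ((2 * α + 2) * y) • g1 y)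
        - ((1 - y ^ 2) * φ2 y - ((2 * α + 2) * y) * φ1 y) • g y)
      = gegWeight (α + 1) b • (φ b • g1 b - φ1 b • g b)
        - gegWeight (α + 1) a • (φ a • g1 a - φ1 a • g a) := by
  have hφ0 := hφ.cont
  have hφ1 := hφ.cont1
  have hφ2 := hφ.cont2
  have hg0 := hg.cont
  have hg1 := hg.cont1
  have hg2 := hg.cont2
  refine intervalIntegral.integral_eq_sub_of_hasDerivAt_of_le
    (f := fun y => gegWeight (α + 1) y • (φ y • g1 y - φ1 y • g y)) hab ?_ ?_ ?_
  · exact (continuous_gegWeight_add_one hα).continuousOn.smul (by fun_prop)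
  · intro x hx
    have hxs : Icc a b ∈ 𝓝 x := Icc_mem_nhds hx.1 hx.2
    have hx' : x ∈ Ioo (-1 : ℝ) 1 := ⟨by linarith [hx.1], by linarith [hx.2]⟩
    have e1 := (hφ.hasDerivAt hxs).smul (hasDerivAt_gegWeight_smul α hx' (hg.hasDerivAt1 hxs))
    have e2 := (hasDerivAt_gegWeight_smul α hx' (hφ.hasDerivAt1 hxs)).smul (hg.hasDerivAt hxs)
    convert! e1.sub e2 using 1
    · ext y
      simp only [Pi.smul_apply', Pi.sub_apply, smul_eq_mul]
      module
    · simp only [smul_eq_mul]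
      module
  · refine intervalIntegrable_gegWeight_smul hα ha hab hb ?_
    fun_prop

end

/-! ### The solution that is regular at the end point `1` -/

lemma summable_powerSeries {a : ℕ → ℝ} {C ρ t : ℝ} (hρ : 0 < ρ) (h : ∀ k, |a k| ≤ C * ρ ^ k)
    (ht : |t| * ρ < 1) : Summable fun k => a k * t ^ k := by
  refine Summable.of_norm_bounded (g := fun k : ℕ => C * (|t| * ρ) ^ k)
    ((summable_geometric_of_lt_one (by positivity) ht).mul_left C) fun k => ?_
  rw [norm_mul, norm_pow, Real.norm_eq_abs, Real.norm_eq_abs, mul_pow, mul_comm (|t| ^ k),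
    ← mul_assoc]
  gcongr
  exact h k

/-- Coefficients of geometric growth `ρ` keep, when multiplied by the index, the growth `ρ'` for
every `ρ' > ρ`; this bounds the coefficients of a derived power series. -/
lemma deriv_coeff_bound {C ρ ρ' : ℝ} (hρ : 0 < ρ) (hρ' : ρ < ρ') (hC : 0 ≤ C) :
    ∃ C', 0 ≤ C' ∧ ∀ a : ℕ → ℝ, (∀ k, |a k| ≤ C * ρ ^ k) →
      ∀ k : ℕ, |((k : ℝ) + 1) * a (k + 1)| ≤ C' * ρ' ^ k := by
  have hq : ρ / ρ' < 1 := (div_lt_one (hρ.trans hρ')).2 hρ'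
  have hq0 : 0 ≤ ρ / ρ' := div_nonneg hρ.le (hρ.trans hρ').le
  have hlim := tendsto_self_mul_const_pow_of_lt_one hq0 hq
  obtain ⟨D, hD⟩ := hlim.bddAbove_range
  have hD' : ∀ k : ℕ, (k : ℝ) * (ρ / ρ') ^ k ≤ D := fun k => hD ⟨k, rfl⟩
  have hD0 : 0 ≤ D := by simpa using hD' 0
  have hp : 0 < ρ' := hρ.trans hρ'
  refine ⟨C * D * ρ', by positivity, fun a h k => ?_⟩
  have h1 := hD' (k + 1)
  rw [div_pow, mul_div_assoc', div_le_iff₀ (by positivity)] at h1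
  push_cast at h1
  rw [abs_mul, abs_of_nonneg (by positivity : (0 : ℝ) ≤ (k : ℝ) + 1)]
  calc ((k : ℝ) + 1) * |a (k + 1)| ≤ ((k : ℝ) + 1) * (C * ρ ^ (k + 1)) := by
        gcongr; exact h (k + 1)
    _ = C * (((k : ℝ) + 1) * ρ ^ (k + 1)) := by ring
    _ ≤ C * (D * ρ' ^ (k + 1)) := by gcongr
    _ = C * D * ρ' * ρ' ^ k := by ring

lemma hasDerivAt_powerSeries {a : ℕ → ℝ} {C ρ t : ℝ} (hρ : 0 < ρ) (hC : 0 ≤ C)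
    (h : ∀ k, |a k| ≤ C * ρ ^ k) (ht : |t| * ρ < 1) :
    HasDerivAt (fun t => ∑' k, a k * t ^ k) (∑' k : ℕ, ((k : ℝ) + 1) * a (k + 1) * t ^ k) t := by
  obtain ⟨r, hr1, hr2⟩ := exists_between ((lt_div_iff₀ hρ).2 ht)
  have hr0 : 0 < r := (abs_nonneg t).trans_lt hr1
  rw [lt_div_iff₀ hρ] at hr2
  -- the intermediate radius leaves room for the factor `k + 1` of the derived series
  obtain ⟨s, hs1, hs2⟩ := exists_between ((lt_div_iff₀ hr0).2 (mul_comm r ρ ▸ hr2))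
  rw [lt_div_iff₀ hr0] at hs2
  have hs0 := hρ.trans hs1
  obtain ⟨C', hC', hb⟩ := deriv_coeff_bound hρ hs1 hC
  have hb := hb a h
  have hsum : Summable fun k : ℕ => C' * (s * r) ^ k :=
    (summable_geometric_of_lt_one (by positivity) hs2).mul_left C'
  have hder := hasDerivAt_tsum_of_isPreconnected (u := fun k => if k = 0 then 0 else
      C' * (s * r) ^ (k - 1)) (t := Metric.ball (0 : ℝ) r)
    (g := fun k t => a k * t ^ k) (g' := fun k t => a k * ((k : ℝ) * t ^ (k - 1)))
    (y₀ := 0) (y := t) ?_ Metric.isOpen_ball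
    (convex_ball (0 : ℝ) r).isPreconnected ?_ ?_ (by simpa) ?_ (by simpa using hr1)
  · convert! hder using 1
    have hs : Summable fun k : ℕ => a k * ((k : ℝ) * t ^ (k - 1)) := by
      rw [← summable_nat_add_iff 1]
      have := summable_powerSeries (t := t) hs0 hb (by
        calc |t| * s ≤ r * s := by gcongr
          _ < 1 := by linarith)
      convert! this using 2 with k
      simp only [Nat.cast_add, Nat.cast_one, Nat.add_sub_cancel]
      ring
    rw [hs.tsum_eq_zero_add]
    simp only [Nat.cast_zero, zero_mul, mul_zero, zero_add, Nat.cast_add, Nat.cast_one,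
      Nat.add_sub_cancel]
    exact tsum_congr fun k => by ring
  · rw [← summable_nat_add_iff 1]
    simpa using hsum
  · intro k y _
    exact (hasDerivAt_pow k y).const_mul _
  · intro k y hy
    rcases k with _ | k
    · simp
    · have hy : |y| < r := by simpa using hy
      have := hb k
      simp only [Nat.add_sub_cancel, Nat.add_eq_zero_iff, one_ne_zero, and_false, if_false,
        Nat.cast_add, Nat.cast_one, Real.norm_eq_abs]
      calc |a (k + 1) * (((k : ℝ) + 1) * y ^ k)| = |((k : ℝ) + 1) * a (k + 1)| * |y| ^ k := by
            rw [← abs_pow, ← abs_mul]; ring_nf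
        _ ≤ C' * s ^ k * r ^ k := by gcongr
        _ = C' * (s * r) ^ k := by ring
  · exact summable_powerSeries hρ h (by simp)

/-- The coefficients of the solution of `L_c u = -χ u` with `u(1) = 1` that is analytic at `1`, in
powers of `1 - x`. -/
noncomputable def frobCoeff (α c χ : ℝ) : ℕ → ℝ
  | 0 => 1
  | 1 => (c ^ 2 - χ) / (2 * (α + 1))
  | 2 => ((2 * α + 2 - χ + c ^ 2) * ((c ^ 2 - χ) / (2 * (α + 1))) - 2 * c ^ 2) / (4 * (α + 2))
  | k + 3 => ((((k : ℝ) + 2) * (k + 2 * α + 3) - χ + c ^ 2) * frobCoeff α c χ (k + 2)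
      - 2 * c ^ 2 * frobCoeff α c χ (k + 1) + c ^ 2 * frobCoeff α c χ k)
      / (2 * ((k : ℝ) + 3) * (k + α + 3))

lemma continuous_frobCoeff (α c : ℝ) (k : ℕ) : Continuous fun χ => frobCoeff α c χ k := by
  induction k using Nat.strong_induction_on with
  | _ k ih =>
    match k with
    | 0 => simp only [frobCoeff]; fun_prop
    | 1 => simp only [frobCoeff]; fun_prop
    | 2 => simp only [frobCoeff]; fun_prop
    | k + 3 =>
      have h0 := ih k (by omega)
      have h1 := ih (k + 1) (by omega)
      have h2 := ih (k + 2) (by omega)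
      simp only [frobCoeff]
      fun_prop

/-- The ratio of consecutive coefficients tends to `1 / 2`, so any ratio above `1 / 2` bounds
them, uniformly for bounded `χ`. -/
lemma exists_frobCoeff_bound {α : ℝ} (hα : -1 < α) (c B : ℝ) :
    ∃ C, 0 ≤ C ∧ ∀ χ, |χ| ≤ B → ∀ k, |frobCoeff α c χ k| ≤ C * (3 / 4 : ℝ) ^ k := by
  obtain ⟨N, hN⟩ := exists_nat_ge (8 * |α| + 10 * (B + c ^ 2) + 25 * c ^ 2 + 1)
  have hfin : ∀ n : ℕ, ∃ C, 0 ≤ C ∧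
      ∀ χ, |χ| ≤ B → ∀ k, k < n → |frobCoeff α c χ k| ≤ C * (3 / 4 : ℝ) ^ k := by
    intro n
    induction n with
    | zero => exact ⟨0, le_rfl, fun χ _ k hk => absurd hk (by omega)⟩
    | succ n ih =>
      obtain ⟨C, hC, h⟩ := ih
      obtain ⟨D, hD⟩ := (isCompact_Icc (a := -B) (b := B)).exists_bound_of_continuousOn
        (continuous_frobCoeff α c n).continuousOn
      refine ⟨C + |D| / (3 / 4 : ℝ) ^ n, by positivity, fun χ hχ k hk => ?_⟩
      rcases Nat.lt_succ_iff_lt_or_eq.1 hk with hk | rfl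
      · refine (h χ hχ k hk).trans ?_
        gcongr
        exact le_add_of_nonneg_right (by positivity)
      · rw [add_mul, div_mul_cancel₀ _ (by positivity)]
        have := hD χ (abs_le.1 hχ)
        rw [Real.norm_eq_abs] at this
        have h2 := le_abs_self D
        have h3 : 0 ≤ C * (3 / 4 : ℝ) ^ k := by positivity
        linarith
  obtain ⟨C, hC, hlow⟩ := hfin (N + 3)
  refine ⟨C, hC, fun χ hχ k => ?_⟩
  induction k using Nat.strong_induction_on with
  | _ k ih =>
    by_cases hk : k < N + 3
    · exact hlow χ hχ k hk
    obtain ⟨j, rfl⟩ : ∃ j, k = j + 3 := ⟨k - 3, by omega⟩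
    have hjN : (N : ℝ) ≤ j := by exact_mod_cast (by omega : N ≤ j)
    have h0 := ih j (by omega)
    have h1 := ih (j + 1) (by omega)
    have h2 := ih (j + 2) (by omega)
    set m : ℝ := (j : ℝ) + 2 with hm
    have hB : 0 ≤ B := (abs_nonneg _).trans hχ
    have hα' := neg_abs_le α
    have hα'' := le_abs_self α
    have hm1 : 8 * |α| + 10 * (B + c ^ 2) + 25 * c ^ 2 + 1 ≤ m := by linarith
    have hc2 := sq_nonneg c
    have hαa := abs_nonneg α
    have hm2 : 1 ≤ m := by linarith
    have hden : m ^ 2 ≤ (m + 1) * (m + α + 1) := by nlinarith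
    have hdpos : 0 < 2 * (m + 1) * (m + α + 1) := by nlinarith
    have hA : m * (m + 2 * α + 1) + B + c ^ 2 ≤ 0.6 * (2 * (m + 1) * (m + α + 1)) := by
      have e1 : 8 * |α| * m ≤ m * m - (10 * (B + c ^ 2) + 1) * m := by nlinarith
      have e2 : 10 * (B + c ^ 2) ≤ 10 * (B + c ^ 2) * m := by nlinarith
      have e3 : α * m ≤ |α| * m := by gcongr
      nlinarith
    have hE : 2 * c ^ 2 ≤ 0.04 * (2 * (m + 1) * (m + α + 1)) := by
      have : 25 * c ^ 2 ≤ m ^ 2 := by nlinarith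
      nlinarith
    have hA' : |m * (m + 2 * α + 1) - χ + c ^ 2| ≤ 0.6 * (2 * (m + 1) * (m + α + 1)) := by
      obtain ⟨hl, hu⟩ := abs_le.1 hχ
      have h0 : 0 ≤ m * (m + 2 * α + 1) := mul_nonneg (by linarith) (by linarith)
      rw [abs_le]
      constructor <;> linarith
    have hrec : frobCoeff α c χ (j + 3) = ((m * (m + 2 * α + 1) - χ + c ^ 2)
        * frobCoeff α c χ (j + 2) - 2 * c ^ 2 * frobCoeff α c χ (j + 1)
        + c ^ 2 * frobCoeff α c χ j) / (2 * (m + 1) * (m + α + 1)) := by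
      rw [frobCoeff, hm]
      ring_nf
    rw [hrec, abs_div, abs_of_pos hdpos, div_le_iff₀ hdpos]
    set d := 2 * (m + 1) * (m + α + 1) with hd
    calc _ ≤ |m * (m + 2 * α + 1) - χ + c ^ 2| * |frobCoeff α c χ (j + 2)|
          + 2 * c ^ 2 * |frobCoeff α c χ (j + 1)| + c ^ 2 * |frobCoeff α c χ j| := by
          refine (abs_add_le _ _).trans (add_le_add ((abs_sub _ _).trans (add_le_add ?_ ?_)) ?_)
          · rw [abs_mul]
          · rw [abs_mul, abs_of_nonneg (by positivity : 0 ≤ 2 * c ^ 2)]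
          · rw [abs_mul, abs_of_nonneg hc2]
      _ ≤ (0.6 * d) * (C * (3 / 4 : ℝ) ^ (j + 2)) + (0.04 * d) * (C * (3 / 4 : ℝ) ^ (j + 1))
          + (0.04 * d) * (C * (3 / 4 : ℝ) ^ j) := by
          gcongr
          linarith
      _ = (0.6 * (3 / 4) ^ 2 + 0.04 * (3 / 4) + 0.04) * (d * (C * (3 / 4 : ℝ) ^ j)) := by ring
      _ ≤ (3 / 4) ^ 3 * (d * (C * (3 / 4 : ℝ) ^ j)) := by gcongr; norm_num
      _ = C * (3 / 4 : ℝ) ^ (j + 3) * d := by ring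

/-- The solution of `L_c u = -χ u` with `u(1) = 1` that is analytic at `1`, by its power series
there (the Frobenius method). It is used for `|1 - x| < 5 / 4` only. -/
noncomputable def frob (α c χ x : ℝ) : ℝ := ∑' k, frobCoeff α c χ k * (1 - x) ^ k

/-- The derivative of `frob`. -/
noncomputable def frob1 (α c χ x : ℝ) : ℝ :=
  -∑' k : ℕ, ((k : ℝ) + 1) * frobCoeff α c χ (k + 1) * (1 - x) ^ k

/-- The second derivative of `frob`. -/
noncomputable def frob2 (α c χ x : ℝ) : ℝ :=
  ∑' k : ℕ, ((k : ℝ) + 1) * (((k + 1 : ℕ) : ℝ) + 1) * frobCoeff α c χ (k + 2) * (1 - x) ^ k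

lemma frob_one (α c χ : ℝ) : frob α c χ 1 = 1 := by
  rw [frob, tsum_eq_single 0 fun k hk => by simp [hk]]
  simp [frobCoeff]

section FrobODE

variable {α c χ x : ℝ}

lemma hasDerivAt_frob (hα : -1 < α) (hx : x ∈ Ioo (-1 / 4 : ℝ) (9 / 4)) :
    HasDerivAt (frob α c χ) (frob1 α c χ x) x := by
  obtain ⟨C, hC, hb⟩ := exists_frobCoeff_bound hα c |χ|
  have ht : |1 - x| * (3 / 4) < 1 := by
    have : |1 - x| < 5 / 4 := abs_lt.2 ⟨by linarith [hx.2], by linarith [hx.1]⟩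
    linarith
  have h := hasDerivAt_powerSeries (by norm_num) hC (hb χ le_rfl) ht
  have h2 := h.comp x ((hasDerivAt_id x).const_sub 1)
  convert! h2 using 1
  simp [frob1]

lemma hasDerivAt_frob1 (hα : -1 < α) (hx : x ∈ Ioo (-1 / 4 : ℝ) (9 / 4)) :
    HasDerivAt (frob1 α c χ) (frob2 α c χ x) x := by
  obtain ⟨C, hC, hb⟩ := exists_frobCoeff_bound hα c |χ|
  obtain ⟨C', hC', hb'⟩ := deriv_coeff_bound (C := C)
    (by norm_num : (0 : ℝ) < 3 / 4) (by norm_num : (3 / 4 : ℝ) < 4 / 5) hC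
  have ht : |1 - x| * (4 / 5) < 1 := by
    have : |1 - x| < 5 / 4 := abs_lt.2 ⟨by linarith [hx.2], by linarith [hx.1]⟩
    linarith
  have h := hasDerivAt_powerSeries (by norm_num) hC' (hb' _ (hb χ le_rfl)) ht
  have h2 := (h.comp x ((hasDerivAt_id x).const_sub 1)).neg
  convert! h2 using 1
  simp only [frob2, mul_neg, mul_one, neg_neg]
  exact tsum_congr fun k => by ring

lemma hasSum_frob (hα : -1 < α) (hx : x ∈ Ioo (-1 / 4 : ℝ) (9 / 4)) :
    HasSum (fun k => frobCoeff α c χ k * (1 - x) ^ k) (frob α c χ x) ∧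
    HasSum (fun k : ℕ => ((k : ℝ) + 1) * frobCoeff α c χ (k + 1) * (1 - x) ^ k)
      (-frob1 α c χ x) ∧
    HasSum (fun k : ℕ => ((k : ℝ) + 1) * (k + 2) * frobCoeff α c χ (k + 2) * (1 - x) ^ k)
      (frob2 α c χ x) := by
  obtain ⟨C, hC, hb⟩ := exists_frobCoeff_bound hα c |χ|
  have hb := hb χ le_rfl
  obtain ⟨C1, hC1, hb1⟩ := deriv_coeff_bound (C := C)
    (by norm_num : (0 : ℝ) < 3 / 4) (by norm_num : (3 / 4 : ℝ) < 77 / 100) hC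
  have hb1 := hb1 _ hb
  obtain ⟨C2, hC2, hb2⟩ := deriv_coeff_bound (C := C1)
    (by norm_num : (0 : ℝ) < 77 / 100) (by norm_num : (77 / 100 : ℝ) < 4 / 5) hC1
  have hb2 := hb2 _ hb1
  have ht : |1 - x| < 5 / 4 := abs_lt.2 ⟨by linarith [hx.2], by linarith [hx.1]⟩
  refine ⟨(summable_powerSeries (by norm_num) hb (by linarith)).hasSum, ?_, ?_⟩
  · rw [frob1, neg_neg]
    exact (summable_powerSeries (by norm_num) hb1 (by linarith)).hasSum
  · have := (summable_powerSeries (t := 1 - x) (by norm_num) hb2 (by linarith)).hasSum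
    convert! this using 1
    · ext k
      push_cast
      ring
    · exact tsum_congr fun k => by ring

lemma frob_ode (hα : -1 < α) (hx : x ∈ Ioo (-1 / 4 : ℝ) (9 / 4)) :
    (1 - x ^ 2) * frob2 α c χ x - (2 * α + 2) * x * frob1 α c χ x
      = (c ^ 2 * x ^ 2 - χ) * frob α c χ x := by
  obtain ⟨h0, h1, h2⟩ := hasSum_frob (c := c) (χ := χ) hα hx
  set t := 1 - x with ht
  set U := frob α c χ x
  set U1 := frob1 α c χ x
  set U2 := frob2 α c χ x
  have s0 := (hasSum_nat_add_iff' 2).2 h0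
  have s1 := ((hasSum_nat_add_iff' 1).2 h0).mul_left t
  have s2 := h0.mul_left (t ^ 2)
  have s3 := (hasSum_nat_add_iff' 2).2 h1
  have s4 := ((hasSum_nat_add_iff' 1).2 h1).mul_left t
  have s5 := ((hasSum_nat_add_iff' 1).2 h2).mul_left t
  have s6 := h2.mul_left (t ^ 2)
  -- the recursion of the coefficients, from the third one on, multiplied by powers of `t`
  have key := ((((((s5.mul_left 2).sub s6).add (s3.mul_left (2 * α + 2))).sub
    (s4.mul_left (2 * α + 2))).add (s0.mul_left (χ - c ^ 2))).add
    (s1.mul_left (2 * c ^ 2))).sub (s2.mul_left (c ^ 2))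
  have hα1 : α + 1 ≠ 0 := by linarith
  have hα2 : α + 2 ≠ 0 := by linarith
  have r1 : 2 * (α + 1) * frobCoeff α c χ 1 = c ^ 2 - χ := by
    rw [frobCoeff]; field_simp
  have r2 : 4 * (α + 2) * frobCoeff α c χ 2
      = (2 * α + 2 - χ + c ^ 2) * frobCoeff α c χ 1 - 2 * c ^ 2 := by
    rw [frobCoeff, frobCoeff]; field_simp
  have hz := key.unique (hasSum_zero.congr_fun ?_)
  · have hx' : x = 1 - t := by rw [ht]; ring
    have r0 : frobCoeff α c χ 0 = 1 := rfl
    simp only [Finset.sum_range_succ, Finset.sum_range_zero, r0] at hz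
    norm_num at hz
    rw [hx']
    linear_combination hz + r1 + t * r2
  · intro k
    have hk : (k : ℝ) + 3 ≠ 0 := by positivity
    have hk' : (k : ℝ) + α + 3 ≠ 0 := by
      have : (0 : ℝ) ≤ k := by positivity
      linarith
    have r3 : 2 * ((k : ℝ) + 3) * (k + α + 3) * frobCoeff α c χ (k + 3)
        = (((k : ℝ) + 2) * (k + 2 * α + 3) - χ + c ^ 2) * frobCoeff α c χ (k + 2)
          - 2 * c ^ 2 * frobCoeff α c χ (k + 1) + c ^ 2 * frobCoeff α c χ k := by
      rw [frobCoeff]; field_simp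
    push_cast
    rw [show k + 1 + 2 = k + 3 from rfl, show k + 2 + 1 = k + 3 from rfl,
      show k + 1 + 1 = k + 2 from rfl]
    linear_combination t ^ (k + 2) * r3

end FrobODE

lemma continuous_powerSeries_param {b : ℝ → ℕ → ℝ} {ρ t : ℝ} (hρ : 0 < ρ)
    (hb : ∀ k, Continuous fun χ => b χ k)
    (h : ∀ B, ∃ C, ∀ χ, |χ| ≤ B → ∀ k, |b χ k| ≤ C * ρ ^ k) (ht : |t| * ρ < 1) :
    Continuous fun χ => ∑' k, b χ k * t ^ k := by
  rw [continuous_iff_continuousAt]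
  intro χ₀
  obtain ⟨C, hC⟩ := h (|χ₀| + 1)
  have hc : ContinuousOn (fun χ => ∑' k, b χ k * t ^ k) (Metric.ball χ₀ 1) := by
    refine continuousOn_tsum (u := fun k : ℕ => C * (|t| * ρ) ^ k)
      (fun k => ((hb k).mul continuous_const).continuousOn)
      ((summable_geometric_of_lt_one (by positivity) ht).mul_left C) fun k χ hχ => ?_
    rw [norm_mul, norm_pow, Real.norm_eq_abs, Real.norm_eq_abs, mul_pow, mul_comm (|t| ^ k),
      ← mul_assoc]
    gcongr
    refine hC χ ?_ k
    rw [Metric.mem_ball, Real.dist_eq] at hχ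
    have := abs_sub_abs_le_abs_sub χ χ₀
    linarith
  exact hc.continuousAt (Metric.ball_mem_nhds χ₀ one_pos)

lemma continuous_frob {α : ℝ} (hα : -1 < α) (c : ℝ) {x : ℝ} (hx : x ∈ Icc (0 : ℝ) 1) :
    Continuous fun χ => frob α c χ x := by
  refine continuous_powerSeries_param (ρ := 3 / 4) (by norm_num) (continuous_frobCoeff α c)
    (fun B => ?_) ?_
  · obtain ⟨C, -, h⟩ := exists_frobCoeff_bound hα c B
    exact ⟨C, h⟩
  · have : |1 - x| ≤ 1 := abs_le.2 ⟨by linarith [hx.2], by linarith [hx.1]⟩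
    linarith

lemma continuous_frob1_zero {α : ℝ} (hα : -1 < α) (c : ℝ) :
    Continuous fun χ => frob1 α c χ 0 := by
  refine (continuous_powerSeries_param (ρ := 4 / 5) (b := fun χ k =>
    ((k : ℝ) + 1) * frobCoeff α c χ (k + 1)) (by norm_num)
    (fun k => continuous_const.mul (continuous_frobCoeff α c _)) (fun B => ?_) ?_).neg
  · obtain ⟨C, hC, h⟩ := exists_frobCoeff_bound hα c B
    obtain ⟨C', -, hb⟩ := deriv_coeff_bound (C := C)
      (by norm_num : (0 : ℝ) < 3 / 4) (by norm_num : (3 / 4 : ℝ) < 4 / 5) hC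
    exact ⟨C', fun χ hχ => hb _ (h χ hχ)⟩
  · norm_num

lemma exists_frob_bound {α : ℝ} (hα : -1 < α) (c B : ℝ) :
    ∃ C, ∀ χ, |χ| ≤ B → ∀ x ∈ Icc (0 : ℝ) 1, |frob α c χ x| ≤ C := by
  obtain ⟨C, hC, h⟩ := exists_frobCoeff_bound hα c B
  refine ⟨∑' k : ℕ, C * (3 / 4 : ℝ) ^ k, fun χ hχ x hx => ?_⟩
  refine tsum_of_norm_bounded (f := fun k => frobCoeff α c χ k * (1 - x) ^ k)
    ((summable_geometric_of_lt_one (by norm_num) (by norm_num)).mul_left C).hasSum fun k => ?_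
  rw [norm_mul, norm_pow, Real.norm_eq_abs, Real.norm_eq_abs]
  have h1 : |1 - x| ^ k ≤ 1 :=
    pow_le_one₀ (abs_nonneg _) (abs_le.2 ⟨by linarith [hx.2], by linarith [hx.1]⟩)
  calc _ ≤ (C * (3 / 4 : ℝ) ^ k) * 1 := by
        gcongr
        exact h χ hχ k
    _ = _ := mul_one _

lemma hasC2On_frob {α : ℝ} (hα : -1 < α) (c χ : ℝ) :
    HasC2On (frob α c χ) (frob1 α c χ) (frob2 α c χ) (Ioo (-1 / 4) (9 / 4)) := by
  refine .of_hasDerivAt (fun x hx => hasDerivAt_frob hα hx) (fun x hx => hasDerivAt_frob1 hα hx) ?_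
  obtain ⟨C, hC, hb⟩ := exists_frobCoeff_bound hα c |χ|
  have hb := hb χ le_rfl
  obtain ⟨C1, hC1, hb1⟩ := deriv_coeff_bound (C := C)
    (by norm_num : (0 : ℝ) < 3 / 4) (by norm_num : (3 / 4 : ℝ) < 77 / 100) hC
  obtain ⟨C2, hC2, hb2⟩ := deriv_coeff_bound (C := C1)
    (by norm_num : (0 : ℝ) < 77 / 100) (by norm_num : (77 / 100 : ℝ) < 4 / 5) hC1
  have hb2 := hb2 _ (hb1 _ hb)
  intro x hx
  have ht : |1 - x| < 5 / 4 := abs_lt.2 ⟨by linarith [hx.2], by linarith [hx.1]⟩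
  have h := (hasDerivAt_powerSeries (t := 1 - x) (by norm_num) hC2 hb2 (by linarith)).continuousAt
  have h2 : ContinuousAt (fun x : ℝ => 1 - x) x := by fun_prop
  convert! (h.comp h2).continuousWithinAt using 1
  ext y
  simp only [frob2, Function.comp]
  exact tsum_congr fun k => by ring

/-! ### Solutions of the differential equation -/

/-- `φ`, with derivatives `φ1`, `φ2`, solves `L_c φ = -χ φ` on `s`. -/
structure IsSol (α c χ : ℝ) (φ φ1 φ2 : ℝ → ℝ) (s : Set ℝ) : Prop extends HasC2On φ φ1 φ2 s where
  ode : ∀ x ∈ s, (1 - x ^ 2) * φ2 x - (2 * α + 2) * x * φ1 x = (c ^ 2 * x ^ 2 - χ) * φ x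

lemma IsSol.mono {α c χ : ℝ} {φ φ1 φ2 : ℝ → ℝ} {s t : Set ℝ} (h : IsSol α c χ φ φ1 φ2 s)
    (hts : t ⊆ s) : IsSol α c χ φ φ1 φ2 t :=
  ⟨h.toHasC2On.mono hts, fun x hx => h.ode x (hts hx)⟩

/-- The interval reaches beyond the midpoint `0` of `[-1, 1]`, where the solution is compared with
its reflection. -/
lemma isSol_frob {α : ℝ} (hα : -1 < α) (c χ : ℝ) :
    IsSol α c χ (frob α c χ) (frob1 α c χ) (frob2 α c χ) (Ioo (-1 / 4) (9 / 4)) :=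
  ⟨hasC2On_frob hα c χ, fun _ hx => frob_ode hα hx⟩

lemma IsGegEigen.exists_isSol {α c χ : ℝ} {φ : ℝ → ℝ} (h : IsGegEigen α c χ φ) :
    ∃ φ1 φ2, IsSol α c χ φ φ1 φ2 (Icc (-1) 1) := by
  obtain ⟨hC, hode⟩ := h
  have hu : UniqueDiffOn ℝ (Icc (-1 : ℝ) 1) := uniqueDiffOn_Icc (by norm_num)
  have e2 : iteratedDerivWithin 2 φ (Icc (-1) 1)
      = derivWithin (derivWithin φ (Icc (-1) 1)) (Icc (-1) 1) := by
    ext x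
    rw [iteratedDerivWithin_succ, iteratedDerivWithin_one]
  refine ⟨derivWithin φ (Icc (-1) 1), iteratedDerivWithin 2 φ (Icc (-1) 1),
    ⟨?_, ?_, hC.continuousOn_iteratedDerivWithin le_rfl hu⟩, fun x hx => ?_⟩
  · intro x hx
    exact (hC.differentiableOn (by norm_num) x hx).hasDerivWithinAt
  · intro x hx
    rw [e2]
    exact ((hC.derivWithin hu (m := 1) (by norm_num)).differentiableOn (by norm_num)
      x hx).hasDerivWithinAt
  · have := hode x hx
    rw [gegOp] at this
    linarith

lemma IsSol.isGegEigen {α c χ : ℝ} {φ φ1 φ2 : ℝ → ℝ} (h : IsSol α c χ φ φ1 φ2 (Icc (-1) 1)) :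
    IsGegEigen α c χ φ := by
  have hu : UniqueDiffOn ℝ (Icc (-1 : ℝ) 1) := uniqueDiffOn_Icc (by norm_num)
  have e1 : ∀ x ∈ Icc (-1 : ℝ) 1, derivWithin φ (Icc (-1) 1) x = φ1 x := fun x hx =>
    (h.deriv1 x hx).derivWithin (hu x hx)
  have e2 : ∀ x ∈ Icc (-1 : ℝ) 1, iteratedDerivWithin 2 φ (Icc (-1) 1) x = φ2 x := fun x hx => by
    rw [iteratedDerivWithin_succ, iteratedDerivWithin_one, derivWithin_congr e1 (e1 x hx)]
    exact (h.deriv2 x hx).derivWithin (hu x hx)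
  refine ⟨?_, fun x hx => ?_⟩
  · rw [show (2 : WithTop ℕ∞) = 1 + 1 by norm_num, contDiffOn_succ_iff_derivWithin hu]
    refine ⟨fun x hx => (h.deriv1 x hx).differentiableWithinAt, by simp, ?_⟩
    refine ContDiffOn.congr ?_ e1
    rw [show (1 : WithTop ℕ∞) = 0 + 1 by norm_num, contDiffOn_succ_iff_derivWithin hu]
    refine ⟨fun x hx => (h.deriv2 x hx).differentiableWithinAt, by simp, ?_⟩
    rw [contDiffOn_zero]
    exact h.cont2.congr fun x hx => (h.deriv2 x hx).derivWithin (hu x hx)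
  · have := h.ode x hx
    rw [gegOp, e1 x hx, e2 x hx]
    linarith

lemma IsSol.sub_const_mul {α c χ k : ℝ} {φ φ1 φ2 η η1 η2 : ℝ → ℝ} {s : Set ℝ}
    (h : IsSol α c χ φ φ1 φ2 s) (h' : IsSol α c χ η η1 η2 s) :
    IsSol α c χ (fun x => φ x - k * η x) (fun x => φ1 x - k * η1 x) (fun x => φ2 x - k * η2 x) s :=
  ⟨⟨fun x hx => (h.deriv1 x hx).sub ((h'.deriv1 x hx).const_mul k),
    fun x hx => (h.deriv2 x hx).sub ((h'.deriv2 x hx).const_mul k),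
    h.cont2.sub (continuousOn_const.mul h'.cont2)⟩,
    fun x hx => by linear_combination h.ode x hx - k * h'.ode x hx⟩

lemma IsSol.comp_neg {α c χ : ℝ} {φ φ1 φ2 : ℝ → ℝ} {s t : Set ℝ}
    (h : IsSol α c χ φ φ1 φ2 s) (hst : ∀ x ∈ t, -x ∈ s) :
    IsSol α c χ (fun x => φ (-x)) (fun x => -φ1 (-x)) (fun x => φ2 (-x)) t := by
  have hm : MapsTo (fun x : ℝ => -x) t s := hst
  have hn : ∀ x, HasDerivWithinAt (fun x : ℝ => -x) (-1) t x := fun x => hasDerivWithinAt_neg x t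
  refine ⟨⟨fun x hx => ?_, fun x hx => ?_, h.cont2.comp (by fun_prop) hm⟩, fun x hx => ?_⟩
  · simpa [Function.comp_def] using (h.deriv1 (-x) (hst x hx)).comp x (hn x) hm
  · have := ((h.deriv2 (-x) (hst x hx)).comp x (hn x) hm).neg
    simp only [mul_neg, mul_one, neg_neg] at this
    exact this
  · have := h.ode (-x) (hst x hx)
    simp only [neg_sq] at this
    rw [← this]
    ring

/-- Uniqueness for the initial value problem, away from the singular points `±1`. -/
lemma IsSol.eqOn_zero {α c χ a b x₀ : ℝ} {φ φ1 φ2 : ℝ → ℝ} (ha : -1 ≤ a) (hb : b ≤ 1)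
    (h : IsSol α c χ φ φ1 φ2 (Ioo a b)) (hx₀ : x₀ ∈ Ioo a b) (h0 : φ x₀ = 0) (h1 : φ1 x₀ = 0) :
    ∀ x ∈ Ioo a b, φ x = 0 ∧ φ1 x = 0 := by
  intro x hx
  obtain ⟨a', ha1, ha2⟩ := exists_between (lt_min hx₀.1 hx.1)
  obtain ⟨b', hb1, hb2⟩ := exists_between (max_lt hx₀.2 hx.2)
  rw [lt_min_iff] at ha2
  rw [max_lt_iff] at hb1
  have hsub : Ioo a' b' ⊆ Ioo a b := Ioo_subset_Ioo ha1.le hb2.le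
  have hsub1 : Icc a' b' ⊆ Ioo (-1) 1 := fun y hy => ⟨by linarith [hy.1], by linarith [hy.2]⟩
  -- the equation as a first order linear system `(φ, φ1)' = (φ1, q φ + r φ1)`
  let q : ℝ → ℝ := fun y => (c ^ 2 * y ^ 2 - χ) / (1 - y ^ 2)
  let r : ℝ → ℝ := fun y => (2 * α + 2) * y / (1 - y ^ 2)
  have hne : ∀ y ∈ Icc a' b', 1 - y ^ 2 ≠ 0 := fun y hy => (one_sub_sq_pos (hsub1 hy)).ne'
  have hq : ContinuousOn q (Icc a' b') := ContinuousOn.div (by fun_prop) (by fun_prop) hne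
  have hr : ContinuousOn r (Icc a' b') := ContinuousOn.div (by fun_prop) (by fun_prop) hne
  obtain ⟨Q, hQ⟩ := isCompact_Icc.exists_bound_of_continuousOn hq
  obtain ⟨R, hR⟩ := isCompact_Icc.exists_bound_of_continuousOn hr
  let v : ℝ → ℝ × ℝ → ℝ × ℝ := fun y p => (p.2, q y * p.1 + r y * p.2)
  have hv : ∀ y ∈ Ioo a' b', LipschitzOnWith (1 + |Q| + |R|).toNNReal (v y) univ := by
    intro y hy
    have hQy := (hQ y (Ioo_subset_Icc_self hy)).trans (le_abs_self Q)
    have hRy := (hR y (Ioo_subset_Icc_self hy)).trans (le_abs_self R)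
    rw [lipschitzOnWith_univ]
    refine LipschitzWith.of_dist_le_mul fun p p' => ?_
    rw [Real.coe_toNNReal _ (by positivity), dist_eq_norm, dist_eq_norm]
    have e1 : ‖(p - p').1‖ ≤ ‖p - p'‖ := norm_fst_le _
    have e2 : ‖(p - p').2‖ ≤ ‖p - p'‖ := norm_snd_le _
    have hpos := norm_nonneg (p - p')
    have eq : v y p - v y p' = ((p - p').2, q y * (p - p').1 + r y * (p - p').2) := by
      simp only [v, Prod.mk_sub_mk, Prod.fst_sub, Prod.snd_sub]
      congr 1
      ring
    rw [eq]
    refine norm_prod_le_iff.2 ⟨?_, ?_⟩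
    · refine e2.trans (le_mul_of_one_le_left hpos ?_)
      linarith [abs_nonneg Q, abs_nonneg R]
    · refine (norm_add_le _ _).trans ?_
      rw [norm_mul, norm_mul]
      calc _ ≤ |Q| * ‖p - p'‖ + |R| * ‖p - p'‖ := by gcongr
        _ ≤ _ := by linarith
  have huniq := ODE_solution_unique_of_mem_Ioo (v := v) (s := fun _ => univ) (t₀ := x₀)
    (f := fun y => (φ y, φ1 y)) (g := fun _ => ((0 : ℝ), (0 : ℝ))) hv ⟨ha2.1, hb1.1⟩
    (fun y hy => ⟨?_, mem_univ _⟩) (fun y hy => ⟨?_, mem_univ _⟩) (by simp [h0, h1])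
  · have := huniq ⟨ha2.2, hb1.2⟩
    simpa using this
  · have hnh : Ioo a b ∈ 𝓝 y := Ioo_mem_nhds (hsub hy).1 (hsub hy).2
    convert! (h.hasDerivAt hnh).prodMk (h.hasDerivAt1 hnh) using 1
    have h3 := h.ode y (hsub hy)
    have h4 := hne y (Ioo_subset_Icc_self hy)
    simp only [v, q, r]
    congr 1
    field_simp
    linarith
  · convert! hasDerivAt_const y ((0 : ℝ), (0 : ℝ)) using 1
    simp [v]

lemma IsSol.congr {α c χ : ℝ} {φ φ1 φ2 η η1 η2 : ℝ → ℝ} {s : Set ℝ} (h : IsSol α c χ φ φ1 φ2 s)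
    (h0 : EqOn η φ s) (h1 : EqOn η1 φ1 s) (h2 : EqOn η2 φ2 s) : IsSol α c χ η η1 η2 s :=
  ⟨⟨fun x hx => by rw [h1 hx]; exact (h.deriv1 x hx).congr h0 (h0 hx),
    fun x hx => by rw [h2 hx]; exact (h.deriv2 x hx).congr h1 (h1 hx), h.cont2.congr h2⟩,
    fun x hx => by rw [h0 hx, h1 hx, h2 hx]; exact h.ode x hx⟩

lemma IsSol.of_locally {α c χ : ℝ} {φ φ1 φ2 : ℝ → ℝ} {t : Set ℝ}
    (h : ∀ x ∈ t, ∃ s ∈ 𝓝 x, IsSol α c χ φ φ1 φ2 s) : IsSol α c χ φ φ1 φ2 t := by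
  refine ⟨⟨fun x hx => ?_, fun x hx => ?_, fun x hx => ?_⟩, fun x hx => ?_⟩ <;>
    obtain ⟨s, hs, hsol⟩ := h x hx
  · exact (hsol.hasDerivAt hs).hasDerivWithinAt
  · exact (hsol.hasDerivAt1 hs).hasDerivWithinAt
  · exact (hsol.cont2.continuousAt hs).continuousWithinAt
  · exact hsol.ode x (mem_of_mem_nhds hs)

section Sol

variable {α c χ : ℝ} {φ φ1 φ2 η η1 η2 : ℝ → ℝ}

lemma isSol_frob_Icc (hα : -1 < α) (c χ : ℝ) :
    IsSol α c χ (frob α c χ) (frob1 α c χ) (frob2 α c χ) (Icc 0 1) :=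
  (isSol_frob hα c χ).mono fun x hx => ⟨by linarith [hx.1], by linarith [hx.2]⟩

/-- The Lagrange identity on `[a, 1]`; the boundary term at the singular point `1` vanishes. -/
lemma IsSol.lagrange {χ' a : ℝ} (hα : -1 < α) (ha : -1 ≤ a) (ha1 : a ≤ 1)
    (h : IsSol α c χ φ φ1 φ2 (Icc a 1)) (h' : IsSol α c χ' η η1 η2 (Icc a 1)) :
    gegWeight (α + 1) a * (φ a * η1 a - φ1 a * η a)
      = (χ' - χ) * ∫ y in a..1, φ y * η y * gegWeight α y := by
  have hl := integral_lagrange hα ha ha1 le_rfl h.toHasC2On h'.toHasC2On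
  rw [gegWeight_add_one_one hα, zero_smul, zero_sub] at hl
  simp only [smul_eq_mul] at hl
  rw [← intervalIntegral.integral_const_mul, ← neg_eq_iff_eq_neg.2 hl,
    ← intervalIntegral.integral_neg]
  refine intervalIntegral.integral_congr fun y hy => ?_
  rw [uIcc_of_le ha1] at hy
  have e1 := h.ode y hy
  have e2 := h'.ode y hy
  rw [e1, e2]
  ring

lemma frob_ne_zero_or_of_mem (hα : -1 < α) (c χ : ℝ) {x₀ : ℝ} (hx₀ : x₀ ∈ Ioo (-1 / 4 : ℝ) 1) :
    frob α c χ x₀ ≠ 0 ∨ frob1 α c χ x₀ ≠ 0 := by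
  by_contra! h
  have hs := (isSol_frob hα c χ).mono (t := Ioo (-1 / 4) 1)
    fun x hx => ⟨hx.1, by linarith [hx.2]⟩
  have hz := hs.eqOn_zero (by norm_num) le_rfl hx₀ h.1 h.2
  have hc : ContinuousAt (frob α c χ) 1 := (hasDerivAt_frob hα (by norm_num)).continuousAt
  have h1 : Tendsto (frob α c χ) (𝓝[<] 1) (𝓝 1) := by
    simpa [frob_one] using hc.tendsto.mono_left nhdsWithin_le_nhds
  have h2 : Tendsto (frob α c χ) (𝓝[<] 1) (𝓝 0) := by
    refine tendsto_const_nhds.congr' ?_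
    filter_upwards [Ioo_mem_nhdsLT (by norm_num : (-1 / 4 : ℝ) < 1)] with x hx
    exact (hz x hx).1.symm
  exact one_ne_zero (tendsto_nhds_unique h1 h2)

lemma frob_ne_zero_or (hα : -1 < α) (c χ : ℝ) : frob α c χ 0 ≠ 0 ∨ frob1 α c χ 0 ≠ 0 :=
  frob_ne_zero_or_of_mem hα c χ (by norm_num)

lemma exists_frob_ne_zero (hα : -1 < α) (c χ : ℝ) : ∃ x ∈ Ioo (0 : ℝ) 1, frob α c χ x ≠ 0 := by
  have hc : ContinuousAt (frob α c χ) 1 := (hasDerivAt_frob hα (by norm_num)).continuousAt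
  have h1 : ∀ᶠ x in 𝓝[<] (1 : ℝ), frob α c χ x ≠ 0 :=
    (hc.eventually_ne (by simp [frob_one])).filter_mono nhdsWithin_le_nhds
  obtain ⟨x, hx, hx'⟩ := (h1.and (Ioo_mem_nhdsLT (zero_lt_one' ℝ))).exists
  exact ⟨x, hx', hx⟩

/-- A solution that is `C²` up to the end point `1` is a multiple of the analytic one. -/
lemma IsSol.eq_frob (hα : -1 < α) (h : IsSol α c χ φ φ1 φ2 (Icc (-1) 1)) :
    (∀ x ∈ Ioc (-1 / 4 : ℝ) 1, φ x = φ 1 * frob α c χ x) ∧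
      ∀ x ∈ Ioo (-1 / 4 : ℝ) 1, φ1 x = φ 1 * frob1 α c χ x := by
  obtain ⟨x₀, hx₀, hne⟩ := exists_frob_ne_zero hα c χ
  -- the Wronskian of two solutions with the same parameter vanishes, by the Lagrange identity
  have hw := (h.mono (Icc_subset_Icc_left (by linarith [hx₀.1]))).lagrange hα
    (by linarith [hx₀.1]) hx₀.2.le ((isSol_frob_Icc hα c χ).mono (Icc_subset_Icc_left hx₀.1.le))
  rw [sub_self, zero_mul, mul_eq_zero_iff_left
    (gegWeight_pos (α + 1) ⟨by linarith [hx₀.1], hx₀.2⟩).ne'] at hw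
  set k := φ x₀ / frob α c χ x₀ with hk
  have hs : IsSol α c χ _ _ _ (Ioo (-1 / 4) 1) :=
    (h.mono fun x hx => ⟨by linarith [hx.1], hx.2.le⟩).sub_const_mul (k := k)
      ((isSol_frob hα c χ).mono fun x hx => ⟨hx.1, by linarith [hx.2]⟩)
  have hz := hs.eqOn_zero (by norm_num) le_rfl (x₀ := x₀) ⟨by linarith [hx₀.1], hx₀.2⟩
    (by rw [hk]; field_simp; ring) (by rw [hk]; field_simp; linarith)
  have h1 : φ 1 = k := by
    have hc : ContinuousAt (frob α c χ) 1 := (hasDerivAt_frob hα (by norm_num)).continuousAt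
    have t1 : Tendsto φ (𝓝[<] 1) (𝓝 (φ 1)) := by
      refine (h.cont 1 (by norm_num)).mono_left ?_
      rw [← nhdsWithin_Ioo_eq_nhdsLT (by norm_num : (-1 : ℝ) < 1)]
      exact nhdsWithin_mono _ Ioo_subset_Icc_self
    have t2 : Tendsto (fun x => k * frob α c χ x) (𝓝[<] 1) (𝓝 k) := by
      simpa [frob_one] using (hc.tendsto.mono_left nhdsWithin_le_nhds).const_mul k
    refine tendsto_nhds_unique (t1.congr' ?_) t2
    filter_upwards [Ioo_mem_nhdsLT (by norm_num : (-1 / 4 : ℝ) < 1)] with x hx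
    linarith [(hz x hx).1]
  refine ⟨fun x hx => ?_, fun x hx => by linarith [(h1 ▸ hz x hx).2]⟩
  rcases hx.2.eq_or_lt with rfl | hlt
  · rw [frob_one, mul_one]
  · linarith [(h1 ▸ hz x ⟨hx.1, hlt⟩).1]

/-- By reflection, a solution is a multiple of the same function near the end point `-1`. -/
lemma IsSol.eq_frob_neg (hα : -1 < α) (h : IsSol α c χ φ φ1 φ2 (Icc (-1) 1)) :
    (∀ x ∈ Ioc (-1 / 4 : ℝ) 1, φ (-x) = φ (-1) * frob α c χ x) ∧
      ∀ x ∈ Ioo (-1 / 4 : ℝ) 1, -φ1 (-x) = φ (-1) * frob1 α c χ x :=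
  (h.comp_neg (t := Icc (-1) 1) fun x hx => ⟨by linarith [hx.2], by linarith [hx.1]⟩).eq_frob hα

lemma IsSol.neg_one_eq (hα : -1 < α) (h : IsSol α c χ φ φ1 φ2 (Icc (-1) 1))
    (h0 : frob α c χ 0 ≠ 0) : φ (-1) = φ 1 := by
  have e1 := (h.eq_frob hα).1 0 (by norm_num)
  have e2 := (h.eq_frob_neg hα).1 0 (by norm_num)
  rw [neg_zero, e1] at e2
  exact (mul_right_cancel₀ h0 e2).symm

lemma IsSol.neg_one_eq_neg (hα : -1 < α) (h : IsSol α c χ φ φ1 φ2 (Icc (-1) 1))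
    (h0 : frob1 α c χ 0 ≠ 0) : φ (-1) = -φ 1 := by
  have e1 := (h.eq_frob hα).2 0 (by norm_num)
  have e2 := (h.eq_frob_neg hα).2 0 (by norm_num)
  rw [neg_zero, e1, ← neg_mul] at e2
  exact (mul_right_cancel₀ h0 e2).symm

lemma IsSol.eq_mul_frob (hα : -1 < α) (h : IsSol α c χ φ φ1 φ2 (Icc (-1) 1)) {ε : ℝ}
    (hε : φ (-1) = ε * φ 1) {x : ℝ} (hx : x ∈ Icc (0 : ℝ) 1) :
    φ x = φ 1 * frob α c χ x ∧ φ (-x) = ε * φ x := by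
  have hx' : x ∈ Ioc (-1 / 4 : ℝ) 1 := ⟨by linarith [hx.1], hx.2⟩
  have e1 := (h.eq_frob hα).1 x hx'
  refine ⟨e1, ?_⟩
  rw [(h.eq_frob_neg hα).1 x hx', hε, e1, mul_assoc]

/-- Where `u` is the regular solution at `1`, exactly one of `u(0)`, `u'(0)` vanishes if `χ` is an
eigenvalue, and which one determines the parity of the eigenfunction. -/
lemma IsSol.parity (hα : -1 < α) (h : IsSol α c χ φ φ1 φ2 (Icc (-1) 1))
    (hne : ∃ x ∈ Icc (-1 : ℝ) 1, φ x ≠ 0) :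
    φ 1 ≠ 0 ∧ ((frob1 α c χ 0 = 0 ∧ φ (-1) = 1 * φ 1) ∨ (frob α c χ 0 = 0 ∧ φ (-1) = -1 * φ 1)) := by
  have h1 : φ 1 ≠ 0 := by
    intro h1
    have hm : φ (-1) = 0 := by
      rcases frob_ne_zero_or hα c χ with h0 | h0
      · rw [h.neg_one_eq hα h0, h1]
      · rw [h.neg_one_eq_neg hα h0, h1, neg_zero]
    obtain ⟨x, hx, hφ⟩ := hne
    rcases le_total 0 x with h0 | h0
    · exact hφ (by rw [(h.eq_mul_frob hα (ε := 1) (by rw [h1, hm]; simp) ⟨h0, hx.2⟩).1, h1, zero_mul])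
    · have hx' : -x ∈ Icc (0 : ℝ) 1 := ⟨by linarith, by linarith [hx.1]⟩
      have := h.eq_mul_frob hα (ε := 1) (by rw [h1, hm]; simp) hx'
      rw [neg_neg, this.1, h1] at this
      exact hφ (by rw [this.2]; ring)
  refine ⟨h1, ?_⟩
  by_cases h0 : frob α c χ 0 = 0
  · right
    refine ⟨h0, ?_⟩
    have := h.neg_one_eq_neg hα ((frob_ne_zero_or hα c χ).resolve_left (not_not.2 h0))
    linarith
  · left
    have e := h.neg_one_eq hα h0
    refine ⟨?_, by linarith⟩
    by_contra h2
    have := h.neg_one_eq_neg hα h2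
    exact h1 (by linarith)

/-- The even or odd extension of the regular solution `u` from `[0, 1]` is an eigenfunction if
`u'(0) = 0` or `u(0) = 0`, respectively. -/
lemma mem_gegSpectrum_of_frob (hα : -1 < α) {ε : ℝ} (hε : ε = 1 ∨ ε = -1)
    (h0 : (1 - ε) * frob α c χ 0 = 0) (h1 : (1 + ε) * frob1 α c χ 0 = 0) :
    χ ∈ gegSpectrum α c := by
  have hε2 : ε * ε = 1 := by rcases hε with rfl | rfl <;> norm_num
  have hu := isSol_frob hα c χ
  set u := frob α c χ
  set u1 := frob1 α c χ
  set u2 := frob2 α c χ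
  have hz : IsSol α c χ (fun _ => 0) (fun _ => 0) (fun _ => 0) (Ioo (-9 / 4 : ℝ) (1 / 4)) :=
    ⟨.of_hasDerivAt (fun x _ => hasDerivAt_const x 0) (fun x _ => hasDerivAt_const x 0)
      continuousOn_const, fun x _ => by ring⟩
  -- the reflection `x ↦ ε u(-x)`
  have hv : IsSol α c χ (fun x => ε * u (-x)) (fun x => -(ε * u1 (-x))) (fun x => ε * u2 (-x))
      (Ioo (-9 / 4) (1 / 4)) := by
    have h := hz.sub_const_mul (k := -ε) (hu.comp_neg (t := Ioo (-9 / 4) (1 / 4))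
      fun x hx => ⟨by linarith [hx.2], by linarith [hx.1]⟩)
    refine h.congr (fun x _ => ?_) (fun x _ => ?_) (fun x _ => ?_) <;> ring
  have hw : IsSol α c χ _ _ _ (Ioo (-1 / 4 : ℝ) (1 / 4)) :=
    (hu.mono fun x hx => ⟨hx.1, by linarith [hx.2]⟩).sub_const_mul (k := 1)
      (hv.mono fun x hx => ⟨by linarith [hx.1], hx.2⟩)
  have hw0 := hw.eqOn_zero (by norm_num) (by norm_num) (x₀ := 0) (by norm_num)
    (by simp only [neg_zero]; linarith) (by simp only [neg_zero]; linarith)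
  have hw2 : ∀ x ∈ Ioo (-1 / 4 : ℝ) (1 / 4), u2 x = ε * u2 (-x) := by
    intro x hx
    have hode := hw.ode x hx
    rw [(hw0 x hx).1, (hw0 x hx).2] at hode
    have hp := one_sub_sq_pos (x := x) ⟨by linarith [hx.1], by linarith [hx.2]⟩
    have : (1 - x ^ 2) * (u2 x - 1 * (ε * u2 (-x))) = 0 := by linarith
    rcases mul_eq_zero.1 this with h | h
    · exact absurd h hp.ne'
    · linarith
  -- the two halves agree on a neighbourhood of `0`, so that they can be glued there
  have key : IsSol α c χ (fun x => if 0 ≤ x then u x else ε * u (-x))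
      (fun x => if 0 ≤ x then u1 x else -(ε * u1 (-x)))
      (fun x => if 0 ≤ x then u2 x else ε * u2 (-x)) (Icc (-1) 1) := by
    refine .of_locally fun x hx => ?_
    rcases le_or_gt 0 x with h | h
    · refine ⟨Ioo (-1 / 4) (9 / 4), Ioo_mem_nhds (by linarith) (by linarith [hx.2]), hu.congr ?_ ?_ ?_⟩
        <;> intro y hy <;> dsimp only <;> split_ifs with hy0
      · rfl
      · have := (hw0 y ⟨hy.1, by linarith⟩).1
        linarith
      · rfl
      · have := (hw0 y ⟨hy.1, by linarith⟩).2
        linarith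
      · rfl
      · exact (hw2 y ⟨hy.1, by linarith⟩).symm
    · refine ⟨Ioo (-9 / 4) 0, Ioo_mem_nhds (by linarith [hx.1]) h,
        (hv.mono (Ioo_subset_Ioo_right (by norm_num))).congr ?_ ?_ ?_⟩ <;>
        intro y hy <;> exact if_neg (not_le.2 hy.2)
  refine ⟨_, key.isGegEigen, 1, by norm_num, ?_⟩
  rw [if_pos zero_le_one]
  simp [u, frob_one]

/-- The eigenvalues are the parameters at which the point `(u(0), u'(0))`, for the regular solution
`u` at `1`, lies on a coordinate axis. -/
lemma mem_gegSpectrum_iff (hα : -1 < α) :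
    χ ∈ gegSpectrum α c ↔ frob α c χ 0 = 0 ∨ frob1 α c χ 0 = 0 := by
  constructor
  · rintro ⟨φ, hφ, hne⟩
    obtain ⟨φ1, φ2, hs⟩ := hφ.exists_isSol
    rcases (hs.parity hα hne).2 with h | h
    · exact Or.inr h.1
    · exact Or.inl h.1
  · rintro (h | h)
    · exact mem_gegSpectrum_of_frob hα (ε := -1) (Or.inr rfl) (by rw [h, mul_zero]) (by norm_num)
    · exact mem_gegSpectrum_of_frob hα (ε := 1) (Or.inl rfl) (by norm_num) (by rw [h, mul_zero])

end Sol

/-! ### Counting the eigenvalues -/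

lemma pos_of_isPreconnected {s : Set ℝ} (hs : IsPreconnected s) {f : ℝ → ℝ} (hf : ContinuousOn f s)
    (hne : ∀ x ∈ s, f x ≠ 0) {x : ℝ} (hx : x ∈ s) (hpos : 0 < f x) : ∀ y ∈ s, 0 < f y := by
  intro y hy
  by_contra! h
  obtain ⟨z, hz, hz0⟩ := hs.intermediate_value hy hx hf ⟨h, hpos.le⟩
  exact hne z hz hz0

/-- The point `(f, g)` of the plane turns counterclockwise, strictly near each parameter. -/
def TurnsPositively (f g : ℝ → ℝ) : Prop :=
  Continuous f ∧ Continuous g ∧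
    ∀ a, ∀ᶠ b in 𝓝[≠] a, 0 < (b - a) * (f a * g b - g a * f b)

lemma TurnsPositively.rotate {f g : ℝ → ℝ} (h : TurnsPositively f g) : TurnsPositively g (-f) := by
  refine ⟨h.2.1, h.1.neg, fun a => ?_⟩
  filter_upwards [h.2.2 a] with b hb
  simp only [Pi.neg_apply]
  linarith

lemma TurnsPositively.eventually_left {f g : ℝ → ℝ} (h : TurnsPositively f g) (b : ℝ) :
    ∀ᶠ x in 𝓝[<] b, f b * g x < g b * f x := by
  filter_upwards [(h.2.2 b).filter_mono (nhdsWithin_mono b fun x hx => ne_of_lt hx),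
    self_mem_nhdsWithin] with x hx hxb
  have hxb : x < b := hxb
  nlinarith

/-- Right of the positive `f`-axis the next axis met is the positive `g`-axis. -/
lemma TurnsPositively.next_zero {f g : ℝ → ℝ} (h : TurnsPositively f g) {a b : ℝ} (hab : a < b)
    (hfa : 0 < f a) (hga : g a = 0) (hno : ∀ x ∈ Ioo a b, f x ≠ 0 ∧ g x ≠ 0)
    (hb : f b = 0 ∨ g b = 0) : 0 < g b ∧ f b = 0 := by
  have hg : ∀ x ∈ Ioo a b, 0 < g x := by
    have hr := (h.2.2 a).filter_mono (nhdsWithin_mono a fun x (hx : x ∈ Ioi a) => ne_of_gt hx)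
    obtain ⟨x, hx, hx'⟩ := (hr.and (Ioo_mem_nhdsGT hab)).exists
    refine pos_of_isPreconnected isPreconnected_Ioo h.2.1.continuousOn (fun x hx => (hno x hx).2)
      hx' ?_
    rw [hga, zero_mul, sub_zero] at hx
    have h1 := pos_of_mul_pos_right hx (sub_nonneg.2 hx'.1.le)
    exact pos_of_mul_pos_right h1 hfa.le
  have hf : ∀ x ∈ Ioo a b, 0 < f x := by
    have hr : ∀ᶠ x in 𝓝[>] a, 0 < f x :=
      (h.1.continuousAt.eventually_const_lt hfa).filter_mono nhdsWithin_le_nhds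
    obtain ⟨x, hx, hx'⟩ := (hr.and (Ioo_mem_nhdsGT hab)).exists
    exact pos_of_isPreconnected isPreconnected_Ioo h.1.continuousOn (fun x hx => (hno x hx).1)
      hx' hx
  have hcl : b ∈ closure (Ioo a b) := by
    rw [closure_Ioo hab.ne]
    exact right_mem_Icc.2 hab.le
  have hfb : 0 ≤ f b := closure_minimal (fun x hx => (hf x hx).le)
    (isClosed_Ici.preimage h.1) hcl
  obtain ⟨x, hx, hx'⟩ := ((h.eventually_left b).and (Ioo_mem_nhdsLT hab)).exists
  have h1 := mul_nonneg hfb (hg x hx').le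
  have h2 : 0 < g b := pos_of_mul_pos_left (h1.trans_lt hx) (hf x hx').le
  exact ⟨h2, hb.resolve_right h2.ne'⟩

lemma TurnsPositively.first_zero {f g : ℝ → ℝ} (h : TurnsPositively f g) {b : ℝ}
    (h0 : ∀ x ≤ 0, 0 < f x ∧ g x < 0) (hno : ∀ x < b, f x ≠ 0 ∧ g x ≠ 0)
    (hb : f b = 0 ∨ g b = 0) : 0 < f b ∧ g b = 0 := by
  have hm : min (b - 1) 0 ∈ Iio b := by
    rw [mem_Iio, min_lt_iff]
    left
    linarith
  have hf : ∀ x ∈ Iio b, 0 < f x := pos_of_isPreconnected isPreconnected_Iio h.1.continuousOn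
    (fun x hx => (hno x hx).1) hm (h0 _ (min_le_right _ _)).1
  have hg : ∀ x ∈ Iio b, 0 < -g x := pos_of_isPreconnected isPreconnected_Iio
    h.2.1.neg.continuousOn (fun x hx => neg_ne_zero.2 (hno x hx).2) hm
    (neg_pos.2 (h0 _ (min_le_right _ _)).2)
  have hcl : b ∈ closure (Iio b) := by
    rw [closure_Iio]
    exact self_mem_Iic
  have hgb : g b ≤ 0 := closure_minimal (fun x hx => (neg_pos.1 (hg x hx)).le)
    (isClosed_Iic.preimage h.2.1) hcl
  obtain ⟨x, hx, hx'⟩ := ((h.eventually_left b).and (self_mem_nhdsWithin)).exists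
  have h1 : g b * f x ≤ 0 := mul_nonpos_of_nonpos_of_nonneg hgb (hf x hx').le
  have h2 : 0 < f b := by
    by_contra! hle
    have := mul_nonneg_of_nonpos_of_nonpos hle (neg_pos.1 (hg x hx')).le
    linarith
  exact ⟨h2, hb.resolve_left h2.ne'⟩

/-- The functions `f, g, -f, -g, f, …`: the coordinate that is positive at the `n`-th passage of
`(f, g)` through the coordinate axes. -/
def turnSeq (f g : ℝ → ℝ) : ℕ → ℝ → ℝ
  | 0 => f
  | 1 => g
  | n + 2 => -turnSeq f g n

lemma TurnsPositively.turnSeq {f g : ℝ → ℝ} (h : TurnsPositively f g) (n : ℕ) :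
    TurnsPositively (turnSeq f g n) (turnSeq f g (n + 1)) := by
  induction n with
  | zero => exact h
  | succ n ih => exact ih.rotate

lemma turnSeq_eq_zero_iff (f g : ℝ → ℝ) (n : ℕ) (x : ℝ) :
    (turnSeq f g n x = 0 ∨ turnSeq f g (n + 1) x = 0) ↔ (f x = 0 ∨ g x = 0) := by
  induction n with
  | zero => rfl
  | succ n ih =>
    rw [← ih, turnSeq, Pi.neg_apply, neg_eq_zero]
    exact or_comm

lemma turnSeq_even (f g : ℝ → ℝ) (m : ℕ) (x : ℝ) : turnSeq f g (2 * m) x = (-1) ^ m * f x := by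
  induction m with
  | zero => simp [turnSeq]
  | succ m ih =>
    rw [show 2 * (m + 1) = 2 * m + 2 by ring, turnSeq, Pi.neg_apply, ih]
    ring

lemma turnSeq_odd (f g : ℝ → ℝ) (m : ℕ) (x : ℝ) : turnSeq f g (2 * m + 1) x = (-1) ^ m * g x := by
  induction m with
  | zero => simp [turnSeq]
  | succ m ih =>
    rw [show 2 * (m + 1) + 1 = 2 * m + 1 + 2 by ring, turnSeq, Pi.neg_apply, ih]
    ring

/-- If `(f, g)` starts in the open fourth quadrant, then its `n`-th passage through an axis happens
on the half axis that is `n` quarter turns away from the positive `f`-axis. -/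
lemma TurnsPositively.sign_of_encard {f g : ℝ → ℝ} (h : TurnsPositively f g)
    (h0 : ∀ x ≤ 0, 0 < f x ∧ g x < 0) (n : ℕ) :
    ∀ b, (f b = 0 ∨ g b = 0) → {x | (f x = 0 ∨ g x = 0) ∧ x < b}.encard = n →
      0 < _root_.turnSeq f g n b ∧ _root_.turnSeq f g (n + 1) b = 0 := by
  induction n with
  | zero =>
    intro b hb hn
    rw [Nat.cast_zero, encard_eq_zero] at hn
    refine h.first_zero h0 (fun x hx => ?_) hb
    by_contra! hx'
    have : x ∈ ({x | (f x = 0 ∨ g x = 0) ∧ x < b} : Set ℝ) :=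
      ⟨by by_cases hf : f x = 0
          · exact Or.inl hf
          · exact Or.inr (hx' hf), hx⟩
    rw [hn] at this
    exact this
  | succ n ih =>
    intro b hb hn
    have hfin : {x | (f x = 0 ∨ g x = 0) ∧ x < b}.Finite := finite_of_encard_eq_coe hn
    have hne : {x | (f x = 0 ∨ g x = 0) ∧ x < b}.Nonempty := by
      rw [← encard_ne_zero, hn]
      simp
    -- the largest of the passages before `b`
    obtain ⟨a, ha, hmax⟩ := hfin.exists_maximalFor id _ hne
    have hmax' : ∀ x, (f x = 0 ∨ g x = 0) → x < b → x ≤ a := by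
      intro x hx hxb
      by_contra! hlt
      exact absurd (hmax (j := x) ⟨hx, hxb⟩ hlt.le) (not_le.2 hlt)
    have hset : {x | (f x = 0 ∨ g x = 0) ∧ x < b}
        = insert a {x | (f x = 0 ∨ g x = 0) ∧ x < a} := by
      ext x
      constructor
      · rintro ⟨hx, hxb⟩
        rcases (hmax' x hx hxb).eq_or_lt with h | h
        · exact Or.inl h
        · exact Or.inr ⟨hx, h⟩
      · rintro (rfl | ⟨hx, hxa⟩)
        · exact ha
        · exact ⟨hx, hxa.trans ha.2⟩
    have hcard : {x | (f x = 0 ∨ g x = 0) ∧ x < a}.encard = n := by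
      rw [hset, encard_insert_of_notMem (by simp), Nat.cast_add, Nat.cast_one] at hn
      exact WithTop.add_right_cancel ENat.one_ne_top hn
    obtain ⟨i1, i2⟩ := ih a ha.1 hcard
    have hno : ∀ x ∈ Ioo a b, _root_.turnSeq f g n x ≠ 0 ∧ _root_.turnSeq f g (n + 1) x ≠ 0 := by
      intro x hx
      rw [← not_or, turnSeq_eq_zero_iff]
      exact fun h0 => absurd (hmax' x h0 hx.2) (not_le.2 hx.1)
    obtain ⟨j1, j2⟩ := (h.turnSeq n).next_zero ha.2 i1 i2 hno ((turnSeq_eq_zero_iff f g n b).2 hb)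
    refine ⟨j1, ?_⟩
    rw [_root_.turnSeq, Pi.neg_apply, j2, neg_zero]

lemma gegWeight_zero (α : ℝ) : gegWeight α 0 = 1 := by simp [gegWeight]

lemma continuous_integral_frob_mul {α : ℝ} (hα : -1 < α) (c χ₀ : ℝ) :
    Continuous fun χ => ∫ y in (0 : ℝ)..1, frob α c χ₀ y * frob α c χ y * gegWeight α y := by
  rw [continuous_iff_continuousAt]
  intro χ₁
  obtain ⟨C, hC⟩ := exists_frob_bound hα c (|χ₁| + 1)
  obtain ⟨D, hD⟩ := exists_frob_bound hα c |χ₀|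
  have hw : IntervalIntegrable (gegWeight α) volume 0 1 := by
    refine (intervalIntegrable_gegWeight hα).mono_set ?_
    rw [uIcc_of_le zero_le_one, uIcc_of_le (by norm_num)]
    exact Icc_subset_Icc_left (by norm_num)
  have hcont : ∀ χ, ContinuousOn (frob α c χ) (Icc 0 1) := fun χ => (isSol_frob_Icc hα c χ).cont
  refine intervalIntegral.continuousAt_of_dominated_interval
    (bound := fun y => D * C * gegWeight α y) ?_ ?_ (hw.const_mul _) ?_
  · refine Eventually.of_forall fun χ => ?_
    have := (intervalIntegrable_mul_gegWeight hα (by norm_num : (-1 : ℝ) ≤ 0) zero_le_one le_rfl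
      ((hcont χ₀).mul (hcont χ))).aestronglyMeasurable
    rwa [uIoc_of_le zero_le_one]
  · filter_upwards [Metric.ball_mem_nhds χ₁ one_pos] with χ hχ
    refine Eventually.of_forall fun y hy => ?_
    rw [uIoc_of_le zero_le_one] at hy
    have hy' : y ∈ Icc (0 : ℝ) 1 := Ioc_subset_Icc_self hy
    have hχ' : |χ| ≤ |χ₁| + 1 := by
      rw [Metric.mem_ball, Real.dist_eq] at hχ
      have := abs_sub_abs_le_abs_sub χ χ₁
      linarith
    have hw0 := gegWeight_nonneg α (x := y) ⟨by linarith [hy'.1], hy'.2⟩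
    have h1 := hD χ₀ le_rfl y hy'
    rw [norm_mul, norm_mul, Real.norm_eq_abs, Real.norm_eq_abs, Real.norm_eq_abs, abs_of_nonneg hw0]
    gcongr
    · exact (abs_nonneg _).trans h1
    · exact hC χ hχ' y hy'
  · refine Eventually.of_forall fun y hy => ?_
    rw [uIoc_of_le zero_le_one] at hy
    exact (((continuous_frob hα c (Ioc_subset_Icc_self hy)).continuousAt).const_mul _).mul_const _

lemma integral_frob_sq_pos {α : ℝ} (hα : -1 < α) (c χ : ℝ) :
    0 < ∫ y in (0 : ℝ)..1, frob α c χ y * frob α c χ y * gegWeight α y := by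
  obtain ⟨x, hx, hne⟩ := exists_frob_ne_zero hα c χ
  exact integral_sq_mul_gegWeight_pos hα (by norm_num) le_rfl hx (isSol_frob_Icc hα c χ).cont hne

/-- The point `(u(0), u'(0))`, for the regular solution `u` at `1`, turns counterclockwise as `χ`
increases: by the Lagrange identity the cross product of its positions at `χ₀` and `χ` is
`(χ - χ₀) ∫₀¹ u_{χ₀} u_χ ω_α`, and the integral is positive for `χ` near `χ₀`. -/
lemma turnsPositively_frob {α : ℝ} (hα : -1 < α) (c : ℝ) :
    TurnsPositively (fun χ => frob α c χ 0) (fun χ => frob1 α c χ 0) := by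
  refine ⟨continuous_frob hα c (by norm_num), continuous_frob1_zero hα c, fun χ₀ => ?_⟩
  have hI := (continuous_integral_frob_mul hα c χ₀).continuousAt.eventually_const_lt
    (integral_frob_sq_pos hα c χ₀)
  filter_upwards [hI.filter_mono nhdsWithin_le_nhds, self_mem_nhdsWithin] with χ hχ hne
  have hl := (isSol_frob_Icc hα c χ₀).lagrange hα (by norm_num) zero_le_one
    (isSol_frob_Icc hα c χ)
  rw [gegWeight_zero, one_mul] at hl
  rw [hl, ← mul_assoc]
  exact mul_pos (mul_self_pos.2 (sub_ne_zero.2 hne)) hχ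

/-- For `χ ≤ 0` the energy `(1 - x²)^{α+1} u u'` increases to `0` at the end point `1`. -/
lemma frob_pos_of_nonpos {α c χ : ℝ} (hα : -1 < α) (hc : 0 < c) (hχ : χ ≤ 0) :
    0 < frob α c χ 0 ∧ frob1 α c χ 0 < 0 := by
  have hs := isSol_frob_Icc hα c χ
  have hmono : StrictMonoOn (fun x => gegWeight (α + 1) x * frob1 α c χ x * frob α c χ x)
      (Icc 0 1) := by
    refine strictMonoOn_of_deriv_pos (convex_Icc 0 1) (((continuous_gegWeight_add_one
      hα).continuousOn.mul hs.cont1).mul hs.cont) fun x hx => ?_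
    rw [interior_Icc] at hx
    have hx' : x ∈ Ioo (-1 : ℝ) 1 := ⟨by linarith [hx.1], hx.2⟩
    have hnh : Icc (0 : ℝ) 1 ∈ 𝓝 x := Icc_mem_nhds hx.1 hx.2
    have hd := (hasDerivAt_gegWeight_smul α hx' (hs.hasDerivAt1 hnh)).mul (hs.hasDerivAt hnh)
    have hode := hs.ode x (Ioo_subset_Icc_self hx)
    simp only [smul_eq_mul] at hd
    rw [hode] at hd
    refine lt_of_lt_of_eq ?_ hd.deriv.symm
    have hw := gegWeight_pos α hx'
    have hp := gegWeight_pos (α + 1) hx'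
    have hq : 0 < c ^ 2 * x ^ 2 - χ := by
      have : 0 < c ^ 2 * x ^ 2 := mul_pos (pow_pos hc 2) (pow_pos hx.1 2)
      linarith
    have e : gegWeight α x * ((c ^ 2 * x ^ 2 - χ) * frob α c χ x) * frob α c χ x
        + gegWeight (α + 1) x * frob1 α c χ x * frob1 α c χ x
        = gegWeight α x * (c ^ 2 * x ^ 2 - χ) * frob α c χ x ^ 2
          + gegWeight (α + 1) x * frob1 α c χ x ^ 2 := by ring
    rw [e]
    rcases frob_ne_zero_or_of_mem hα c χ (x₀ := x) ⟨by linarith [hx.1], hx.2⟩ with h | h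
    · have := pow_pos (abs_pos.2 h) 2
      rw [sq_abs] at this
      positivity
    · have := pow_pos (abs_pos.2 h) 2
      rw [sq_abs] at this
      positivity
  have hneg : ∀ x ∈ Ico (0 : ℝ) 1, frob1 α c χ x * frob α c χ x < 0 := by
    intro x hx
    have h1 := hmono (Ico_subset_Icc_self hx) (right_mem_Icc.2 zero_le_one) hx.2
    simp only [gegWeight_add_one_one hα, zero_mul] at h1
    rw [mul_assoc] at h1
    exact neg_of_mul_neg_right h1 (gegWeight_pos (α + 1) ⟨by linarith [hx.1], hx.2⟩).le
  have h0 : 0 < frob α c χ 0 := by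
    refine pos_of_isPreconnected isPreconnected_Icc hs.cont (fun x hx => ?_)
      (right_mem_Icc.2 zero_le_one) (by simp [frob_one]) 0 (left_mem_Icc.2 zero_le_one)
    rcases hx.2.eq_or_lt with rfl | h
    · simp [frob_one]
    · intro h0
      have := hneg x ⟨hx.1, h⟩
      rw [h0, mul_zero] at this
      exact lt_irrefl _ this
  exact ⟨h0, neg_of_mul_neg_left (hneg 0 (by norm_num)) h0.le⟩

/-- The sign at `0` of the `n`-th eigenfunction, or of its derivative, relative to its sign at `1`:
the eigenvalues are the passages of `(u(0), u'(0))` through the axes, and for `χ ≤ 0` this point is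
in the fourth quadrant. -/
lemma frob_sign_of_encard {α c χ : ℝ} (hα : -1 < α) (hc : 0 < c) {n : ℕ}
    (hχ : χ ∈ gegSpectrum α c) (hn : {χ' ∈ gegSpectrum α c | χ' < χ}.encard = n) :
    (∀ m, n = 2 * m → frob1 α c χ 0 = 0 ∧ 0 < (-1) ^ m * frob α c χ 0) ∧
      ∀ m, n = 2 * m + 1 → frob α c χ 0 = 0 ∧ 0 < (-1) ^ m * frob1 α c χ 0 := by
  have h := (turnsPositively_frob hα c).sign_of_encard
    (fun x hx => frob_pos_of_nonpos hα hc hx) n χ ((mem_gegSpectrum_iff hα).1 hχ) (by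
      rw [← hn]
      congr 1
      ext x
      exact and_congr_left fun _ => (mem_gegSpectrum_iff hα).symm)
  constructor <;> rintro m rfl
  · rw [turnSeq_even, turnSeq_odd] at h
    exact ⟨(mul_eq_zero.1 h.2).resolve_left (by simp), h.1⟩
  · rw [turnSeq_odd, show 2 * m + 1 + 1 = 2 * (m + 1) by ring, turnSeq_even] at h
    exact ⟨(mul_eq_zero.1 h.2).resolve_left (by simp), h.1⟩

/-! ### The signs of the moments of an eigenfunction -/

/-- The moments `∫_{-1}^1 y^k ψ(y) ω_α(y) dy`. -/
noncomputable def gegMoment (α : ℝ) (ψ : ℝ → ℝ) (k : ℕ) : ℝ :=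
  ∫ y in (-1 : ℝ)..1, y ^ k * ψ y * gegWeight α y

lemma hasC2On_pow (k : ℕ) (s : Set ℝ) : HasC2On (fun y : ℝ => y ^ k)
    (fun y => (k : ℝ) * y ^ (k - 1)) (fun y => (k : ℝ) * (((k - 1 : ℕ) : ℝ) * y ^ (k - 1 - 1))) s :=
  .of_hasDerivAt (fun x _ => hasDerivAt_pow k x)
    (fun x _ => (hasDerivAt_pow (k - 1) x).const_mul _) (by fun_prop)

/-- The Lagrange identity of a solution with the monomial `y^k`. -/
lemma IsSol.integral_pow_eq_zero {α c χ : ℝ} {φ φ1 φ2 : ℝ → ℝ} (hα : -1 < α)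
    (h : IsSol α c χ φ φ1 φ2 (Icc (-1) 1)) (k : ℕ) :
    ∫ y in (-1 : ℝ)..1, ((k : ℝ) * (((k - 1 : ℕ) : ℝ) * y ^ (k - 1 - 1))
      - k * (k + 2 * α + 1) * y ^ k + χ * y ^ k - c ^ 2 * y ^ (k + 2)) * φ y * gegWeight α y = 0 := by
  have hl := integral_lagrange hα le_rfl (by norm_num) le_rfl h.toHasC2On (hasC2On_pow k _)
  rw [gegWeight_add_one_one hα, gegWeight_add_one_neg_one hα, zero_smul, zero_smul, sub_zero] at hl
  rw [← hl]
  refine intervalIntegral.integral_congr fun y hy => ?_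
  rw [uIcc_of_le (by norm_num)] at hy
  simp only [smul_eq_mul]
  rw [h.ode y hy]
  rcases k with _ | _ | k
  · simp
    ring
  · simp
    ring
  · simp only [Nat.add_sub_cancel]
    push_cast
    ring

lemma intervalIntegrable_gegMoment {α : ℝ} (hα : -1 < α) {φ : ℝ → ℝ}
    (hφ : ContinuousOn φ (Icc (-1) 1)) (k : ℕ) :
    IntervalIntegrable (fun y => y ^ k * φ y * gegWeight α y) volume (-1) 1 :=
  intervalIntegrable_mul_gegWeight (f := fun y => y ^ k * φ y) hα le_rfl (by norm_num) le_rfl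
    (by fun_prop)

lemma IsSol.moment_recursion {α c χ : ℝ} {φ φ1 φ2 : ℝ → ℝ} (hα : -1 < α)
    (h : IsSol α c χ φ φ1 φ2 (Icc (-1) 1)) (k : ℕ) :
    c ^ 2 * gegMoment α φ (k + 2) = k * ((k - 1 : ℕ) : ℝ) * gegMoment α φ (k - 1 - 1)
      - (k * (k + 2 * α + 1) - χ) * gegMoment α φ k := by
  have hi := fun j => intervalIntegrable_gegMoment hα h.cont j
  have h0 := h.integral_pow_eq_zero hα k
  have e : ∀ y : ℝ, ((k : ℝ) * (((k - 1 : ℕ) : ℝ) * y ^ (k - 1 - 1))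
      - k * (k + 2 * α + 1) * y ^ k + χ * y ^ k - c ^ 2 * y ^ (k + 2)) * φ y * gegWeight α y
      = (k * ((k - 1 : ℕ) : ℝ)) * (y ^ (k - 1 - 1) * φ y * gegWeight α y)
        - (k * (k + 2 * α + 1) - χ) * (y ^ k * φ y * gegWeight α y)
        - c ^ 2 * (y ^ (k + 2) * φ y * gegWeight α y) := fun y => by ring
  simp_rw [e] at h0
  rw [intervalIntegral.integral_sub (((hi _).const_mul _).sub ((hi _).const_mul _))
    ((hi _).const_mul _), intervalIntegral.integral_sub ((hi _).const_mul _) ((hi _).const_mul _),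
    intervalIntegral.integral_const_mul, intervalIntegral.integral_const_mul,
    intervalIntegral.integral_const_mul] at h0
  simp only [gegMoment]
  linarith

/-- The signs in a three term recursion: positivity of two neighbours propagates down where `q ≥ 0`,
and nonpositivity propagates up where `q < 0`. For increasing `q` the two ranges meet, so positivity
at infinity reaches `m 0`. -/
lemma pos_of_eventually_pos {m q d : ℕ → ℝ} {a : ℝ} (ha : 0 < a) (hq : Monotone q)
    (hd : ∀ j, 0 < d j) (h0 : a * m 1 = -(q 0 * m 0))
    (hrec : ∀ j, a * m (j + 2) = d j * m j - q (j + 1) * m (j + 1))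
    (hev : ∀ᶠ j in atTop, 0 < m j) : 0 < m 0 := by
  by_contra! hm0
  obtain ⟨N, hN⟩ := eventually_atTop.1 hev
  -- if `m 0 ≤ 0`, then all terms up to the sign change of `q` are nonpositive
  have hup : ∀ K, (∀ j < K, q j < 0) → ∀ j ≤ K, m j ≤ 0 := by
    intro K hK j
    induction j using Nat.strong_induction_on with
    | _ j ih =>
      intro hj
      match j with
      | 0 => exact hm0
      | 1 =>
        have h1 := hK 0 (by omega)
        have h2 : a * m 1 ≤ 0 := by
          rw [h0]
          linarith [mul_nonneg_of_nonpos_of_nonpos h1.le hm0]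
        exact nonpos_of_mul_nonpos_right h2 ha
      | j + 2 =>
        have i0 := ih j (by omega) (by omega)
        have i1 := ih (j + 1) (by omega) (by omega)
        have h1 := hK (j + 1) (by omega)
        have h2 : a * m (j + 2) ≤ 0 := by
          rw [hrec]
          linarith [mul_nonneg_of_nonpos_of_nonpos h1.le i1,
            mul_nonpos_of_nonneg_of_nonpos (hd j).le i0]
        exact nonpos_of_mul_nonpos_right h2 ha
  have hex : ∃ K, 0 ≤ q K := by
    by_contra! hall
    exact absurd (hup N (fun j _ => hall j) N le_rfl) (not_le.2 (hN N le_rfl))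
  classical
  set K := Nat.find hex with hKdef
  have hK : 0 ≤ q K := Nat.find_spec hex
  have hlt : ∀ j < K, q j < 0 := fun j hj => not_le.1 (Nat.find_min hex hj)
  -- all terms from the sign change of `q` on are positive
  have hdown : ∀ i j, N ≤ j + i → K ≤ j + 1 → 0 < m j := by
    intro i
    induction i using Nat.strong_induction_on with
    | _ i ih =>
      intro j hji hKj
      match i with
      | 0 => exact hN j hji
      | 1 =>
        have i1 := hN (j + 1) (by omega)
        have i2 := hN (j + 2) (by omega)
        have hqj := hK.trans (hq hKj)
        have : 0 < d j * m j := by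
          have := hrec j
          have := mul_nonneg hqj i1.le
          have := mul_pos ha i2
          linarith
        exact pos_of_mul_pos_right this (hd j).le
      | i + 2 =>
        have i1 := ih (i + 1) (by omega) (j + 1) (by omega) (by omega)
        have i2 := ih i (by omega) (j + 2) (by omega) (by omega)
        have hqj := hK.trans (hq hKj)
        have : 0 < d j * m j := by
          have := hrec j
          have := mul_nonneg hqj i1.le
          have := mul_pos ha i2
          linarith
        exact pos_of_mul_pos_right this (hd j).le
  rcases Nat.eq_zero_or_pos K with h | h
  · exact absurd (hdown N 0 (by omega) (by omega)) (not_lt.2 hm0)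
  · exact absurd (hdown N (K - 1) (by omega) (by omega)) (not_lt.2 (hup K hlt (K - 1) (by omega)))

/-- The mass of `y^k ω_α` on `[0, 1]` concentrates at `1` as `k` grows, so the high moments of a
function have its sign at `1`. -/
lemma eventually_integral_pow_pos {α : ℝ} (hα : -1 < α) {η : ℝ → ℝ} (hη : ContinuousOn η (Icc 0 1))
    (h1 : 0 < η 1) : ∀ᶠ k : ℕ in atTop, 0 < ∫ y in (0 : ℝ)..1, y ^ k * η y * gegWeight α y := by
  have hnear : ∀ᶠ x in 𝓝[<] (1 : ℝ), ∀ y ∈ Icc x 1, 0 < η y := by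
    have hc := (hη 1 (right_mem_Icc.2 zero_le_one)).eventually_const_lt h1
    rw [eventually_nhdsWithin_iff, Metric.eventually_nhds_iff] at hc
    obtain ⟨δ, hδ, hc⟩ := hc
    have hm : max 0 (1 - δ) < 1 := max_lt one_pos (by linarith)
    filter_upwards [Ioo_mem_nhdsLT hm] with x hx y hy
    have hx1 := (max_lt_iff.1 hx.1)
    refine hc ?_ ⟨by linarith [hy.1], hy.2⟩
    rw [Real.dist_eq, abs_lt]
    constructor <;> linarith [hy.1, hy.2]
  obtain ⟨δ, hδ, hδ0⟩ := (hnear.and (Ioo_mem_nhdsLT (zero_lt_one' ℝ))).exists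
  obtain ⟨δ', hδ1, hδ2⟩ := exists_between hδ0.2
  have hδ'0 : 0 < δ' := hδ0.1.trans hδ1
  have hint : ∀ {a b : ℝ}, 0 ≤ a → a ≤ b → b ≤ 1 → ∀ f : ℝ → ℝ, ContinuousOn f (Icc 0 1) →
      IntervalIntegrable (fun y => f y * gegWeight α y) volume a b := fun ha hab hb f hf =>
    intervalIntegrable_mul_gegWeight hα (by linarith) hab hb (hf.mono (Icc_subset_Icc ha hb))
  have hw : ∀ y ∈ Icc (0 : ℝ) 1, 0 ≤ gegWeight α y := fun y hy =>
    gegWeight_nonneg α ⟨by linarith [hy.1], hy.2⟩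
  have hpc : ∀ k : ℕ, ContinuousOn (fun y => y ^ k * η y) (Icc 0 1) := fun k => by fun_prop
  set B := ∫ y in (0 : ℝ)..δ, |η y| * gegWeight α y with hB
  set J := ∫ y in δ'..1, η y * gegWeight α y with hJ
  have hJ0 : 0 < J := by
    refine intervalIntegral.intervalIntegral_pos_of_pos_on (hint hδ'0.le hδ2.le le_rfl η hη)
      (fun y hy => ?_) hδ2
    exact mul_pos (hδ y ⟨by linarith [hy.1], hy.2.le⟩)
      (gegWeight_pos α ⟨by linarith [hy.1], hy.2⟩)
  have hlim : Tendsto (fun k : ℕ => (δ / δ') ^ k * B) atTop (𝓝 0) := by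
    simpa using (tendsto_pow_atTop_nhds_zero_of_lt_one (div_nonneg hδ0.1.le hδ'0.le)
      ((div_lt_one hδ'0).2 hδ1)).mul_const B
  filter_upwards [hlim.eventually_lt_const hJ0] with k hk
  have s1 := intervalIntegral.integral_add_adjacent_intervals
    (hint le_rfl hδ0.1.le hδ0.2.le _ (hpc k)) (hint hδ0.1.le hδ0.2.le le_rfl _ (hpc k))
  have s2 := intervalIntegral.integral_add_adjacent_intervals
    (hint hδ0.1.le hδ1.le hδ2.le _ (hpc k)) (hint hδ'0.le hδ2.le le_rfl _ (hpc k))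
  have p1 : -(δ ^ k * B) ≤ ∫ y in (0 : ℝ)..δ, y ^ k * η y * gegWeight α y := by
    rw [hB, ← intervalIntegral.integral_const_mul, ← intervalIntegral.integral_neg]
    refine intervalIntegral.integral_mono_on hδ0.1.le
      ((hint le_rfl hδ0.1.le hδ0.2.le _ hη.abs).const_mul _).neg
      (hint le_rfl hδ0.1.le hδ0.2.le _ (hpc k)) fun y hy => ?_
    have hwy := hw y ⟨hy.1, by linarith [hy.2, hδ0.2]⟩
    have h2 : y ^ k * |η y| ≤ δ ^ k * |η y| := by
      gcongr
      · exact hy.1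
      · exact hy.2
    have h3 : -(y ^ k * |η y|) ≤ y ^ k * η y := by
      have := mul_le_mul_of_nonneg_left (neg_abs_le (η y)) (pow_nonneg hy.1 k)
      linarith
    nlinarith
  have p2 : 0 ≤ ∫ y in δ..δ', y ^ k * η y * gegWeight α y := by
    refine intervalIntegral.integral_nonneg hδ1.le fun y hy => ?_
    have hy0 : 0 ≤ y := by linarith [hy.1, hδ0.1]
    exact mul_nonneg (mul_nonneg (pow_nonneg hy0 k) (hδ y ⟨hy.1, by linarith [hy.2]⟩).le)
      (hw y ⟨hy0, by linarith [hy.2]⟩)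
  have p3 : δ' ^ k * J ≤ ∫ y in δ'..1, y ^ k * η y * gegWeight α y := by
    rw [hJ, ← intervalIntegral.integral_const_mul]
    refine intervalIntegral.integral_mono_on hδ2.le
      ((hint hδ'0.le hδ2.le le_rfl _ hη).const_mul _)
      (hint hδ'0.le hδ2.le le_rfl _ (hpc k)) fun y hy => ?_
    have hy0 : 0 ≤ y := by linarith [hy.1, hδ0.1]
    rw [← mul_assoc]
    have hηy := (hδ y ⟨by linarith [hy.1], hy.2⟩).le
    have hwy := hw y ⟨hy0, hy.2⟩
    gcongr
    exact hy.1
  have p4 : δ ^ k * B < δ' ^ k * J := by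
    have hpk : 0 < δ' ^ k := pow_pos hδ'0 k
    have := mul_lt_mul_of_pos_left hk hpk
    rwa [← mul_assoc, div_pow, mul_div_cancel₀ _ hpk.ne'] at this
  linarith

lemma integral_eq_two_mul_of_even {f : ℝ → ℝ} (hf : ∀ x ∈ Icc (-1 : ℝ) 1, f (-x) = f x)
    (hi : IntervalIntegrable f volume (-1) 1) :
    ∫ y in (-1 : ℝ)..1, f y = 2 * ∫ y in (0 : ℝ)..1, f y := by
  have h0 : ∫ y in (-1 : ℝ)..0, f y = ∫ y in (0 : ℝ)..1, f y := by
    rw [← neg_zero, ← intervalIntegral.integral_comp_neg, neg_zero]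
    refine intervalIntegral.integral_congr fun y hy => ?_
    rw [uIcc_of_le zero_le_one] at hy
    exact hf y ⟨by linarith [hy.1], hy.2⟩
  rw [← intervalIntegral.integral_add_adjacent_intervals (b := 0)
    (hi.mono_set (uIcc_subset_uIcc (by simp) (by simp)))
    (hi.mono_set (uIcc_subset_uIcc (by simp) (by simp))), h0]
  ring

/-- The lowest moment that parity allows has the sign of the eigenfunction at `1`: the high moments
do, and the sign is carried down by the recursion. -/
lemma IsSol.moment_pos {α c χ : ℝ} {φ φ1 φ2 : ℝ → ℝ} (hα : -1 < α) (hc : 0 < c)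
    (h : IsSol α c χ φ φ1 φ2 (Icc (-1) 1)) {e : ℕ} (he : e = 0 ∨ e = 1)
    (hpar : φ (-1) = (-1) ^ e * φ 1) (h1 : φ 1 ≠ 0) : 0 < φ 1 * gegMoment α φ e := by
  have hp : ∀ x ∈ Icc (-1 : ℝ) 1, φ (-x) = (-1) ^ e * φ x := by
    intro x hx
    rcases le_total 0 x with h0 | h0
    · exact (h.eq_mul_frob hα hpar ⟨h0, hx.2⟩).2
    · have := (h.eq_mul_frob hα hpar (x := -x) ⟨by linarith, by linarith [hx.1]⟩).2
      rw [neg_neg] at this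
      rw [this, ← mul_assoc, ← mul_pow]
      simp
  have hee : ((-1 : ℝ) ^ e) * (-1) ^ e = 1 := by rw [← mul_pow]; simp
  have hφ := h.cont
  refine pos_of_eventually_pos (m := fun j => φ 1 * gegMoment α φ (e + 2 * j))
    (q := fun j => ((e + 2 * j : ℕ) : ℝ) * ((e + 2 * j : ℕ) + 2 * α + 1) - χ)
    (d := fun j => ((e + 2 * j : ℕ) + 2) * ((e + 2 * j : ℕ) + 1)) (pow_pos hc 2) ?_ ?_ ?_ ?_ ?_
  · refine monotone_nat_of_le_succ fun j => ?_
    push_cast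
    have : (0 : ℝ) ≤ e := by positivity
    have : (0 : ℝ) ≤ j := by positivity
    nlinarith
  · intro j
    positivity
  · have := h.moment_recursion hα e
    have h0 : (e : ℝ) * ((e - 1 : ℕ) : ℝ) = 0 := by rcases he with rfl | rfl <;> simp
    rw [h0] at this
    simp only [mul_one, mul_zero, add_zero]
    linear_combination φ 1 * this
  · intro j
    have := h.moment_recursion hα (e + 2 * j + 2)
    simp only [Nat.add_sub_cancel, show e + 2 * j + 2 - 1 = e + 2 * j + 1 by omega] at this
    rw [show e + 2 * (j + 2) = e + 2 * j + 2 + 2 by ring, show e + 2 * (j + 1) = e + 2 * j + 2 by ring]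
    push_cast at this ⊢
    linear_combination φ 1 * this
  · have hev := eventually_integral_pow_pos hα (η := fun y => φ 1 * φ y)
      (continuousOn_const.mul (hφ.mono (Icc_subset_Icc_left (by norm_num)))) (mul_self_pos.2 h1)
    have ht : Tendsto (fun j : ℕ => e + 2 * j) atTop atTop :=
      tendsto_atTop_mono (fun j => (by omega : j ≤ e + 2 * j)) tendsto_id
    filter_upwards [ht.eventually hev] with j hj
    rw [gegMoment, integral_eq_two_mul_of_even _ (intervalIntegrable_gegMoment hα hφ _)]
    · have e1 : ∫ y in (0 : ℝ)..1, y ^ (e + 2 * j) * (φ 1 * φ y) * gegWeight α y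
          = φ 1 * ∫ y in (0 : ℝ)..1, y ^ (e + 2 * j) * φ y * gegWeight α y := by
        rw [← intervalIntegral.integral_const_mul]
        exact intervalIntegral.integral_congr fun y _ => by ring
      linarith
    · intro x hx
      rw [hp x hx, gegWeight_neg, neg_pow x, pow_add (-1 : ℝ), pow_mul]
      simp only [even_two, Even.neg_pow, one_pow, mul_one]
      linear_combination (x ^ (e + 2 * j) * φ x * gegWeight α x) * hee

/-! ### The weighted finite Fourier transform of an eigenfunction -/

/-- The finite Fourier transform `∫_{-1}^1 e^{iczy} w(y) dy`, as an entire function of `z`. -/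
noncomputable def fourierInt (c : ℝ) (w : ℝ → ℂ) (z : ℂ) : ℂ :=
  ∫ y in (-1 : ℝ)..1, Complex.exp (Complex.I * c * z * y) * w y

lemma weightedFourier_eq_fourierInt (α c : ℝ) (f : ℝ → ℝ) (x : ℝ) :
    weightedFourier α c f x = fourierInt c (fun y => f y * gegWeight α y) x := by
  simp only [weightedFourier, fourierInt, mul_assoc]

lemma intervalIntegrable_exp_mul {c : ℝ} {w : ℝ → ℂ} (hw : IntervalIntegrable w volume (-1) 1)
    (z : ℂ) :
    IntervalIntegrable (fun y : ℝ => Complex.exp (Complex.I * c * z * y) * w y) volume (-1) 1 :=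
  hw.continuousOn_mul (by fun_prop)

lemma norm_exp_le_of_abs_le_one {c y : ℝ} (hy : |y| ≤ 1) (z : ℂ) :
    ‖Complex.exp (Complex.I * c * z * y)‖ ≤ Real.exp (|c| * ‖z‖) := by
  refine (Complex.norm_exp_le_exp_norm _).trans (Real.exp_le_exp.2 ?_)
  rw [norm_mul, norm_mul, norm_mul, Complex.norm_I, one_mul, Complex.norm_real, Complex.norm_real,
    Real.norm_eq_abs, Real.norm_eq_abs]
  exact mul_le_of_le_one_right (by positivity) hy

lemma hasDerivAt_fourierInt {c : ℝ} {w : ℝ → ℂ} (hw : IntervalIntegrable w volume (-1) 1) (z : ℂ) :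
    HasDerivAt (fourierInt c w) (fourierInt c (fun y => Complex.I * c * y * w y) z) z := by
  have hw' : IntervalIntegrable (fun y : ℝ => Complex.I * c * y * w y) volume (-1) 1 :=
    hw.continuousOn_mul (by fun_prop)
  refine (intervalIntegral.hasDerivAt_integral_of_dominated_loc_of_deriv_le
    (F := fun z y => Complex.exp (Complex.I * c * z * y) * w y)
    (F' := fun z y => Complex.exp (Complex.I * c * z * y) * (Complex.I * c * y * w y))
    (bound := fun y => Real.exp (|c| * (‖z‖ + 1)) * ‖Complex.I * c * y * w y‖)
    (Metric.ball_mem_nhds z one_pos) ?_ (intervalIntegrable_exp_mul hw z) ?_ ?_ ?_ ?_).2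
  · exact Eventually.of_forall fun x => (intervalIntegrable_exp_mul hw x).def'.aestronglyMeasurable
  · exact (intervalIntegrable_exp_mul hw' z).def'.aestronglyMeasurable
  · refine Eventually.of_forall fun y hy x hx => ?_
    rw [uIoc_of_le (by norm_num)] at hy
    rw [norm_mul]
    gcongr
    refine (norm_exp_le_of_abs_le_one (abs_le.2 ⟨hy.1.le, hy.2⟩) x).trans ?_
    gcongr
    rw [mem_ball_iff_norm] at hx
    have := norm_sub_norm_le x z
    linarith
  · exact hw'.norm.const_mul _
  · refine Eventually.of_forall fun y _ x _ => ?_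
    have h1 : HasDerivAt (fun x : ℂ => Complex.I * c * x * y) (Complex.I * c * y) x := by
      simpa using ((hasDerivAt_id x).const_mul (Complex.I * c)).mul_const (y : ℂ)
    convert! (h1.cexp).mul_const (w y) using 1
    ring

section

variable {α c χ : ℝ} {φ φ1 φ2 η η1 η2 : ℝ → ℝ}

lemma intervalIntegrable_ofReal_mul_gegWeight (hα : -1 < α) (hφ : ContinuousOn φ (Icc (-1) 1)) :
    IntervalIntegrable (fun y => (φ y * gegWeight α y : ℂ)) volume (-1) 1 := by
  have h : ContinuousOn (fun y => (φ y : ℂ)) (Icc (-1) 1) :=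
    Complex.continuous_ofReal.comp_continuousOn hφ
  have := intervalIntegrable_gegWeight_smul hα le_rfl (by norm_num) le_rfl h
  simpa only [Complex.real_smul, mul_comm] using this

/-- The kernel `e^{icxy}` is annihilated by `L_c` in `x` minus `L_c` in `y`, so the transform maps
solutions to solutions. -/
lemma IsSol.fourierInt_ode (hα : -1 < α) (h : IsSol α c χ φ φ1 φ2 (Icc (-1) 1)) (x : ℝ) :
    let w : ℝ → ℂ := fun y => φ y * gegWeight α y
    let w1 : ℝ → ℂ := fun y => Complex.I * c * y * w y
    let w2 : ℝ → ℂ := fun y => Complex.I * c * y * w1 y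
    (1 - (x : ℂ) ^ 2) * fourierInt c w2 x - (2 * α + 2) * x * fourierInt c w1 x
      = (c ^ 2 * x ^ 2 - χ) * fourierInt c w x := by
  intro w w1 w2
  have hw : IntervalIntegrable w volume (-1) 1 := intervalIntegrable_ofReal_mul_gegWeight hα h.cont
  have hw1 : IntervalIntegrable w1 volume (-1) 1 := hw.continuousOn_mul (by fun_prop)
  have hw2 : IntervalIntegrable w2 volume (-1) 1 := hw1.continuousOn_mul (by fun_prop)
  have hd : ∀ (k : ℂ) (y : ℝ), HasDerivAt (fun y : ℝ => k * Complex.exp (Complex.I * c * x * y))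
      (k * (Complex.I * c * x) * Complex.exp (Complex.I * c * x * y)) y := by
    intro k y
    have h1 : HasDerivAt (fun y : ℂ => Complex.I * c * x * y) (Complex.I * c * x) y := by
      simpa using (hasDerivAt_id (y : ℂ)).const_mul (Complex.I * c * x)
    convert! (h1.cexp.const_mul k).comp_ofReal using 1
    ring
  have hg : HasC2On (fun y : ℝ => 1 * Complex.exp (Complex.I * c * x * y))
      (fun y => 1 * (Complex.I * c * x) * Complex.exp (Complex.I * c * x * y))
      (fun y => 1 * (Complex.I * c * x) * (Complex.I * c * x)
        * Complex.exp (Complex.I * c * x * y)) (Icc (-1) 1) :=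
    .of_hasDerivAt (fun y _ => hd _ y) (fun y _ => hd _ y) (by fun_prop)
  have hl := integral_lagrange hα le_rfl (by norm_num) le_rfl h.toHasC2On hg
  rw [gegWeight_add_one_one hα, gegWeight_add_one_neg_one hα, zero_smul, zero_smul, sub_zero] at hl
  rw [← sub_eq_zero, ← hl]
  simp only [fourierInt]
  rw [← intervalIntegral.integral_const_mul, ← intervalIntegral.integral_const_mul,
    ← intervalIntegral.integral_const_mul, ← intervalIntegral.integral_sub
      ((intervalIntegrable_exp_mul hw2 x).const_mul _)
      ((intervalIntegrable_exp_mul hw1 x).const_mul _), ← intervalIntegral.integral_sub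
      (((intervalIntegrable_exp_mul hw2 x).const_mul _).sub
      ((intervalIntegrable_exp_mul hw1 x).const_mul _))
      ((intervalIntegrable_exp_mul hw x).const_mul _)]
  refine intervalIntegral.integral_congr fun y hy => ?_
  rw [uIcc_of_le (by norm_num)] at hy
  simp only [Complex.real_smul, w2, w1, w]
  rw [h.ode y hy]
  push_cast
  linear_combination (Complex.exp (Complex.I * c * x * y) * c ^ 2 * φ y * gegWeight α y
    * (y ^ 2 - x ^ 2)) * Complex.I_sq

lemma HasC2On.of_fourierInt {w : ℝ → ℂ} (hw : IntervalIntegrable w volume (-1) 1) (s : Set ℝ) :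
    HasC2On (fun x : ℝ => fourierInt c w x)
      (fun x : ℝ => fourierInt c (fun y => Complex.I * c * y * w y) x)
      (fun x : ℝ => fourierInt c (fun y => Complex.I * c * y * (Complex.I * c * y * w y)) x) s := by
  have hw1 : IntervalIntegrable (fun y : ℝ => Complex.I * c * y * w y) volume (-1) 1 :=
    hw.continuousOn_mul (by fun_prop)
  have hw2 : IntervalIntegrable (fun y : ℝ => Complex.I * c * y * (Complex.I * c * y * w y))
    volume (-1) 1 := hw1.continuousOn_mul (by fun_prop)
  refine .of_hasDerivAt (fun x _ => (hasDerivAt_fourierInt hw x).comp_ofReal)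
    (fun x _ => (hasDerivAt_fourierInt hw1 x).comp_ofReal) fun x _ => ?_
  exact (hasDerivAt_fourierInt hw2 x).comp_ofReal.continuousAt.continuousWithinAt

lemma IsSol.of_complex {g g1 g2 : ℝ → ℂ} {s : Set ℝ} (hg : HasC2On g g1 g2 s)
    (ode : ∀ x ∈ s, (1 - (x : ℂ) ^ 2) * g2 x - (2 * α + 2) * x * g1 x
      = (c ^ 2 * x ^ 2 - χ) * g x) (L : ℂ →L[ℝ] ℝ) :
    IsSol α c χ (fun x => L (g x)) (fun x => L (g1 x)) (fun x => L (g2 x)) s := by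
  refine ⟨⟨fun x hx => L.hasFDerivAt.comp_hasDerivWithinAt x (hg.deriv1 x hx),
    fun x hx => L.hasFDerivAt.comp_hasDerivWithinAt x (hg.deriv2 x hx),
    L.continuous.comp_continuousOn hg.cont2⟩, fun x hx => ?_⟩
  have h1 : (1 - x ^ 2) • g2 x - ((2 * α + 2) * x) • g1 x = (c ^ 2 * x ^ 2 - χ) • g x := by
    simp only [Complex.real_smul]
    push_cast
    exact ode x hx
  have h2 := congrArg L h1
  simpa only [map_sub, map_smul, smul_eq_mul] using h2

/-- Eigenfunctions with the same eigenvalue are proportional. -/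
lemma IsSol.mul_eq_mul (hα : -1 < α) (h : IsSol α c χ φ φ1 φ2 (Icc (-1) 1))
    (h' : IsSol α c χ η η1 η2 (Icc (-1) 1)) {x : ℝ} (hx : x ∈ Icc (-1 : ℝ) 1) :
    η x * φ 1 = η 1 * φ x := by
  obtain ⟨ε, e1, e2⟩ : ∃ ε, φ (-1) = ε * φ 1 ∧ η (-1) = ε * η 1 := by
    rcases frob_ne_zero_or hα c χ with h0 | h0
    · exact ⟨1, by rw [h.neg_one_eq hα h0, one_mul], by rw [h'.neg_one_eq hα h0, one_mul]⟩
    · exact ⟨-1, by rw [h.neg_one_eq_neg hα h0]; ring, by rw [h'.neg_one_eq_neg hα h0]; ring⟩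
  rcases le_total 0 x with h0 | h0
  · rw [(h.eq_mul_frob hα e1 ⟨h0, hx.2⟩).1, (h'.eq_mul_frob hα e2 ⟨h0, hx.2⟩).1]
    ring
  · have hx' : -x ∈ Icc (0 : ℝ) 1 := ⟨by linarith, by linarith [hx.1]⟩
    have f1 := h.eq_mul_frob hα e1 hx'
    have f2 := h'.eq_mul_frob hα e2 hx'
    rw [neg_neg] at f1 f2
    rw [f1.2, f2.2, f1.1, f2.1]
    ring

lemma IsSol.fourierInt_eq (hα : -1 < α) (h : IsSol α c χ φ φ1 φ2 (Icc (-1) 1)) (h1 : φ 1 ≠ 0) :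
    ∃ μ : ℂ, ∀ x ∈ Icc (-1 : ℝ) 1, fourierInt c (fun y => φ y * gegWeight α y) x = μ * φ x := by
  have hw : IntervalIntegrable (fun y => (φ y * gegWeight α y : ℂ)) volume (-1) 1 :=
    intervalIntegrable_ofReal_mul_gegWeight hα h.cont
  have hC := HasC2On.of_fourierInt (c := c) hw (Icc (-1) 1)
  have hre := IsSol.of_complex hC (fun x _ => h.fourierInt_ode hα x) Complex.reCLM
  have him := IsSol.of_complex hC (fun x _ => h.fourierInt_ode hα x) Complex.imCLM
  refine ⟨fourierInt c (fun y => φ y * gegWeight α y) (1 : ℝ) / φ 1, fun x hx => ?_⟩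
  have e1 := h.mul_eq_mul hα hre hx
  have e2 := h.mul_eq_mul hα him hx
  simp only [Complex.reCLM_apply, Complex.imCLM_apply] at e1 e2
  rw [div_mul_eq_mul_div, eq_div_iff (Complex.ofReal_ne_zero.2 h1)]
  apply Complex.ext <;> simp only [Complex.re_mul_ofReal, Complex.im_mul_ofReal] <;> assumption

lemma fourierInt_zero (α c : ℝ) (φ : ℝ → ℝ) :
    fourierInt c (fun y => φ y * gegWeight α y) (0 : ℝ) = gegMoment α φ 0 := by
  rw [fourierInt, gegMoment, ← intervalIntegral.integral_ofReal]
  refine intervalIntegral.integral_congr fun y _ => ?_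
  simp

lemma fourierInt_deriv_zero (α c : ℝ) (φ : ℝ → ℝ) :
    fourierInt c (fun y => Complex.I * c * y * (φ y * gegWeight α y)) (0 : ℝ)
      = Complex.I * (c * gegMoment α φ 1 : ℝ) := by
  rw [fourierInt, gegMoment, Complex.ofReal_mul, ← intervalIntegral.integral_ofReal,
    ← intervalIntegral.integral_const_mul, ← intervalIntegral.integral_const_mul]
  refine intervalIntegral.integral_congr fun y _ => ?_
  simp
  ring

/-- The eigenvalue of the transform is a positive multiple of `i^n`. It is read off at `0`, from the
values in the even case and from the derivatives in the odd case: there the transform is a moment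
of `φ`, whose sign is that of `φ(1)`, while the sign of `φ(0)` or `φ'(0)` relative to `φ(1)`
depends on `n`. -/
lemma IsSol.exists_fourier_eigenvalue (hα : -1 < α) (hc : 0 < c)
    (h : IsSol α c χ φ φ1 φ2 (Icc (-1) 1)) (hne : ∃ x ∈ Icc (-1 : ℝ) 1, φ x ≠ 0) {n : ℕ}
    (hn : {χ' ∈ gegSpectrum α c | χ' < χ}.encard = n) :
    (∃ r : ℝ, 0 < r ∧ ∀ x ∈ Icc (-1 : ℝ) 1,
      fourierInt c (fun y => φ y * gegWeight α y) x = Complex.I ^ n * r * φ x) ∧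
    φ 1 ≠ 0 ∧ ∀ x ∈ Icc (-1 : ℝ) 1, φ (-x) = (-1) ^ n * φ x := by
  obtain ⟨h1, hpar⟩ := h.parity hα hne
  obtain ⟨μ, hμ⟩ := h.fourierInt_eq hα h1
  have hsign := frob_sign_of_encard hα hc ⟨φ, h.isGegEigen, hne⟩ hn
  have hpar' : ∀ {ε : ℝ}, ε * ε = 1 → φ (-1) = ε * φ 1 → ∀ x ∈ Icc (-1 : ℝ) 1, φ (-x) = ε * φ x := by
    intro ε hε2 hε x hx
    rcases le_total 0 x with h0 | h0
    · exact (h.eq_mul_frob hα hε ⟨h0, hx.2⟩).2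
    · have := (h.eq_mul_frob hα hε (x := -x) ⟨by linarith, by linarith [hx.1]⟩).2
      rw [neg_neg] at this
      rw [this, ← mul_assoc, hε2, one_mul]
  have hpow : ∀ m : ℕ, ((-1 : ℝ) ^ m) * (-1) ^ m = 1 := fun m => by rw [← mul_pow]; simp
  rcases Nat.even_or_odd' n with ⟨m, hm | hm⟩
  · obtain ⟨hg, hf⟩ := hsign.1 m hm
    have hφ1 : φ (-1) = (-1) ^ 0 * φ 1 := by
      rcases hpar with h2 | h2
      · rw [h2.2, pow_zero]
      · exact absurd hf (by rw [h2.1]; simp)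
    have hM := h.moment_pos hα hc (Or.inl rfl) hφ1 h1
    have e0 := hμ 0 (by norm_num)
    rw [fourierInt_zero] at e0
    have hφ0 := (h.eq_frob hα).1 0 (by norm_num)
    have hf0 : frob α c χ 0 ≠ 0 := fun h0 => by simp [h0] at hf
    refine ⟨⟨gegMoment α φ 0 * φ 1 / ((-1) ^ m * frob α c χ 0 * φ 1 ^ 2), ?_, ?_⟩, h1, ?_⟩
    · have h2 : 0 < φ 1 ^ 2 := by positivity
      exact div_pos (by linarith) (mul_pos hf h2)
    · intro x hx
      rw [hμ x hx]
      congr 1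
      rw [hφ0] at e0
      have e1 : μ = gegMoment α φ 0 / (φ 1 * frob α c χ 0 : ℝ) := by
        rw [e0, mul_div_cancel_right₀]
        exact_mod_cast mul_ne_zero h1 hf0
      rw [e1, hm, pow_mul, Complex.I_sq]
      have hp : ((-1 : ℂ)) ^ m ≠ 0 := by simp
      have hfC : (frob α c χ 0 : ℂ) ≠ 0 := by exact_mod_cast hf0
      have h1C : (φ 1 : ℂ) ≠ 0 := by exact_mod_cast h1
      push_cast
      field_simp
    · rw [hm, pow_mul]
      simp only [even_two, Even.neg_pow, one_pow]
      exact hpar' (by norm_num) (by simpa using hφ1)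
  · obtain ⟨hf, hg⟩ := hsign.2 m hm
    have hφ1 : φ (-1) = (-1) ^ 1 * φ 1 := by
      rcases hpar with h2 | h2
      · exact absurd hg (by rw [h2.1]; simp)
      · rw [h2.2, pow_one]
    have hM := h.moment_pos hα hc (Or.inr rfl) hφ1 h1
    have hnh : Icc (-1 : ℝ) 1 ∈ 𝓝 (0 : ℝ) := Icc_mem_nhds (by norm_num) (by norm_num)
    -- compare the derivatives at `0`
    have e0 : Complex.I * (c * gegMoment α φ 1 : ℝ) = μ * φ1 0 := by
      rw [← fourierInt_deriv_zero]
      have d1 := (hasDerivAt_fourierInt (c := c)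
        (intervalIntegrable_ofReal_mul_gegWeight hα h.cont) ((0 : ℝ) : ℂ)).comp_ofReal
      have d2 := (h.hasDerivAt hnh).ofReal_comp.const_mul μ
      refine d1.unique (d2.congr_of_eventuallyEq ?_)
      filter_upwards [hnh] with x hx using hμ x hx
    have hφ0 := (h.eq_frob hα).2 0 (by norm_num)
    have hg0 : frob1 α c χ 0 ≠ 0 := fun h0 => by simp [h0] at hg
    refine ⟨⟨c * gegMoment α φ 1 * φ 1 / ((-1) ^ m * frob1 α c χ 0 * φ 1 ^ 2), ?_, ?_⟩, h1, ?_⟩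
    · have h2 : 0 < φ 1 ^ 2 := by positivity
      refine div_pos ?_ (mul_pos hg h2)
      have := mul_pos hc hM
      linarith
    · intro x hx
      rw [hμ x hx]
      congr 1
      rw [hφ0] at e0
      have e1 : μ = Complex.I * (c * gegMoment α φ 1 : ℝ) / (φ 1 * frob1 α c χ 0 : ℝ) := by
        rw [e0, mul_div_cancel_right₀]
        exact_mod_cast mul_ne_zero h1 hg0
      rw [e1, hm, pow_succ, pow_mul, Complex.I_sq]
      have hp : ((-1 : ℂ)) ^ m ≠ 0 := by simp
      have hfC : (frob1 α c χ 0 : ℂ) ≠ 0 := by exact_mod_cast hg0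
      have h1C : (φ 1 : ℂ) ≠ 0 := by exact_mod_cast h1
      push_cast
      field_simp
    · rw [hm, pow_succ, pow_mul]
      simp only [even_two, Even.neg_pow, one_pow, one_mul]
      exact hpar' (by norm_num) (by simpa using hφ1)

end

/-! ### The moments of the Jacobi polynomials -/

lemma integral_gegWeight {α : ℝ} (hα : -1 < α) :
    ∫ y in (-1 : ℝ)..1, gegWeight α y = gegH α 0 := by
  have hb : ∫ t in (0 : ℝ)..1, t ^ α * (1 - t) ^ α
      = Real.Gamma (α + 1) * Real.Gamma (α + 1) / Real.Gamma (2 * α + 2) := by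
    have h := Complex.betaIntegral_eq_Gamma_mul_div (α + 1 : ℝ) (α + 1 : ℝ)
      (by simp; linarith) (by simp; linarith)
    rw [← Complex.ofReal_add, Complex.Gamma_ofReal, Complex.Gamma_ofReal, Complex.betaIntegral,
      show α + 1 + (α + 1) = 2 * α + 2 by ring] at h
    have e : ∫ x in (0 : ℝ)..1, (x : ℂ) ^ (((α + 1 : ℝ) : ℂ) - 1) * (1 - x) ^ (((α + 1 : ℝ) : ℂ) - 1)
        = ((∫ t in (0 : ℝ)..1, t ^ α * (1 - t) ^ α : ℝ) : ℂ) := by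
      rw [← intervalIntegral.integral_ofReal]
      refine intervalIntegral.integral_congr fun x hx => ?_
      rw [uIcc_of_le zero_le_one] at hx
      simp only [Complex.ofReal_mul]
      rw [Complex.ofReal_cpow hx.1, Complex.ofReal_cpow (by linarith [hx.2])]
      push_cast
      simp
    rw [e] at h
    exact_mod_cast h
  have hs := intervalIntegral.integral_comp_mul_sub (a := 0) (b := 1) (gegWeight α)
    (two_ne_zero (α := ℝ)) 1
  rw [mul_zero, zero_sub, mul_one, show (2 : ℝ) - 1 = 1 by norm_num, smul_eq_mul] at hs
  have h2 : ∫ x in (0 : ℝ)..1, gegWeight α (2 * x - 1)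
      = 4 ^ α * ∫ t in (0 : ℝ)..1, t ^ α * (1 - t) ^ α := by
    rw [← intervalIntegral.integral_const_mul]
    refine intervalIntegral.integral_congr fun x hx => ?_
    rw [uIcc_of_le zero_le_one] at hx
    simp only [gegWeight]
    rw [← Real.mul_rpow hx.1 (by linarith [hx.2]), ← Real.mul_rpow (by norm_num)
      (mul_nonneg hx.1 (by linarith [hx.2]))]
    ring_nf
  have h4 : (2 : ℝ) ^ (2 * α + 1) = 2 * 4 ^ α := by
    rw [Real.rpow_add two_pos, Real.rpow_one, Real.rpow_mul two_pos.le]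
    norm_num
    ring
  rw [gegH, h4]
  rw [h2, hb] at hs
  linear_combination -2 * hs

/-- The moments `∫_{-1}^1 y^{k+2l} P_k^{(α,α)}(y) ω_α(y) dy` in closed form; all other moments of the
polynomial vanish. -/
noncomputable def jacobiMoment (α : ℝ) (k l : ℕ) : ℝ :=
  ((k + 2 * l).factorial : ℝ) * (√Real.pi * Real.Gamma (k + α + 1))
    / (4 ^ l * l.factorial * k.factorial * 2 ^ k * Real.Gamma (k + l + α + 3 / 2))

section

variable {α : ℝ}

lemma jacobiMoment_zero_zero (hα : -1 < α) : jacobiMoment α 0 0 = gegH α 0 := by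
  have h := Real.Gamma_mul_Gamma_add_half_of_pos (s := α + 1) (by linarith)
  rw [show α + 1 + 1 / 2 = α + 3 / 2 by ring, show 2 * (α + 1) = 2 * α + 2 by ring] at h
  have h1 : Real.Gamma (α + 3 / 2) ≠ 0 := (Real.Gamma_pos_of_pos (by linarith)).ne'
  have h2 : Real.Gamma (2 * α + 2) ≠ 0 := (Real.Gamma_pos_of_pos (by linarith)).ne'
  have h3 : Real.Gamma (α + 1) ≠ 0 := (Real.Gamma_pos_of_pos (by linarith)).ne'
  have h4 : (2 : ℝ) ^ (2 * α + 1) * 2 ^ (1 - (2 * α + 2)) = 1 := by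
    rw [← Real.rpow_add two_pos, show 2 * α + 1 + (1 - (2 * α + 2)) = 0 by ring, Real.rpow_zero]
  simp only [jacobiMoment, gegH, Nat.cast_zero, mul_zero, add_zero, Nat.factorial_zero, Nat.cast_one,
    zero_add, pow_zero, mul_one, one_mul]
  rw [div_eq_div_iff h1 h2]
  linear_combination (-(Real.Gamma (α + 1) * 2 ^ (2 * α + 1))) * h
    - (Real.Gamma (α + 1) * Real.Gamma (2 * α + 2) * √Real.pi) * h4

/-- For `c = χ = 0` the constants solve the equation, so the moment recursion of solutions computes
the moments of the weight. -/
lemma isSol_one (α : ℝ) (s : Set ℝ) : IsSol α 0 0 (fun _ => 1) (fun _ => 0) (fun _ => 0) s :=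
  ⟨.of_hasDerivAt (fun x _ => hasDerivAt_const x 1) (fun x _ => hasDerivAt_const x 0)
    continuousOn_const, fun x _ => by ring⟩

lemma gegMoment_one_even (hα : -1 < α) (l : ℕ) :
    gegMoment α (fun _ => 1) (2 * l) = jacobiMoment α 0 l := by
  induction l with
  | zero =>
    rw [jacobiMoment_zero_zero hα, ← integral_gegWeight hα]
    simp [gegMoment]
  | succ l ih =>
    have h := (isSol_one α (Icc (-1) 1)).moment_recursion hα (2 * l + 2)
    simp only [Nat.add_sub_cancel, show 2 * l + 2 - 1 = 2 * l + 1 by omega] at h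
    push_cast at h
    rw [show 2 * (l + 1) = 2 * l + 2 by ring]
    have hl : (0 : ℝ) ≤ l := by positivity
    have e1 : (2 * l + 2 : ℝ) * (2 * l + 2 + 2 * α + 1) ≠ 0 :=
      mul_ne_zero (by positivity) (by linarith)
    rw [ih] at h
    have hG : Real.Gamma (l + 1 + α + 3 / 2) = (l + α + 3 / 2) * Real.Gamma (l + α + 3 / 2) := by
      rw [← Real.Gamma_add_one (by linarith : (l + α + 3 / 2 : ℝ) ≠ 0)]
      ring_nf
    have hG0 : Real.Gamma (l + α + 3 / 2) ≠ 0 := (Real.Gamma_pos_of_pos (by linarith)).ne'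
    -- the denominators are made atoms before fractions are cleared, here and below
    obtain ⟨p, hp⟩ : ∃ p, p = (l : ℝ) + α + 3 / 2 := ⟨_, rfl⟩
    have hp0 : p ≠ 0 := by rw [hp]; linarith
    rw [← hp] at hG hG0
    have h3 : jacobiMoment α 0 (l + 1) * ((2 * l + 2 : ℝ) * (2 * l + 2 + 2 * α + 1))
        = (2 * l + 2) * (2 * l + 1) * jacobiMoment α 0 l := by
      simp only [jacobiMoment, Nat.cast_zero, zero_add, Nat.cast_add, Nat.cast_one, hG,
        show 2 * (l + 1) = 2 * l + 1 + 1 by ring, Nat.factorial_succ, Nat.cast_mul, pow_succ, ← hp]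
      push_cast
      field_simp
      rw [hp]
      ring
    exact mul_right_cancel₀ e1 (by linarith)

lemma gegMoment_one_odd (hα : -1 < α) (l : ℕ) : gegMoment α (fun _ => 1) (2 * l + 1) = 0 := by
  induction l with
  | zero =>
    have h := (isSol_one α (Icc (-1) 1)).moment_recursion hα 1
    simp only [Nat.sub_self, Nat.cast_zero, mul_zero, zero_mul, Nat.cast_one] at h
    have e1 : 1 * (1 + 2 * α + 1) ≠ 0 := by linarith
    refine mul_left_cancel₀ e1 ?_
    rw [mul_zero, zero_add]
    linarith
  | succ l ih =>
    have h := (isSol_one α (Icc (-1) 1)).moment_recursion hα (2 * l + 3)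
    simp only [show 2 * l + 3 - 1 = 2 * l + 2 by omega, show 2 * l + 2 - 1 = 2 * l + 1 by omega] at h
    rw [ih] at h
    push_cast at h
    have hl : (0 : ℝ) ≤ l := by positivity
    have e1 : (2 * l + 3 : ℝ) * (2 * l + 3 + 2 * α + 1) ≠ 0 :=
      mul_ne_zero (by positivity) (by linarith)
    refine mul_left_cancel₀ e1 ?_
    rw [show 2 * (l + 1) + 1 = 2 * l + 3 by ring, mul_zero]
    linarith

lemma jacobiP_one_apply (x : ℝ) : jacobiP α α 1 x = (α + 1) * x := by
  simp only [jacobiP]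
  ring

/-- The recursion in the ultraspherical case. -/
lemma jacobiP_add_two (hα : -1 < α) (k : ℕ) (x : ℝ) : jacobiP α α (k + 2) x
    = (2 * k + 2 * α + 3) * (k + α + 2) / ((k + 2) * (k + 2 * α + 2)) * (x * jacobiP α α (k + 1) x)
      - (k + α + 1) * (k + α + 2) / ((k + 2) * (k + 2 * α + 2)) * jacobiP α α k x := by
  have hk : (0 : ℝ) ≤ k := by positivity
  have h1 : (k : ℝ) + 2 ≠ 0 := by positivity
  have h2 : (k : ℝ) + 2 * α + 2 ≠ 0 := by linarith
  have h3 : (k : ℝ) + α + 1 ≠ 0 := by linarith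
  simp only [jacobiP, sub_self, zero_mul, zero_div, add_zero]
  have e1 : ((k : ℝ) + 1 + 1) = k + 2 := by ring
  have e2 : (k : ℝ) + 1 + α + α + 1 = k + 2 * α + 2 := by ring
  have e3 : 2 * ((k : ℝ) + 1) + α + α = 2 * (k + α + 1) := by ring
  have e4 : (k : ℝ) + 1 + α = k + α + 1 := by ring
  rw [e1, e2, e3, e4]
  congr 1
  · field_simp
    ring
  · field_simp
    ring

lemma continuous_jacobiP (hα : -1 < α) (k : ℕ) : Continuous (jacobiP α α k) := by
  induction k using Nat.twoStepInduction with
  | zero => exact continuous_const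
  | one => exact (continuous_const.mul continuous_id).congr fun x => (jacobiP_one_apply x).symm
  | more k h0 h1 =>
    have : Continuous fun x => (2 * k + 2 * α + 3) * (k + α + 2) / ((k + 2) * (k + 2 * α + 2))
      * (x * jacobiP α α (k + 1) x)
      - (k + α + 1) * (k + α + 2) / ((k + 2) * (k + 2 * α + 2)) * jacobiP α α k x := by fun_prop
    exact this.congr fun x => (jacobiP_add_two hα k x).symm

lemma gegMoment_jacobiP_one (j : ℕ) :
    gegMoment α (jacobiP α α 1) j = (α + 1) * gegMoment α (fun _ => 1) (j + 1) := by
  rw [gegMoment, gegMoment, ← intervalIntegral.integral_const_mul]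
  refine intervalIntegral.integral_congr fun x _ => ?_
  simp only [jacobiP_one_apply]
  ring

lemma gegMoment_jacobiP_add_two (hα : -1 < α) (k j : ℕ) : gegMoment α (jacobiP α α (k + 2)) j
    = (2 * k + 2 * α + 3) * (k + α + 2) / ((k + 2) * (k + 2 * α + 2))
        * gegMoment α (jacobiP α α (k + 1)) (j + 1)
      - (k + α + 1) * (k + α + 2) / ((k + 2) * (k + 2 * α + 2)) * gegMoment α (jacobiP α α k) j := by
  have h0 := intervalIntegrable_gegMoment hα (continuous_jacobiP hα k).continuousOn j
  have h1 := intervalIntegrable_gegMoment hα (continuous_jacobiP hα (k + 1)).continuousOn (j + 1)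
  simp only [gegMoment]
  rw [← intervalIntegral.integral_const_mul, ← intervalIntegral.integral_const_mul,
    ← intervalIntegral.integral_sub (h1.const_mul _) (h0.const_mul _)]
  refine intervalIntegral.integral_congr fun x _ => ?_
  simp only [jacobiP_add_two hα]
  ring

lemma jacobiMoment_one (hα : -1 < α) (l : ℕ) :
    jacobiMoment α 1 l = (α + 1) * jacobiMoment α 0 (l + 1) := by
  have hl : (0 : ℝ) ≤ l := by positivity
  have hG : Real.Gamma (1 + α + 1) = (α + 1) * Real.Gamma (α + 1) := by
    rw [← Real.Gamma_add_one (by linarith : α + 1 ≠ 0)]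
    ring_nf
  have hG0 : Real.Gamma (l + 1 + α + 3 / 2) ≠ 0 := (Real.Gamma_pos_of_pos (by linarith)).ne'
  simp only [jacobiMoment, Nat.cast_zero, zero_add, Nat.cast_add, Nat.cast_one, hG,
    show 2 * (l + 1) = 1 + 2 * l + 1 by ring, add_comm (1 : ℝ) (l : ℝ)]
  simp only [Nat.factorial_succ (1 + 2 * l), Nat.factorial_succ l, Nat.factorial_zero,
    Nat.factorial_one, pow_succ, pow_zero]
  push_cast
  field_simp
  ring

lemma jacobiMoment_add_two_zero (hα : -1 < α) (k : ℕ) :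
    (2 * k + 2 * α + 3) * (k + α + 2) / ((k + 2) * (k + 2 * α + 2)) * jacobiMoment α (k + 1) 0
      = (k + α + 1) * (k + α + 2) / ((k + 2) * (k + 2 * α + 2)) * jacobiMoment α k 0 := by
  have hk : (0 : ℝ) ≤ k := by positivity
  have h2 : (k : ℝ) + 2 * α + 2 ≠ 0 := by linarith
  have h3 : (k : ℝ) + α + 3 / 2 ≠ 0 := by linarith
  have hG : Real.Gamma (k + 1 + α + 1) = (k + α + 1) * Real.Gamma (k + α + 1) := by
    rw [← Real.Gamma_add_one (by linarith : (k : ℝ) + α + 1 ≠ 0)]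
    ring_nf
  have hG' : Real.Gamma (k + 1 + α + 3 / 2) = (k + α + 3 / 2) * Real.Gamma (k + α + 3 / 2) := by
    rw [← Real.Gamma_add_one h3]
    ring_nf
  have hG0 : Real.Gamma (k + α + 3 / 2) ≠ 0 := (Real.Gamma_pos_of_pos (by linarith)).ne'
  simp only [jacobiMoment, Nat.cast_add, Nat.cast_one, Nat.cast_zero, add_zero, mul_zero, hG, hG',
    pow_succ, Nat.factorial_succ, Nat.cast_mul]
  obtain ⟨p, hp⟩ : ∃ p, p = (k : ℝ) + α + 3 / 2 := ⟨_, rfl⟩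
  obtain ⟨d, hd⟩ : ∃ d, d = (k : ℝ) + 2 * α + 2 := ⟨_, rfl⟩
  rw [← hp] at h3 hG0 ⊢
  rw [← hd] at h2 ⊢
  field_simp
  rw [hp]
  ring

lemma jacobiMoment_add_two (hα : -1 < α) (k l : ℕ) : jacobiMoment α (k + 2) l
    = (2 * k + 2 * α + 3) * (k + α + 2) / ((k + 2) * (k + 2 * α + 2)) * jacobiMoment α (k + 1) (l + 1)
      - (k + α + 1) * (k + α + 2) / ((k + 2) * (k + 2 * α + 2)) * jacobiMoment α k (l + 1) := by
  have hk : (0 : ℝ) ≤ k := by positivity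
  have hl : (0 : ℝ) ≤ l := by positivity
  have h2 : (k : ℝ) + 2 * α + 2 ≠ 0 := by linarith
  have h3 : (k : ℝ) + l + α + 5 / 2 ≠ 0 := by linarith
  have hG1 : Real.Gamma (k + 1 + α + 1) = (k + α + 1) * Real.Gamma (k + α + 1) := by
    rw [← Real.Gamma_add_one (by linarith : (k : ℝ) + α + 1 ≠ 0)]
    ring_nf
  have hG2 : Real.Gamma (k + 2 + α + 1) = (k + α + 2) * ((k + α + 1) * Real.Gamma (k + α + 1)) := by
    rw [← Real.Gamma_add_one (by linarith : (k : ℝ) + α + 1 ≠ 0),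
      show (k : ℝ) + α + 1 + 1 = k + α + 2 by ring,
      ← Real.Gamma_add_one (by linarith : (k : ℝ) + α + 2 ≠ 0)]
    ring_nf
  have hG' : Real.Gamma (k + (l + 1) + α + 3 / 2) = Real.Gamma (k + l + α + 5 / 2) := by ring_nf
  have hG'1 : Real.Gamma (k + 1 + (l + 1) + α + 3 / 2)
      = (k + l + α + 5 / 2) * Real.Gamma (k + l + α + 5 / 2) := by
    rw [← Real.Gamma_add_one h3]
    ring_nf
  have hG'2 : Real.Gamma (k + 2 + l + α + 3 / 2)
      = (k + l + α + 5 / 2) * Real.Gamma (k + l + α + 5 / 2) := by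
    rw [← Real.Gamma_add_one h3]
    ring_nf
  have hG0 : Real.Gamma (k + l + α + 5 / 2) ≠ 0 := (Real.Gamma_pos_of_pos (by linarith)).ne'
  have f1 : k + 2 + 2 * l = k + 2 * (l + 1) := by ring
  have f2 : k + 1 + 2 * (l + 1) = k + 2 * (l + 1) + 1 := by ring
  simp only [jacobiMoment, f1, f2, Nat.factorial_succ (k + 2 * (l + 1)), Nat.factorial_succ (k + 1),
    Nat.factorial_succ k, Nat.factorial_succ l, pow_succ]
  push_cast
  rw [hG1, hG2, hG', hG'1, hG'2]
  obtain ⟨p, hp⟩ : ∃ p, p = (k : ℝ) + l + α + 5 / 2 := ⟨_, rfl⟩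
  obtain ⟨d, hd⟩ : ∃ d, d = (k : ℝ) + 2 * α + 2 := ⟨_, rfl⟩
  rw [← hp] at h3 hG0 ⊢
  rw [← hd] at h2 ⊢
  field_simp
  rw [hp, hd]
  ring

/-- All moments of the Jacobi polynomials, by the three term recursion. That the moments below the
degree vanish is the orthogonality. -/
lemma gegMoment_jacobiP (hα : -1 < α) (k : ℕ) :
    (∀ l, gegMoment α (jacobiP α α k) (k + 2 * l) = jacobiMoment α k l) ∧
      ∀ j, (∀ l, j ≠ k + 2 * l) → gegMoment α (jacobiP α α k) j = 0 := by
  induction k using Nat.twoStepInduction with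
  | zero =>
    have e : jacobiP α α 0 = fun _ => 1 := rfl
    rw [e]
    refine ⟨fun l => by rw [zero_add, gegMoment_one_even hα], fun j hj => ?_⟩
    rcases Nat.even_or_odd' j with ⟨l, rfl | rfl⟩
    · exact absurd (zero_add _).symm (hj l)
    · exact gegMoment_one_odd hα l
  | one =>
    refine ⟨fun l => ?_, fun j hj => ?_⟩
    · rw [gegMoment_jacobiP_one, show 1 + 2 * l + 1 = 2 * (l + 1) by ring, gegMoment_one_even hα,
        jacobiMoment_one hα]
    · rcases Nat.even_or_odd' j with ⟨l, rfl | rfl⟩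
      · rw [gegMoment_jacobiP_one, gegMoment_one_odd hα, mul_zero]
      · exact absurd (add_comm _ _) (hj l)
  | more k h0 h1 =>
    refine ⟨fun l => ?_, fun j hj => ?_⟩
    · rw [gegMoment_jacobiP_add_two hα, show k + 2 + 2 * l + 1 = k + 1 + 2 * (l + 1) by ring, h1.1,
        show k + 2 + 2 * l = k + 2 * (l + 1) by ring, h0.1, jacobiMoment_add_two hα]
    · rw [gegMoment_jacobiP_add_two hα]
      by_cases hjk : j = k
      · have e0 := h0.1 0
        have e1 := h1.1 0
        rw [mul_zero, add_zero] at e0 e1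
        rw [hjk, e0, e1, jacobiMoment_add_two_zero hα, sub_self]
      · have hj0 : ∀ l, j ≠ k + 2 * l := by
          intro l hl
          rcases l with _ | l
          · exact hjk (by omega)
          · exact hj l (by omega)
        rw [h0.2 j hj0, h1.2 (j + 1) fun l hl => hj0 l (by omega)]
        ring

end

/-! ### Orthonormality, completeness and bounds -/

section

variable {α : ℝ}

lemma gegH_pos (hα : -1 < α) (k : ℕ) : 0 < gegH α k := by
  rcases k with _ | k
  · have h1 : 0 < Real.Gamma (α + 1) := Real.Gamma_pos_of_pos (by linarith)
    have h2 : 0 < Real.Gamma (2 * α + 2) := Real.Gamma_pos_of_pos (by linarith)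
    rw [gegH]
    positivity
  · have hk : (0 : ℝ) ≤ k := by positivity
    have h1 : 0 < Real.Gamma ((k : ℝ) + 1 + α + 1) := Real.Gamma_pos_of_pos (by linarith)
    have h2 : 0 < Real.Gamma ((k : ℝ) + 1 + 2 * α + 1) := Real.Gamma_pos_of_pos (by linarith)
    have h3 : 0 < 2 * ((k : ℝ) + 1) + 2 * α + 1 := by linarith
    rw [gegH]
    positivity

lemma gegH_add_two (hα : -1 < α) (k : ℕ) : gegH α (k + 2) = gegH α (k + 1)
    * ((k + α + 2) ^ 2 * (2 * k + 2 * α + 3) / ((k + 2) * (2 * k + 2 * α + 5) * (k + 2 * α + 2))) := by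
  have hk : (0 : ℝ) ≤ k := by positivity
  have hG1 : Real.Gamma ((k : ℝ) + 1 + 1 + α + 1) = (k + α + 2) * Real.Gamma (k + 1 + α + 1) := by
    rw [show (k : ℝ) + 1 + 1 + α + 1 = (k + α + 2) + 1 by ring,
      Real.Gamma_add_one (by linarith : (k : ℝ) + α + 2 ≠ 0)]
    ring_nf
  have hG2 : Real.Gamma ((k : ℝ) + 1 + 1 + 2 * α + 1)
      = (k + 2 * α + 2) * Real.Gamma (k + 1 + 2 * α + 1) := by
    rw [show (k : ℝ) + 1 + 1 + 2 * α + 1 = (k + 2 * α + 2) + 1 by ring,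
      Real.Gamma_add_one (by linarith : (k : ℝ) + 2 * α + 2 ≠ 0)]
    ring_nf
  have hG0 : Real.Gamma ((k : ℝ) + 1 + 2 * α + 1) ≠ 0 :=
    (Real.Gamma_pos_of_pos (by linarith)).ne'
  simp only [gegH, Nat.factorial_succ (k + 1)]
  push_cast
  rw [hG1, hG2]
  obtain ⟨d, hd⟩ : ∃ d, d = (k : ℝ) + 2 * α + 2 := ⟨_, rfl⟩
  obtain ⟨p, hp⟩ : ∃ p, p = 2 * (k : ℝ) + 2 * α + 3 := ⟨_, rfl⟩
  obtain ⟨q, hq⟩ : ∃ q, q = 2 * (k : ℝ) + 2 * α + 5 := ⟨_, rfl⟩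
  have hd0 : d ≠ 0 := by rw [hd]; linarith
  have hp0 : p ≠ 0 := by rw [hp]; linarith
  have hq0 : q ≠ 0 := by rw [hq]; linarith
  rw [show 2 * ((k : ℝ) + 1 + 1) + 2 * α + 1 = q by rw [hq]; ring,
    show 2 * ((k : ℝ) + 1) + 2 * α + 1 = p by rw [hp]; ring, ← hd, ← hp, ← hq]
  field_simp
  ring

lemma gegH_one (hα : -1 < α) : gegH α 1 = (α + 1) * jacobiMoment α 1 0 := by
  have h0 := jacobiMoment_zero_zero hα
  have hG : Real.Gamma (1 + α + 1) = (α + 1) * Real.Gamma (α + 1) := by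
    rw [← Real.Gamma_add_one (by linarith : α + 1 ≠ 0)]
    ring_nf
  have hG' : Real.Gamma (1 + α + 3 / 2) = (α + 3 / 2) * Real.Gamma (α + 3 / 2) := by
    rw [← Real.Gamma_add_one (by linarith : α + 3 / 2 ≠ 0)]
    ring_nf
  have h1 : Real.Gamma (α + 3 / 2) ≠ 0 := (Real.Gamma_pos_of_pos (by linarith)).ne'
  have h2 : Real.Gamma (2 * α + 2) ≠ 0 := (Real.Gamma_pos_of_pos (by linarith)).ne'
  have e1 : gegH α 1 = (α + 1) ^ 2 / (2 * α + 3) * gegH α 0 := by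
    simp only [gegH, Nat.cast_zero, zero_add, mul_one, hG, Nat.factorial_one, Nat.cast_one, one_mul]
    rw [show 1 + 2 * α + 1 = 2 * α + 2 by ring, show 2 + 2 * α + 1 = 2 * α + 3 by ring]
    obtain ⟨p, hp⟩ : ∃ p, p = 2 * α + 3 := ⟨_, rfl⟩
    have hp0 : p ≠ 0 := by rw [hp]; linarith
    rw [← hp]
    field_simp
  have e2 : jacobiMoment α 1 0 = (α + 1) / (2 * α + 3) * jacobiMoment α 0 0 := by
    simp only [jacobiMoment, Nat.cast_zero, mul_zero, add_zero, Nat.cast_one, hG, hG',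
      Nat.factorial_one, Nat.factorial_zero, pow_zero, zero_add, pow_one, one_mul, mul_one]
    rw [show α + 3 / 2 = (2 * α + 3) / 2 by ring] at h1 ⊢
    obtain ⟨p, hp⟩ : ∃ p, p = 2 * α + 3 := ⟨_, rfl⟩
    have hp0 : p ≠ 0 := by rw [hp]; linarith
    rw [← hp] at h1 ⊢
    field_simp
  rw [e1, e2, h0]
  ring

/-- The leading coefficient of `P_k^{(α,α)}`. -/
noncomputable def jacobiLead (α : ℝ) : ℕ → ℝ
  | 0 => 1
  | 1 => α + 1
  | k + 2 => (2 * k + 2 * α + 3) * (k + α + 2) / ((k + 2) * (k + 2 * α + 2)) * jacobiLead α (k + 1)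

lemma jacobiLead_mul (hα : -1 < α) (k : ℕ) : jacobiLead α k * jacobiMoment α k 0 = gegH α k := by
  rcases k with _ | k
  · rw [jacobiLead, one_mul, jacobiMoment_zero_zero hα]
  induction k with
  | zero => rw [gegH_one hα]; rfl
  | succ k ih =>
    have hk : (0 : ℝ) ≤ k := by positivity
    have hG1 : Real.Gamma ((k : ℝ) + 1 + 1 + α + 1) = (k + α + 2) * Real.Gamma (k + 1 + α + 1) := by
      rw [show (k : ℝ) + 1 + 1 + α + 1 = (k + α + 2) + 1 by ring,
        Real.Gamma_add_one (by linarith : (k : ℝ) + α + 2 ≠ 0)]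
      ring_nf
    have hG2 : Real.Gamma ((k : ℝ) + 1 + 1 + α + 3 / 2)
        = ((2 * k + 2 * α + 5) / 2) * Real.Gamma (k + 1 + α + 3 / 2) := by
      rw [show (k : ℝ) + 1 + 1 + α + 3 / 2 = ((2 * k + 2 * α + 5) / 2) + 1 by ring,
        Real.Gamma_add_one (by linarith : (2 * (k : ℝ) + 2 * α + 5) / 2 ≠ 0)]
      ring_nf
    have hG0 : Real.Gamma ((k : ℝ) + 1 + α + 3 / 2) ≠ 0 :=
      (Real.Gamma_pos_of_pos (by linarith)).ne'
    have e : jacobiMoment α (k + 2) 0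
        = (k + α + 2) / (2 * k + 2 * α + 5) * jacobiMoment α (k + 1) 0 := by
      simp only [jacobiMoment, mul_zero, add_zero, Nat.factorial_succ (k + 1)]
      push_cast
      rw [show (k : ℝ) + 2 = k + 1 + 1 by ring, hG1, add_zero, add_zero, hG2]
      obtain ⟨q, hq⟩ : ∃ q, q = 2 * (k : ℝ) + 2 * α + 5 := ⟨_, rfl⟩
      have hq0 : q ≠ 0 := by rw [hq]; linarith
      rw [← hq]
      field_simp
      ring
    rw [show k + 1 + 1 = k + 2 from rfl, gegH_add_two hα, ← ih, e, jacobiLead]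
    obtain ⟨d, hd⟩ : ∃ d, d = (k : ℝ) + 2 * α + 2 := ⟨_, rfl⟩
    obtain ⟨q, hq⟩ : ∃ q, q = 2 * (k : ℝ) + 2 * α + 5 := ⟨_, rfl⟩
    have hd0 : d ≠ 0 := by rw [hd]; linarith
    have hq0 : q ≠ 0 := by rw [hq]; linarith
    rw [← hd, ← hq]
    field_simp

lemma jacobiLead_ne_zero (hα : -1 < α) (k : ℕ) : jacobiLead α k ≠ 0 := by
  intro h
  have := jacobiLead_mul hα k
  rw [h, zero_mul] at this
  exact (gegH_pos hα k).ne this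

open Polynomial in
lemma exists_polynomial_jacobiP (hα : -1 < α) (k : ℕ) : ∃ p : ℝ[X],
    (∀ x, p.eval x = jacobiP α α k x) ∧ p.natDegree ≤ k ∧ p.coeff k = jacobiLead α k := by
  induction k using Nat.twoStepInduction with
  | zero => exact ⟨1, by simp [jacobiP], by simp, by simp [jacobiLead]⟩
  | one =>
    refine ⟨C (α + 1) * X, fun x => ?_, (natDegree_C_mul_le _ _).trans natDegree_X_le, by simp [jacobiLead]⟩
    rw [jacobiP_one_apply]
    simp
  | more k h0 h1 =>
    obtain ⟨p0, e0, d0, -⟩ := h0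
    obtain ⟨p1, e1, d1, l1⟩ := h1
    refine ⟨C ((2 * k + 2 * α + 3) * (k + α + 2) / ((k + 2) * (k + 2 * α + 2))) * (X * p1)
      - C ((k + α + 1) * (k + α + 2) / ((k + 2) * (k + 2 * α + 2))) * p0, fun x => ?_, ?_, ?_⟩
    · rw [jacobiP_add_two hα, ← e0, ← e1]
      simp only [eval_sub, eval_mul, eval_C, eval_X]
    · refine (natDegree_sub_le _ _).trans (max_le ?_ ?_)
      · refine (natDegree_C_mul_le _ _).trans (natDegree_mul_le.trans ?_)
        rw [natDegree_X]
        omega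
      · exact (natDegree_C_mul_le _ _).trans (by omega)
    · rw [coeff_sub, coeff_C_mul, coeff_C_mul, coeff_X_mul, l1,
        coeff_eq_zero_of_natDegree_lt (p := p0) (by omega), mul_zero, sub_zero, jacobiLead]

open Polynomial in
lemma integral_polynomial_mul (hα : -1 < α) {f : ℝ → ℝ} (hf : ContinuousOn f (Icc (-1) 1))
    (p : ℝ[X]) {n : ℕ} (hn : p.natDegree ≤ n) :
    ∫ y in (-1 : ℝ)..1, p.eval y * f y * gegWeight α y
      = ∑ i ∈ Finset.range (n + 1), p.coeff i * gegMoment α f i := by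
  simp only [gegMoment, ← intervalIntegral.integral_const_mul]
  rw [← intervalIntegral.integral_finsetSum fun i _ =>
    (intervalIntegrable_gegMoment hα hf i).const_mul _]
  refine intervalIntegral.integral_congr fun x _ => ?_
  rw [eval_eq_sum_range' (Nat.lt_succ_of_le hn), Finset.sum_mul, Finset.sum_mul]
  exact Finset.sum_congr rfl fun i _ => by ring

lemma integral_jacobiP_mul (hα : -1 < α) (j k : ℕ) (hjk : j ≤ k) :
    ∫ y in (-1 : ℝ)..1, jacobiP α α j y * jacobiP α α k y * gegWeight α y
      = if j = k then gegH α k else 0 := by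
  obtain ⟨p, e, d, l⟩ := exists_polynomial_jacobiP hα j
  simp only [← e]
  rw [integral_polynomial_mul hα (continuous_jacobiP hα k).continuousOn p d,
    Finset.sum_range_succ, Finset.sum_eq_zero, zero_add]
  · split_ifs with h
    · have := (gegMoment_jacobiP hα k).1 0
      rw [mul_zero, add_zero] at this
      rw [h] at l ⊢
      rw [l, this, jacobiLead_mul hα]
    · rw [(gegMoment_jacobiP hα k).2 j fun l => by omega, mul_zero]
  · intro i hi
    rw [Finset.mem_range] at hi
    rw [(gegMoment_jacobiP hα k).2 i fun l => by omega, mul_zero]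

lemma continuous_gegP (hα : -1 < α) (k : ℕ) : Continuous (gegP α k) :=
  (continuous_jacobiP hα k).div_const _

lemma integral_gegP_mul (hα : -1 < α) (j k : ℕ) :
    ∫ y in (-1 : ℝ)..1, gegP α j y * gegP α k y * gegWeight α y = if j = k then 1 else 0 := by
  wlog hjk : j ≤ k generalizing j k
  · rw [← ite_cond_congr (propext (eq_comm : k = j ↔ j = k)), ← this k j (by omega)]
    exact intervalIntegral.integral_congr fun y _ => by ring
  have e : ∀ y, gegP α j y * gegP α k y * gegWeight α y = (√(gegH α j))⁻¹ * (√(gegH α k))⁻¹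
      * (jacobiP α α j y * jacobiP α α k y * gegWeight α y) := fun y => by
    simp only [gegP, div_eq_mul_inv]
    ring
  simp only [e]
  rw [intervalIntegral.integral_const_mul, integral_jacobiP_mul hα j k hjk]
  split_ifs with h
  · rw [h, ← mul_inv, Real.mul_self_sqrt (gegH_pos hα k).le, inv_mul_cancel₀ (gegH_pos hα k).ne']
  · rw [mul_zero]

/-- A continuous function whose Gegenbauer coefficients all vanish is zero: its moments vanish, hence
it is orthogonal to its own polynomial approximations. -/
lemma eq_zero_of_gegCoeff_eq_zero (hα : -1 < α) {f : ℝ → ℝ} (hf : ContinuousOn f (Icc (-1) 1))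
    (h : ∀ k, gegCoeff α f k = 0) : ∀ x ∈ Icc (-1 : ℝ) 1, f x = 0 := by
  have hJ : ∀ k, ∫ y in (-1 : ℝ)..1, jacobiP α α k y * f y * gegWeight α y = 0 := by
    intro k
    have h1 := h k
    have e : ∀ y, gegP α k y * f y * gegWeight α y
        = (√(gegH α k))⁻¹ * (jacobiP α α k y * f y * gegWeight α y) := fun y => by
      simp only [gegP, div_eq_mul_inv]
      ring
    simp only [gegCoeff, e] at h1
    rw [intervalIntegral.integral_const_mul] at h1
    exact (mul_eq_zero.1 h1).resolve_left (inv_ne_zero (Real.sqrt_pos.2 (gegH_pos hα k)).ne')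
  have hM : ∀ k, gegMoment α f k = 0 := by
    intro k
    induction k using Nat.strong_induction_on with
    | _ k ih =>
      obtain ⟨p, e, d, l⟩ := exists_polynomial_jacobiP hα k
      have h1 := hJ k
      simp only [← e] at h1
      rw [integral_polynomial_mul hα hf p d, Finset.sum_range_succ, Finset.sum_eq_zero, zero_add,
        l] at h1
      · exact (mul_eq_zero.1 h1).resolve_left (jacobiLead_ne_zero hα k)
      · intro i hi
        rw [ih i (Finset.mem_range.1 hi), mul_zero]
  have hin : EqOn f 0 (Ioo (-1) 1) := by
    intro x hx
    by_contra hne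
    have hpos := integral_sq_mul_gegWeight_pos hα le_rfl le_rfl hx hf hne
    set J := ∫ y in (-1 : ℝ)..1, f y * f y * gegWeight α y
    set A := ∫ y in (-1 : ℝ)..1, |f y| * gegWeight α y with hA
    have hA0 : 0 ≤ A := intervalIntegral.integral_nonneg (by norm_num) fun y hy =>
      mul_nonneg (abs_nonneg _) (gegWeight_nonneg α hy)
    obtain ⟨ε, hε⟩ : ∃ ε, ε = J / (A + 1) := ⟨_, rfl⟩
    obtain ⟨p, hp⟩ := exists_polynomial_near_of_continuousOn (-1) 1 f hf ε
      (by rw [hε]; positivity)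
    have hpI : ∫ y in (-1 : ℝ)..1, p.eval y * f y * gegWeight α y = 0 := by
      rw [integral_polynomial_mul hα hf p le_rfl]
      exact Finset.sum_eq_zero fun i _ => by rw [hM, mul_zero]
    have i1 := intervalIntegrable_mul_gegWeight (f := fun y => f y * f y) hα le_rfl
      (by norm_num) le_rfl (hf.mul hf)
    have i2 := intervalIntegrable_mul_gegWeight (f := fun y => p.eval y * f y) hα le_rfl
      (by norm_num) le_rfl (p.continuous.continuousOn.mul hf)
    have i3 := intervalIntegrable_mul_gegWeight (f := fun y => |f y|) hα le_rfl
      (by norm_num) le_rfl hf.abs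
    have hle : J ≤ ε * A := by
      rw [hA, ← intervalIntegral.integral_const_mul, ← sub_zero J, ← hpI,
        ← intervalIntegral.integral_sub i1 i2]
      refine intervalIntegral.integral_mono_on (by norm_num) (i1.sub i2) (i3.const_mul _)
        fun y hy => ?_
      have h1 : (f y - p.eval y) * f y ≤ ε * |f y| := by
        refine (le_abs_self _).trans ?_
        rw [abs_mul, abs_sub_comm]
        gcongr
        exact (hp y hy).le
      have := mul_le_mul_of_nonneg_right h1 (gegWeight_nonneg α hy)
      linarith
    rw [hε, div_mul_eq_mul_div, le_div_iff₀ (by positivity)] at hle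
    linarith
  exact hin.of_subset_closure hf continuousOn_const Ioo_subset_Icc_self
    (closure_Ioo (by norm_num)).ge

/-- The polynomials grow at most geometrically on `[-1, 1]`. -/
lemma exists_gegP_bound (hα : -1 < α) :
    ∃ C R : ℝ, 0 < C ∧ 1 ≤ R ∧ ∀ k, ∀ x ∈ Icc (-1 : ℝ) 1, |gegP α k x| ≤ C * R ^ k := by
  have hα1 : 0 < α + 1 := by linarith
  -- bounds for the coefficients of the recursion
  set D := (2 + |2 * α + 1| / (2 * (α + 1))) * (1 + |α|) with hD
  have hD1 : 1 ≤ D := by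
    have h1 : 0 ≤ |2 * α + 1| / (2 * (α + 1)) := by positivity
    have h2 := abs_nonneg α
    nlinarith
  have hA : ∀ k : ℕ, |(2 * (k : ℝ) + 2 * α + 3) * (k + α + 2) / ((k + 2) * (k + 2 * α + 2))| ≤ D := by
    intro k
    have hk : (0 : ℝ) ≤ k := by positivity
    have p1 : 0 < (k : ℝ) + 2 * α + 2 := by linarith
    have p2 : 0 < (k : ℝ) + 2 := by linarith
    have e1 : (2 * (k : ℝ) + 2 * α + 3) / (k + 2 * α + 2) ≤ 2 + |2 * α + 1| / (2 * (α + 1)) := by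
      have : (2 * (k : ℝ) + 2 * α + 3) / (k + 2 * α + 2) = 2 + -(2 * α + 1) / (k + 2 * α + 2) := by
        rw [show 2 * (k : ℝ) + 2 * α + 3 = 2 * (k + 2 * α + 2) + -(2 * α + 1) by ring, add_div,
          mul_div_assoc, div_self p1.ne', mul_one]
      rw [this]
      gcongr
      · exact neg_le_abs _
      · linarith
    have e2 : ((k : ℝ) + α + 2) / (k + 2) ≤ 1 + |α| := by
      rw [div_le_iff₀ p2]
      nlinarith [le_abs_self α, abs_nonneg α]
    rw [abs_of_nonneg (div_nonneg (mul_nonneg (by linarith) (by linarith)) (by positivity)), hD,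
      mul_comm ((k : ℝ) + 2), mul_div_mul_comm]
    refine mul_le_mul e1 e2 (div_nonneg (by linarith) p2.le) (by positivity)
  have hB : ∀ k : ℕ, |((k : ℝ) + α + 1) * (k + α + 2) / ((k + 2) * (k + 2 * α + 2))| ≤ D := by
    intro k
    have hk : (0 : ℝ) ≤ k := by positivity
    refine le_trans ?_ (hA k)
    rw [abs_of_nonneg (div_nonneg (mul_nonneg (by linarith) (by linarith))
      (mul_nonneg (by linarith) (by linarith))), abs_of_nonneg (div_nonneg (mul_nonneg (by linarith)
      (by linarith)) (mul_nonneg (by linarith) (by linarith)))]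
    have p1 : 0 < (k : ℝ) + 2 * α + 2 := by linarith
    have p2 : 0 < (k : ℝ) + α + 2 := by linarith
    gcongr ?_ / _
    exact mul_le_mul_of_nonneg_right (by linarith) p2.le
  set R := D + 1 + |α + 1| with hR
  have hR1 : 1 ≤ R := by linarith [abs_nonneg (α + 1)]
  have hP : ∀ k, ∀ x ∈ Icc (-1 : ℝ) 1, |jacobiP α α k x| ≤ R ^ k := by
    intro k x hx
    have hx1 : |x| ≤ 1 := abs_le.2 hx
    induction k using Nat.twoStepInduction with
    | zero => simp [jacobiP]
    | one =>
      rw [jacobiP_one_apply, abs_mul, pow_one]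
      have := mul_le_mul_of_nonneg_left hx1 (abs_nonneg (α + 1))
      linarith
    | more k h0 h1 =>
      rw [jacobiP_add_two hα]
      refine (abs_sub _ _).trans ?_
      rw [abs_mul, abs_mul _ (jacobiP α α k x), abs_mul x]
      have hR0 : 0 ≤ R ^ k := by positivity
      calc _ ≤ D * (1 * R ^ (k + 1)) + D * R ^ k := by
            gcongr
            · exact hA k
            · exact hB k
        _ = (D * R + D) * R ^ k := by ring
        _ ≤ (R * R) * R ^ k := by
            gcongr
            nlinarith [abs_nonneg (α + 1)]
        _ = R ^ (k + 2) := by ring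
  -- the normalization constants decay at most geometrically
  have hH : ∀ k, gegH α (k + 1) ≥ gegH α 1 * (1 / 3) ^ k := by
    intro k
    induction k with
    | zero => simp
    | succ k ih =>
      have hk : (0 : ℝ) ≤ k := by positivity
      have p1 : 0 < (k : ℝ) + 2 * α + 2 := by linarith
      have p2 : 0 < 2 * (k : ℝ) + 2 * α + 5 := by linarith
      have p3 : 0 < 2 * (k : ℝ) + 2 * α + 3 := by linarith
      have hq : 1 / 3 ≤ ((k : ℝ) + α + 2) ^ 2 * (2 * k + 2 * α + 3)
          / ((k + 2) * (2 * k + 2 * α + 5) * (k + 2 * α + 2)) := by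
        rw [div_le_div_iff₀ (by norm_num) (by positivity)]
        have q1 : ((k : ℝ) + 2) * (k + 2 * α + 2) ≤ (k + α + 2) ^ 2 := by nlinarith [sq_nonneg α]
        have q2 : 2 * (k : ℝ) + 2 * α + 5 ≤ 3 * (2 * k + 2 * α + 3) := by linarith
        have := mul_le_mul q1 q2 p2.le (by positivity)
        linarith
      have := mul_le_mul ih hq (by norm_num) (gegH_pos hα (k + 1)).le
      rw [show k + 1 + 1 = k + 2 from rfl, gegH_add_two hα]
      calc _ ≥ gegH α 1 * (1 / 3) ^ k * (1 / 3) := this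
        _ = _ := by ring
  set κ := min (gegH α 0) (gegH α 1) with hκ
  have hκ0 : 0 < κ := lt_min (gegH_pos hα 0) (gegH_pos hα 1)
  have hH' : ∀ k, κ * (1 / 2) ^ (2 * k) ≤ gegH α k := by
    intro k
    rcases k with _ | k
    · simp [hκ]
    · refine le_trans ?_ (hH k)
      rw [pow_mul]
      have h1 : ((1 / 2 : ℝ) ^ 2) ^ (k + 1) ≤ (1 / 3) ^ k := by
        rw [pow_succ]
        have : ((1 / 2 : ℝ) ^ 2) ^ k ≤ (1 / 3) ^ k := by gcongr; norm_num
        have h0 : (0 : ℝ) ≤ (1 / 3) ^ k := by positivity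
        nlinarith
      have h2 : κ ≤ gegH α 1 := min_le_right _ _
      have h3 := gegH_pos hα 1
      gcongr
  refine ⟨(√κ)⁻¹, 2 * R, by positivity, by linarith, fun k x hx => ?_⟩
  have hs : √κ * (1 / 2) ^ k ≤ √(gegH α k) := by
    refine Real.le_sqrt_of_sq_le ?_
    rw [mul_pow, Real.sq_sqrt hκ0.le, ← pow_mul, mul_comm k 2]
    exact hH' k
  rw [gegP, abs_div, abs_of_nonneg (Real.sqrt_nonneg _)]
  calc _ ≤ R ^ k / (√κ * (1 / 2) ^ k) := by
        gcongr
        exact hP k x hx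
    _ = (√κ)⁻¹ * (2 * R) ^ k := by
        rw [mul_pow, one_div, inv_pow]
        field_simp

lemma jacobiP_apply_one (hα : -1 < α) (k : ℕ) : jacobiP α α k 1
    = Real.Gamma (k + α + 1) / (k.factorial * Real.Gamma (α + 1)) := by
  have hG0 : Real.Gamma (α + 1) ≠ 0 := (Real.Gamma_pos_of_pos (by linarith)).ne'
  induction k using Nat.twoStepInduction with
  | zero => simp [jacobiP, hG0]
  | one =>
    rw [jacobiP_one_apply, Nat.cast_one, show 1 + α + 1 = (α + 1) + 1 by ring,
      Real.Gamma_add_one (by linarith)]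
    simp [hG0]
  | more k h0 h1 =>
    have hk : (0 : ℝ) ≤ k := by positivity
    rw [jacobiP_add_two hα, h0, h1]
    have hG1 : Real.Gamma (k + 1 + α + 1) = (k + α + 1) * Real.Gamma (k + α + 1) := by
      rw [← Real.Gamma_add_one (by linarith : (k : ℝ) + α + 1 ≠ 0)]
      ring_nf
    have hG2 : Real.Gamma (k + 2 + α + 1)
        = (k + α + 2) * ((k + α + 1) * Real.Gamma (k + α + 1)) := by
      rw [← Real.Gamma_add_one (by linarith : (k : ℝ) + α + 1 ≠ 0),
        show (k : ℝ) + α + 1 + 1 = k + α + 2 by ring,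
        ← Real.Gamma_add_one (by linarith : (k : ℝ) + α + 2 ≠ 0)]
      ring_nf
    simp only [Nat.factorial_succ]
    push_cast
    rw [hG1, hG2]
    obtain ⟨d, hd⟩ : ∃ d, d = (k : ℝ) + 2 * α + 2 := ⟨_, rfl⟩
    have hd0 : d ≠ 0 := by rw [hd]; linarith
    rw [← hd]
    field_simp
    rw [hd]
    ring

end

/-! ### The expansion of an eigenfunction in Gegenbauer polynomials -/

/-- The remainder of the exponential series after `k` terms is smaller than `L^{-k}` for every
`L ≥ 1`, up to a constant. -/
lemma norm_exp_sub_sum_le {c L : ℝ} (hL : 1 ≤ L) {x : ℂ} (hx : ‖x‖ ≤ c) (k : ℕ) :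
    ‖Complex.exp x - ∑ m ∈ Finset.range k, x ^ m / m.factorial‖ ≤ Real.exp (c * L) / L ^ k := by
  refine (Complex.norm_exp_sub_sum_le_exp_norm_sub_sum x k).trans ?_
  set t := ‖x‖
  have ht : 0 ≤ t := norm_nonneg x
  have hs : ∀ u : ℝ, HasSum (fun m : ℕ => u ^ m / m.factorial) (Real.exp u) := fun u => by
    rw [Real.exp_eq_exp_ℝ]
    exact NormedSpace.expSeries_div_hasSum_exp u
  have h1 := ((hasSum_nat_add_iff' k).2 (hs t)).mul_left (L ^ k)
  have h2 := (hasSum_nat_add_iff' k).2 (hs (t * L))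
  have hle := hasSum_le (fun m => ?_) h1 h2
  · rw [le_div_iff₀ (by positivity), mul_comm]
    refine hle.trans ((sub_le_self _ (Finset.sum_nonneg fun i _ => by positivity)).trans ?_)
    gcongr
  · have hLm : (1 : ℝ) ≤ L ^ m := one_le_pow₀ hL
    rw [mul_pow, pow_add L, mul_div_assoc', mul_comm (L ^ k)]
    gcongr
    exact le_mul_of_one_le_left (by positivity) hLm

/-- Integration term by term of a normally convergent series against the weight. -/
lemma hasSum_integral_gegWeight_smul {E : Type*} [NormedAddCommGroup E] [NormedSpace ℝ E] {α : ℝ}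
    (hα : -1 < α) {F : ℕ → ℝ → E} {S : ℝ → E} {u : ℕ → ℝ}
    (hF : ∀ k, ContinuousOn (F k) (Icc (-1) 1)) (hu : Summable u)
    (hb : ∀ k, ∀ y ∈ Icc (-1 : ℝ) 1, ‖F k y‖ ≤ u k)
    (hS : ∀ y ∈ Icc (-1 : ℝ) 1, HasSum (fun k => F k y) (S y)) :
    HasSum (fun k => ∫ y in (-1 : ℝ)..1, gegWeight α y • F k y)
      (∫ y in (-1 : ℝ)..1, gegWeight α y • S y) := by
  have hm : ∀ {y : ℝ}, y ∈ uIoc (-1 : ℝ) 1 → y ∈ Icc (-1 : ℝ) 1 := fun {y} hy => by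
    rw [uIoc_of_le (by norm_num)] at hy
    exact Ioc_subset_Icc_self hy
  refine intervalIntegral.hasSum_integral_of_dominated_convergence
    (fun k y => gegWeight α y * u k) (fun k => ?_) (fun k => ?_) ?_ ?_ ?_
  · exact (intervalIntegrable_gegWeight_smul hα le_rfl (by norm_num) le_rfl
      (hF k)).def'.aestronglyMeasurable
  · refine Eventually.of_forall fun y hy => ?_
    rw [norm_smul, Real.norm_eq_abs, abs_of_nonneg (gegWeight_nonneg α (hm hy))]
    exact mul_le_mul_of_nonneg_left (hb k y (hm hy)) (gegWeight_nonneg α (hm hy))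
  · exact Eventually.of_forall fun y _ => hu.mul_left _
  · simp only [tsum_mul_left]
    exact (intervalIntegrable_gegWeight hα).mul_const _
  · exact Eventually.of_forall fun y hy => (hS y (hm hy)).const_smul _

section

variable {α c : ℝ} {ψ : ℝ → ℝ}

lemma integral_gegP_mul_pow (hα : -1 < α) {m k : ℕ} (hmk : m < k) :
    ∫ y in (-1 : ℝ)..1, gegP α k y * y ^ m * gegWeight α y = 0 := by
  have h := (gegMoment_jacobiP hα k).2 m fun l => by omega
  rw [← mul_zero (√(gegH α k))⁻¹, ← h, gegMoment, ← intervalIntegral.integral_const_mul]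
  refine intervalIntegral.integral_congr fun y _ => ?_
  simp only [gegP, div_eq_mul_inv]
  ring

/-- The coefficients of a function in the image of the finite Fourier transform decay faster than
every geometric sequence: the transform is approximated by its Taylor polynomials, to which the
orthogonal polynomials of higher degree are blind. -/
lemma exists_gegCoeff_bound (hα : -1 < α) {w : ℝ → ℂ} (hw : IntervalIntegrable w volume (-1) 1)
    {μ : ℂ} (hμ : μ ≠ 0) (hψ : ContinuousOn ψ (Icc (-1) 1))
    (hG : ∀ x ∈ Icc (-1 : ℝ) 1, fourierInt c w x = μ * ψ x) {ρ : ℝ} (hρ : 0 < ρ) :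
    ∃ K, 0 ≤ K ∧ ∀ k, |gegCoeff α ψ k| ≤ K * ρ ^ k := by
  obtain ⟨C, R, hC, hR, hP⟩ := exists_gegP_bound hα
  set L := max 1 (R / ρ) with hL
  have hL1 : 1 ≤ L := le_max_left _ _
  have hRL : R / L ≤ ρ := by
    rw [div_le_iff₀ (by positivity), mul_comm, ← div_le_iff₀ hρ]
    exact le_max_right _ _
  set W := ∫ t in (-1 : ℝ)..1, ‖w t‖ with hW
  have hW0 : 0 ≤ W := intervalIntegral.integral_nonneg (by norm_num) fun t _ => norm_nonneg _
  set ex := Real.exp (|c| * L)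
  have hH := gegH_pos hα 0
  -- the Taylor polynomials of the transform
  set N : ℕ → ℂ := fun m => ∫ t in (-1 : ℝ)..1, (t : ℂ) ^ m * w t with hN
  set T : ℕ → ℝ → ℂ := fun k y =>
    ∑ m ∈ Finset.range k, ((Complex.I * c) ^ m / m.factorial * N m) * (y : ℂ) ^ m with hT
  have hpw : ∀ m : ℕ, IntervalIntegrable (fun t : ℝ => (t : ℂ) ^ m * w t) volume (-1) 1 :=
    fun m => hw.continuousOn_mul (by fun_prop)
  have hTaylor : ∀ k, ∀ y ∈ Icc (-1 : ℝ) 1, ‖fourierInt c w y - T k y‖ ≤ ex / L ^ k * W := by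
    intro k y hy
    have e : T k y = ∫ t in (-1 : ℝ)..1,
        (∑ m ∈ Finset.range k, (Complex.I * c * y * t) ^ m / m.factorial) * w t := by
      simp only [hT, hN, Finset.sum_mul]
      rw [intervalIntegral.integral_finsetSum fun m _ => ?_]
      · refine Finset.sum_congr rfl fun m _ => ?_
        rw [mul_right_comm, ← intervalIntegral.integral_const_mul]
        refine intervalIntegral.integral_congr fun t _ => ?_
        rw [mul_pow _ (t : ℂ), mul_pow _ (y : ℂ)]
        ring
      · exact hw.continuousOn_mul (by fun_prop)
    rw [e, fourierInt, ← intervalIntegral.integral_sub (intervalIntegrable_exp_mul hw _)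
      (hw.continuousOn_mul (by fun_prop)), hW, ← intervalIntegral.integral_const_mul]
    refine intervalIntegral.norm_integral_le_of_norm_le (by norm_num) ?_ (hw.norm.const_mul _)
    refine Eventually.of_forall fun t ht => ?_
    rw [← sub_mul, norm_mul]
    gcongr
    refine norm_exp_sub_sum_le hL1 ?_ k
    rw [norm_mul, norm_mul, norm_mul, Complex.norm_I, one_mul, Complex.norm_real, Complex.norm_real,
      Complex.norm_real, Real.norm_eq_abs, Real.norm_eq_abs, Real.norm_eq_abs, mul_assoc]
    have h1 : |y| * |t| ≤ 1 := mul_le_one₀ (abs_le.2 hy) (abs_nonneg t) (abs_le.2 ⟨ht.1.le, ht.2⟩)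
    exact mul_le_of_le_one_right (abs_nonneg c) h1
  have hTc : ∀ k, Continuous (T k) := fun k => by fun_prop
  have hTorth : ∀ k, ∫ y in (-1 : ℝ)..1, gegWeight α y • (gegP α k y • T k y) = 0 := by
    intro k
    simp only [hT, Finset.smul_sum]
    rw [intervalIntegral.integral_finsetSum fun m _ => ?_]
    · refine Finset.sum_eq_zero fun m hm => ?_
      generalize (Complex.I * c) ^ m / m.factorial * N m = a
      have h0 := congrArg (fun r : ℝ => a * (r : ℂ))
        (integral_gegP_mul_pow hα (Finset.mem_range.1 hm))
      simp only [Complex.ofReal_zero, mul_zero] at h0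
      rw [← h0, ← intervalIntegral.integral_ofReal, ← intervalIntegral.integral_const_mul]
      refine intervalIntegral.integral_congr fun y _ => ?_
      simp only [Complex.real_smul]
      push_cast
      ring
    · refine intervalIntegrable_gegWeight_smul hα le_rfl (by norm_num) le_rfl ?_
      have := continuous_gegP hα k
      fun_prop
  have hψC : ContinuousOn (fun y => (ψ y : ℂ)) (Icc (-1) 1) :=
    Complex.continuous_ofReal.comp_continuousOn hψ
  refine ⟨C * ex * W * gegH α 0 / ‖μ‖, by positivity, fun k => ?_⟩
  have hPk := continuous_gegP hα k
  have hcoeff : μ * gegCoeff α ψ k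
      = ∫ y in (-1 : ℝ)..1, gegWeight α y • (gegP α k y • (μ * ψ y - T k y)) := by
    have i1 : IntervalIntegrable (fun y => gegWeight α y • (gegP α k y • (μ * ψ y))) volume (-1) 1 :=
      intervalIntegrable_gegWeight_smul hα le_rfl (by norm_num) le_rfl (by fun_prop)
    have i2 : IntervalIntegrable (fun y => gegWeight α y • (gegP α k y • T k y)) volume (-1) 1 :=
      intervalIntegrable_gegWeight_smul hα le_rfl (by norm_num) le_rfl (by
        have := hTc k
        fun_prop)
    simp only [smul_sub]
    rw [intervalIntegral.integral_sub i1 i2, hTorth, sub_zero, gegCoeff,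
      ← intervalIntegral.integral_ofReal, ← intervalIntegral.integral_const_mul]
    refine intervalIntegral.integral_congr fun y _ => ?_
    simp only [Complex.real_smul]
    push_cast
    ring
  have hnorm : ‖μ‖ * |gegCoeff α ψ k| ≤ C * R ^ k * (ex / L ^ k * W) * gegH α 0 := by
    rw [← Real.norm_eq_abs, ← Complex.norm_real, ← norm_mul, hcoeff, ← integral_gegWeight hα,
      ← intervalIntegral.integral_const_mul]
    refine intervalIntegral.norm_integral_le_of_norm_le (by norm_num) ?_
      ((intervalIntegrable_gegWeight hα).const_mul _)
    refine Eventually.of_forall fun y hy => ?_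
    have hy' := Ioc_subset_Icc_self hy
    rw [norm_smul, norm_smul, Real.norm_eq_abs, Real.norm_eq_abs,
      abs_of_nonneg (gegWeight_nonneg α hy'), mul_comm, ← hG y hy']
    exact mul_le_mul_of_nonneg_right (mul_le_mul (hP k y hy') (hTaylor k y hy') (norm_nonneg _)
      (by positivity)) (gegWeight_nonneg α hy')
  have hμ0 : 0 < ‖μ‖ := norm_pos_iff.2 hμ
  rw [div_mul_eq_mul_div, le_div_iff₀ hμ0, mul_comm]
  refine hnorm.trans ?_
  calc _ = C * ex * W * gegH α 0 * (R / L) ^ k := by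
        rw [div_pow]
        ring
    _ ≤ _ := by gcongr

/-- The Gegenbauer expansion converges, uniformly and absolutely, to the function. -/
lemma hasSum_gegCoeff_mul_gegP (hα : -1 < α) (hψ : ContinuousOn ψ (Icc (-1) 1))
    (hβ : ∀ ρ : ℝ, 0 < ρ → ∃ K, 0 ≤ K ∧ ∀ k, |gegCoeff α ψ k| ≤ K * ρ ^ k) :
    (∃ u : ℕ → ℝ, Summable u ∧
      ∀ k, ∀ x ∈ Icc (-1 : ℝ) 1, |gegCoeff α ψ k * gegP α k x| ≤ u k) ∧
    ∀ x ∈ Icc (-1 : ℝ) 1, HasSum (fun k => gegCoeff α ψ k * gegP α k x) (ψ x) := by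
  obtain ⟨C, R, hC, hR, hP⟩ := exists_gegP_bound hα
  obtain ⟨K, hK, hb⟩ := hβ (1 / (2 * R)) (by positivity)
  have hub : ∀ k, ∀ x ∈ Icc (-1 : ℝ) 1,
      |gegCoeff α ψ k * gegP α k x| ≤ K * C * (1 / 2 : ℝ) ^ k := by
    intro k x hx
    rw [abs_mul]
    calc _ ≤ (K * (1 / (2 * R)) ^ k) * (C * R ^ k) :=
          mul_le_mul (hb k) (hP k x hx) (abs_nonneg _) (by positivity)
      _ = K * C * ((1 / (2 * R)) * R) ^ k := by rw [mul_pow]; ring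
      _ = _ := by
        congr 2
        field_simp
  have hu : Summable fun k : ℕ => K * C * (1 / 2 : ℝ) ^ k :=
    (summable_geometric_of_lt_one (by norm_num) (by norm_num)).mul_left _
  refine ⟨⟨_, hu, hub⟩, ?_⟩
  set s : ℝ → ℝ := fun x => ∑' k, gegCoeff α ψ k * gegP α k x with hs
  have hF : ∀ k, Continuous fun x => gegCoeff α ψ k * gegP α k x :=
    fun k => continuous_const.mul (continuous_gegP hα k)
  have hsum : ∀ x ∈ Icc (-1 : ℝ) 1, HasSum (fun k => gegCoeff α ψ k * gegP α k x) (s x) :=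
    fun x hx => (Summable.of_norm_bounded hu fun k => hub k x hx).hasSum
  have hsc : ContinuousOn s (Icc (-1) 1) :=
    continuousOn_tsum (fun k => (hF k).continuousOn) hu fun k x hx => hub k x hx
  have hcoeff : ∀ j, gegCoeff α s j = gegCoeff α ψ j := by
    intro j
    have h := hasSum_integral_gegWeight_smul hα
      (F := fun k x => gegP α j x * (gegCoeff α ψ k * gegP α k x)) (S := fun x => gegP α j x * s x)
      (u := fun k => (C * R ^ j) * (K * C * (1 / 2 : ℝ) ^ k))
      (fun k => ((continuous_gegP hα j).mul (hF k)).continuousOn) (hu.mul_left _)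
      (fun k y hy => by
        rw [norm_mul]
        exact mul_le_mul (hP j y hy) (hub k y hy) (abs_nonneg _) (by positivity))
      fun y hy => (hsum y hy).mul_left _
    have e1 : ∀ k, ∫ y in (-1 : ℝ)..1, gegWeight α y •
        (gegP α j y * (gegCoeff α ψ k * gegP α k y)) = if k = j then gegCoeff α ψ k else 0 := by
      intro k
      have h1 := integral_gegP_mul hα k j
      rw [← mul_one (gegCoeff α ψ k), ← mul_zero (gegCoeff α ψ k), ← mul_ite, ← h1,
        ← intervalIntegral.integral_const_mul]
      refine intervalIntegral.integral_congr fun y _ => ?_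
      simp only [smul_eq_mul, mul_one]
      ring
    simp only [e1] at h
    have h2 := h.unique (hasSum_ite_eq j (gegCoeff α ψ j) |>.congr_fun fun k => by
      split_ifs with hk
      · rw [hk]
      · rfl)
    rw [← h2, gegCoeff]
    refine intervalIntegral.integral_congr fun y _ => ?_
    simp only [smul_eq_mul]
    ring
  have hzero := eq_zero_of_gegCoeff_eq_zero hα (f := fun x => s x - ψ x) (hsc.sub hψ) fun k => by
    have i1 := intervalIntegrable_mul_gegWeight (f := fun y => gegP α k y * s y) hα le_rfl
      (by norm_num) le_rfl ((continuous_gegP hα k).continuousOn.mul hsc)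
    have i2 := intervalIntegrable_mul_gegWeight (f := fun y => gegP α k y * ψ y) hα le_rfl
      (by norm_num) le_rfl ((continuous_gegP hα k).continuousOn.mul hψ)
    rw [← sub_eq_zero.2 (hcoeff k)]
    simp only [gegCoeff]
    rw [← intervalIntegral.integral_sub i1 i2]
    refine intervalIntegral.integral_congr fun y _ => ?_
    ring
  intro x hx
  have := hzero x hx
  rw [← sub_eq_zero.1 this]
  exact hsum x hx

end

/-! ### Bessel functions -/

section

variable {α c : ℝ} {f : ℝ → ℝ}

lemma fourierInt_eq_integral_smul (α c : ℝ) (f : ℝ → ℝ) (z : ℂ) :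
    fourierInt c (fun y => f y * gegWeight α y) z
      = ∫ y in (-1 : ℝ)..1, gegWeight α y • (Complex.exp (Complex.I * c * z * y) * f y) := by
  refine intervalIntegral.integral_congr fun y _ => ?_
  simp only [Complex.real_smul]
  ring

/-- The power series of the transform; its coefficients are the moments. -/
lemma hasSum_fourierInt (hα : -1 < α) (hf : ContinuousOn f (Icc (-1) 1)) (c : ℝ) (z : ℂ) :
    HasSum (fun j : ℕ => (Complex.I * c * z) ^ j / j.factorial * gegMoment α f j)
      (fourierInt c (fun y => f y * gegWeight α y) z) := by
  obtain ⟨M, hM⟩ := isCompact_Icc.exists_bound_of_continuousOn hf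
  have hfC : ContinuousOn (fun y => (f y : ℂ)) (Icc (-1) 1) :=
    Complex.continuous_ofReal.comp_continuousOn hf
  have h := hasSum_integral_gegWeight_smul hα
    (F := fun j y => (Complex.I * c * z * y) ^ j / j.factorial * f y)
    (S := fun y => Complex.exp (Complex.I * c * z * y) * f y)
    (u := fun j => ‖Complex.I * c * z‖ ^ j / j.factorial * M)
    (fun j => by fun_prop) ((Real.summable_pow_div_factorial _).mul_right _)
    (fun j y hy => by
      rw [norm_mul, norm_div, norm_pow, norm_mul _ (y : ℂ), Complex.norm_natCast,
        Complex.norm_real, Complex.norm_real]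
      gcongr
      · exact mul_le_of_le_one_right (norm_nonneg _) (abs_le.2 hy)
      · exact hM y hy)
    (fun y _ => by
      have := NormedSpace.expSeries_div_hasSum_exp (Complex.I * c * z * y)
      rw [← Complex.exp_eq_exp_ℂ] at this
      exact this.mul_right _)
  rw [fourierInt_eq_integral_smul]
  convert! h using 1
  · funext j
    rw [gegMoment, ← intervalIntegral.integral_ofReal, ← intervalIntegral.integral_const_mul]
    refine intervalIntegral.integral_congr fun y _ => ?_
    simp only [Complex.real_smul, mul_pow _ (y : ℂ)]
    push_cast
    ring

/-- The transform of a Jacobi polynomial is a Bessel function, up to a power. -/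
lemma fourierInt_jacobiP (hα : -1 < α) (k : ℕ) (c : ℝ) (z : ℂ) :
    fourierInt c (fun y => jacobiP α α k y * gegWeight α y) z
      = Complex.I ^ k * ((√Real.pi * Real.Gamma (k + α + 1) / k.factorial : ℝ) : ℂ) *
        ((c * z / 2) ^ k * ∑' m : ℕ, (-1) ^ m /
          ((m.factorial : ℂ) * Complex.Gamma (m + (k + (α + 1 / 2)) + 1)) * (c * z / 2) ^ (2 * m)) := by
  obtain ⟨h1, h2⟩ := gegMoment_jacobiP hα k
  have h := hasSum_fourierInt hα (continuous_jacobiP hα k).continuousOn c z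
  have hinj : Function.Injective fun l : ℕ => k + 2 * l := fun a b hab => by
    simp only at hab
    omega
  rw [← hinj.hasSum_iff fun j hj => by
    rw [h2 j fun l hl => hj ⟨l, hl.symm⟩, Complex.ofReal_zero, mul_zero]] at h
  rw [← h.tsum_eq, ← mul_assoc, ← tsum_mul_left]
  refine tsum_congr fun l => ?_
  have hG : Complex.Gamma (l + (k + (α + 1 / 2)) + 1)
      = ((Real.Gamma (k + l + α + 3 / 2) : ℝ) : ℂ) := by
    rw [← Complex.Gamma_ofReal]
    push_cast
    ring_nf
  simp only [Function.comp_apply]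
  rw [h1, jacobiMoment, hG]
  have hf : ((k + 2 * l).factorial : ℂ) ≠ 0 := Nat.cast_ne_zero.2 (Nat.factorial_ne_zero _)
  have h20 : (2 : ℂ) ^ k ≠ 0 := pow_ne_zero _ two_ne_zero
  have h40 : (4 : ℂ) ^ l ≠ 0 := pow_ne_zero _ (by norm_num)
  have hI : (Complex.I * c * z) ^ (k + 2 * l)
      = Complex.I ^ k * (-1) ^ l * (c * z / 2) ^ (k + 2 * l) * (2 ^ k * 4 ^ l) := by
    rw [mul_assoc, mul_pow, pow_add Complex.I, pow_mul Complex.I, Complex.I_sq, div_pow,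
      pow_add (2 : ℂ), pow_mul (2 : ℂ)]
    norm_num
    field_simp
  rw [hI]
  push_cast
  rw [pow_add (_ / _ : ℂ)]
  field_simp

/-- Dividing the order-`k + a` Bessel function by the power of order `a` cancels the
branch of the power, so that an entire function is left. -/
lemma besselJ_div_cpow (k : ℕ) (a z : ℂ) (hz : z ≠ 0) :
    besselJ (k + a) z / z ^ a = ((2 : ℂ) ^ a)⁻¹ *
      ((z / 2) ^ k * ∑' m : ℕ, (-1) ^ m /
        ((m.factorial : ℂ) * Complex.Gamma (m + (k + a) + 1)) * (z / 2) ^ (2 * m)) := by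
  have h2 : z / 2 ≠ 0 := div_ne_zero hz two_ne_zero
  -- the principal powers are multiplicative here because the factor `2` is positive
  have hz' : z ^ a = (z / 2) ^ a * 2 ^ a := by
    have e : z = ((2 : ℝ) : ℂ) * (z / 2) := by
      push_cast
      field_simp
    have hl : Complex.log z = Real.log 2 + Complex.log (z / 2) := by
      conv_lhs => rw [e]
      exact Complex.log_ofReal_mul two_pos h2
    rw [Complex.cpow_def_of_ne_zero hz, Complex.cpow_def_of_ne_zero h2,
      Complex.cpow_def_of_ne_zero two_ne_zero, ← Complex.exp_add, hl, Complex.ofReal_log two_pos.le]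
    push_cast
    ring_nf
  have h3 : (z / 2) ^ a ≠ 0 := by simp [Complex.cpow_eq_zero_iff, h2]
  have h4 : (2 : ℂ) ^ a ≠ 0 := by simp [Complex.cpow_eq_zero_iff]
  rw [besselJ, Complex.cpow_add _ _ h2, Complex.cpow_natCast, hz']
  field_simp


lemma fourierInt_gegP (α c : ℝ) (k : ℕ) (z : ℂ) :
    fourierInt c (fun y => gegP α k y * gegWeight α y) z = ((√(gegH α k))⁻¹ : ℝ) *
      fourierInt c (fun y => jacobiP α α k y * gegWeight α y) z := by
  simp only [fourierInt]
  rw [← intervalIntegral.integral_const_mul]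
  refine intervalIntegral.integral_congr fun y _ => ?_
  simp only [gegP, div_eq_mul_inv]
  push_cast
  ring

/-- The terms of the series of Bessel functions are, up to a common factor, the transforms of the
terms of the Gegenbauer expansion. -/
lemma gegSeriesCoeff_mul_besselJ_div (hα : -1 < α) (n k : ℕ) (ψ : ℝ → ℝ) {z : ℂ}
    (hz : c * z ≠ 0) :
    gegSeriesCoeff α n ψ k *
        (besselJ (k + α + 1 / 2) (c * z) / ((c : ℂ) * z) ^ ((α : ℂ) + 1 / 2))
      = (Complex.I ^ n * ((√Real.pi * 2 ^ (α + 1 / 2) : ℝ) : ℂ))⁻¹ *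
        (gegCoeff α ψ k * fourierInt c (fun y => gegP α k y * gegWeight α y) z) := by
  have h2 : (2 : ℂ) ^ ((α : ℂ) + 1 / 2) = ((2 ^ (α + 1 / 2) : ℝ) : ℂ) := by
    rw [Complex.ofReal_cpow two_pos.le]
    push_cast
    rfl
  have h2' : ((2 ^ (α + 1 / 2) : ℝ) : ℂ) ≠ 0 :=
    Complex.ofReal_ne_zero.2 (Real.rpow_pos_of_pos two_pos _).ne'
  have hπ : ((√Real.pi : ℝ) : ℂ) ≠ 0 := Complex.ofReal_ne_zero.2 (Real.sqrt_pos.2 Real.pi_pos).ne'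
  have hH : ((√(gegH α k) : ℝ) : ℂ) ≠ 0 :=
    Complex.ofReal_ne_zero.2 (Real.sqrt_pos.2 (gegH_pos hα k)).ne'
  rw [add_assoc (k : ℂ), besselJ_div_cpow _ _ _ hz, h2, fourierInt_gegP, fourierInt_jacobiP hα,
    gegSeriesCoeff, zpow_sub₀ Complex.I_ne_zero, zpow_natCast, zpow_natCast]
  have hI := Complex.I_ne_zero
  push_cast at h2' ⊢
  field_simp

end

section

variable {α c : ℝ} {ψ : ℝ → ℝ}

/-- The transform of the Gegenbauer expansion, term by term, at any point of the plane. -/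
lemma hasSum_gegCoeff_mul_fourierInt (hα : -1 < α) (hψ : ContinuousOn ψ (Icc (-1) 1))
    (hβ : ∀ ρ : ℝ, 0 < ρ → ∃ K, 0 ≤ K ∧ ∀ k, |gegCoeff α ψ k| ≤ K * ρ ^ k) (c : ℝ) (z : ℂ) :
    HasSum (fun k => gegCoeff α ψ k * fourierInt c (fun y => gegP α k y * gegWeight α y) z)
      (fourierInt c (fun y => ψ y * gegWeight α y) z) := by
  obtain ⟨⟨u, hu, hub⟩, hs⟩ := hasSum_gegCoeff_mul_gegP hα hψ hβ
  have h := hasSum_integral_gegWeight_smul hα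
    (F := fun k y => Complex.exp (Complex.I * c * z * y) *
      ((gegCoeff α ψ k * gegP α k y : ℝ) : ℂ))
    (S := fun y => Complex.exp (Complex.I * c * z * y) * ψ y)
    (u := fun k => Real.exp (|c| * ‖z‖) * u k)
    (fun k => by
      have := continuous_gegP hα k
      fun_prop) (hu.mul_left _)
    (fun k y hy => by
      rw [norm_mul, Complex.norm_real]
      exact mul_le_mul (norm_exp_le_of_abs_le_one (abs_le.2 hy) z) (hub k y hy) (norm_nonneg _)
        (Real.exp_pos _).le)
    (fun y hy => (Complex.hasSum_ofReal.2 (hs y hy)).mul_left _)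
  rw [fourierInt_eq_integral_smul]
  convert! h using 1
  funext k
  rw [fourierInt_eq_integral_smul, ← intervalIntegral.integral_const_mul]
  refine intervalIntegral.integral_congr fun y _ => ?_
  simp only [Complex.real_smul]
  push_cast
  ring

lemma exists_norm_fourierInt_gegP_le (hα : -1 < α) (c : ℝ) (z : ℂ) :
    ∃ C R : ℝ, 0 < C ∧ 1 ≤ R ∧
      ∀ k, ‖fourierInt c (fun y => gegP α k y * gegWeight α y) z‖ ≤ C * R ^ k := by
  obtain ⟨C, R, hC, hR, hP⟩ := exists_gegP_bound hα
  have hH := gegH_pos hα 0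
  refine ⟨Real.exp (|c| * ‖z‖) * C * gegH α 0, R, by positivity, hR, fun k => ?_⟩
  rw [fourierInt_eq_integral_smul, show Real.exp (|c| * ‖z‖) * C * gegH α 0 * R ^ k
    = Real.exp (|c| * ‖z‖) * (C * R ^ k) * gegH α 0 by ring, ← integral_gegWeight hα,
    ← intervalIntegral.integral_const_mul]
  refine intervalIntegral.norm_integral_le_of_norm_le (by norm_num) ?_
    ((intervalIntegrable_gegWeight hα).const_mul _)
  refine Eventually.of_forall fun y hy => ?_
  have hy' := Ioc_subset_Icc_self hy
  rw [norm_smul, Real.norm_eq_abs, abs_of_nonneg (gegWeight_nonneg α hy'), mul_comm, norm_mul,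
    Complex.norm_real]
  exact mul_le_mul_of_nonneg_right (mul_le_mul (norm_exp_le_of_abs_le_one (abs_le.2 hy') z)
    (hP k y hy') (norm_nonneg _) (Real.exp_pos _).le) (gegWeight_nonneg α hy')

/-- A sequence that decays faster than every geometric one keeps doing so when multiplied by
a sequence of at most geometric growth. -/
lemma isBigO_pow_of_norm_le {E : Type*} [NormedAddCommGroup E] {b : ℕ → ℝ}
    (hb : ∀ ρ : ℝ, 0 < ρ → ∃ K, 0 ≤ K ∧ ∀ k, |b k| ≤ K * ρ ^ k) {f : ℕ → E} {C R : ℝ}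
    (hR : 1 ≤ R) (hC : 0 ≤ C) (hf : ∀ k, ‖f k‖ ≤ |b k| * (C * R ^ k)) {r : ℝ} (hr : 0 < r) :
    f =O[atTop] fun k => r ^ k := by
  have hR0 : 0 < R := by positivity
  obtain ⟨K, hK, hb⟩ := hb (r / R) (by positivity)
  refine IsBigO.of_bound (K * C) (Eventually.of_forall fun k => (hf k).trans ?_)
  rw [Real.norm_of_nonneg (by positivity)]
  calc _ ≤ (K * (r / R) ^ k) * (C * R ^ k) :=
        mul_le_mul_of_nonneg_right (hb k) (by positivity)
    _ = K * C * (r / R * R) ^ k := by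
        rw [mul_pow]
        ring
    _ = _ := by rw [div_mul_cancel₀ _ hR0.ne']

/-- On the real line the transform of a function of parity `n` is `i^n` times a real function. -/
lemma star_fourierInt_of_parity {n : ℕ}
    (hpar : ∀ x ∈ Icc (-1 : ℝ) 1, ψ (-x) = (-1) ^ n * ψ x) (x : ℝ) :
    (starRingEnd ℂ) (fourierInt c (fun y => ψ y * gegWeight α y) x)
      = (-1) ^ n * fourierInt c (fun y => ψ y * gegWeight α y) x := by
  rw [fourierInt, ← intervalIntegral.intervalIntegral_conj, ← intervalIntegral.integral_const_mul,
    ← neg_neg (1 : ℝ), ← intervalIntegral.integral_comp_neg, neg_neg]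
  refine intervalIntegral.integral_congr fun y hy => ?_
  rw [uIcc_of_le (by norm_num)] at hy
  simp only [map_mul, ← Complex.exp_conj, Complex.conj_ofReal, Complex.conj_I, gegWeight_neg,
    hpar y hy]
  push_cast
  ring_nf

lemma analyticOnNhd_re_fourierInt {w : ℝ → ℂ} (hw : IntervalIntegrable w volume (-1) 1) (μ : ℂ) :
    AnalyticOnNhd ℝ (fun x : ℝ => (fourierInt c w x / μ).re) univ := by
  intro x _
  have hd : Differentiable ℂ fun z => fourierInt c w z / μ := fun z =>
    (hasDerivAt_fourierInt hw z).differentiableAt.div_const μ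
  have h1 : AnalyticAt ℝ (fun z => fourierInt c w z / μ) (x : ℂ) :=
    (hd.analyticAt (x : ℂ)).restrictScalars
  exact (Complex.reCLM.analyticAt _).comp (h1.comp (Complex.ofRealCLM.analyticAt x))

end

/-! ### The series for the eigenfunction and its eigenvalue -/

theorem mainTheorem10 (α c : ℝ) (hα : -1 < α) (hc : 0 < c) (n : ℕ) (ψ : ℝ → ℝ)
    (hψ : IsGPSWF α c n ψ) :
    -- the eigenvalue `μ` of the weighted finite Fourier transform that belongs to `ψ`
    ∃ μ : ℂ, (∀ x ∈ Icc (-1 : ℝ) 1, weightedFourier α c ψ x = μ * ψ x) ∧ μ ≠ 0 ∧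
      -- the analytic extension of `ψ` and its series
      (∃ Ψ : ℝ → ℝ, AnalyticOnNhd ℝ Ψ univ ∧ EqOn Ψ ψ (Icc (-1) 1) ∧
        ∀ x : ℝ, x ≠ 0 →
          Summable (fun k : ℕ => gegSeriesCoeff α n ψ k *
            (besselJ (k + α + 1 / 2) (c * x) / ((c : ℂ) * x) ^ ((α : ℂ) + 1 / 2))) ∧
          (Ψ x : ℂ) = ((√Real.pi * 2 ^ (α + 1 / 2) / ‖μ‖ : ℝ) : ℂ) *
            ∑' k : ℕ, gegSeriesCoeff α n ψ k *
              (besselJ (k + α + 1 / 2) (c * x) / ((c : ℂ) * x) ^ ((α : ℂ) + 1 / 2))) ∧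
      -- the two series in the formula for `μ` converge faster than every geometric series
      (∀ r : ℝ, 0 < r → (fun k => muNumTerm α c n ψ k) =O[atTop] fun k : ℕ => r ^ k) ∧
      (∀ r : ℝ, 0 < r → (fun k => muDenTerm α ψ k) =O[atTop] fun k : ℕ => r ^ k) ∧
      -- the formula for `μ`
      ∑' k : ℕ, muDenTerm α ψ k ≠ 0 ∧
      μ = Complex.I ^ n * ((√Real.pi * (2 / c) ^ (α + 1 / 2) : ℝ) : ℂ) *
        ((∑' k : ℕ, muNumTerm α c n ψ k) / ((∑' k : ℕ, muDenTerm α ψ k : ℝ) : ℂ)) := by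
  obtain ⟨⟨χ, hχ, hcard⟩, hnorm⟩ := hψ
  obtain ⟨φ1, φ2, hs⟩ := hχ.exists_isSol
  have hψc : ContinuousOn ψ (Icc (-1) 1) := hs.cont
  have hne : ∃ x ∈ Icc (-1 : ℝ) 1, ψ x ≠ 0 := by
    by_contra! h0
    have hz : ∫ t in (-1 : ℝ)..1, ψ t ^ 2 * gegWeight α t = ∫ _t in (-1 : ℝ)..1, (0 : ℝ) := by
      refine intervalIntegral.integral_congr fun t ht => ?_
      rw [uIcc_of_le (by norm_num)] at ht
      simp only [h0 t ht]
      ring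
    rw [hnorm, intervalIntegral.integral_zero] at hz
    exact one_ne_zero hz
  obtain ⟨⟨r, hr, hG⟩, hψ1, hpar⟩ := hs.exists_fourier_eigenvalue hα hc hne hcard
  set G := fourierInt c (fun y => ψ y * gegWeight α y) with hGdef
  have hrC : (r : ℂ) ≠ 0 := Complex.ofReal_ne_zero.2 hr.ne'
  have hIn : Complex.I ^ n ≠ 0 := pow_ne_zero _ Complex.I_ne_zero
  have hμ : Complex.I ^ n * r ≠ 0 := mul_ne_zero hIn hrC
  have hμn : ‖Complex.I ^ n * r‖ = r := by
    rw [norm_mul, norm_pow, Complex.norm_I, one_pow, one_mul, Complex.norm_real,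
      Real.norm_of_nonneg hr.le]
  have hβ : ∀ ρ : ℝ, 0 < ρ → ∃ K, 0 ≤ K ∧ ∀ k, |gegCoeff α ψ k| ≤ K * ρ ^ k := fun ρ hρ =>
    exists_gegCoeff_bound hα (intervalIntegrable_ofReal_mul_gegWeight hα hψc) hμ hψc hG hρ
  -- the series of Bessel functions sums to the transform of `ψ`, up to a constant
  set A : ℂ := ((√Real.pi * 2 ^ (α + 1 / 2) : ℝ) : ℂ) with hA
  have hA0 : A ≠ 0 := Complex.ofReal_ne_zero.2
    (mul_pos (Real.sqrt_pos.2 Real.pi_pos) (Real.rpow_pos_of_pos two_pos _)).ne'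
  have hseries : ∀ x : ℝ, x ≠ 0 → HasSum (fun k : ℕ => gegSeriesCoeff α n ψ k *
      (besselJ (k + α + 1 / 2) (c * x) / ((c : ℂ) * x) ^ ((α : ℂ) + 1 / 2)))
      ((Complex.I ^ n * A)⁻¹ * G x) := fun x hx => by
    have hcx : (c : ℂ) * (x : ℂ) ≠ 0 :=
      mul_ne_zero (Complex.ofReal_ne_zero.2 hc.ne') (Complex.ofReal_ne_zero.2 hx)
    simp only [gegSeriesCoeff_mul_besselJ_div hα n _ ψ hcx]
    exact (hasSum_gegCoeff_mul_fourierInt hα hψc hβ c x).mul_left _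
  have hcα : ((c : ℂ) ^ ((α : ℂ) + 1 / 2)) = ((c ^ (α + 1 / 2) : ℝ) : ℂ) := by
    rw [Complex.ofReal_cpow hc.le]
    push_cast
    rfl
  have hcα0 : ((c ^ (α + 1 / 2) : ℝ) : ℂ) ≠ 0 :=
    Complex.ofReal_ne_zero.2 (Real.rpow_pos_of_pos hc _).ne'
  -- the terms of the numerator are those of the series at `x = 1`
  have hnum : ∀ k, muNumTerm α c n ψ k = ((c ^ (α + 1 / 2) : ℝ) : ℂ) * (gegSeriesCoeff α n ψ k *
      (besselJ (k + α + 1 / 2) (c * (1 : ℝ)) / ((c : ℂ) * (1 : ℝ)) ^ ((α : ℂ) + 1 / 2))) := by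
    intro k
    rw [Complex.ofReal_one, mul_one, hcα, muNumTerm, mul_div_assoc',
      mul_div_cancel₀ _ hcα0]
  -- the terms of the denominator are those of the Gegenbauer expansion at `x = 1`
  have hden : ∀ k, muDenTerm α ψ k = gegCoeff α ψ k * gegP α k 1 := by
    intro k
    rw [muDenTerm, gegP, jacobiP_apply_one hα]
    ring
  have h1 : (1 : ℝ) ∈ Icc (-1 : ℝ) 1 := by norm_num
  have hdens : HasSum (fun k => muDenTerm α ψ k) (ψ 1) := by
    simp only [hden]
    exact (hasSum_gegCoeff_mul_gegP hα hψc hβ).2 1 h1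
  have hnums : HasSum (fun k => muNumTerm α c n ψ k)
      (((c ^ (α + 1 / 2) : ℝ) : ℂ) * ((Complex.I ^ n * A)⁻¹ * G (1 : ℝ))) := by
    simp only [hnum]
    exact (hseries 1 one_ne_zero).mul_left _
  refine ⟨Complex.I ^ n * r, fun x hx => ?_, hμ,
    ⟨fun x => (G x / (Complex.I ^ n * r)).re, ?_, fun x hx => ?_, fun x hx => ?_⟩,
    fun ρ hρ => ?_, fun ρ hρ => ?_, ?_, ?_⟩
  · rw [weightedFourier_eq_fourierInt]
    exact hG x hx
  · exact analyticOnNhd_re_fourierInt (intervalIntegrable_ofReal_mul_gegWeight hα hψc) _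
  · simp only [hG x hx]
    rw [mul_div_cancel_left₀ _ hμ, Complex.ofReal_re]
  · refine ⟨(hseries x hx).summable, ?_⟩
    -- the transform divided by its eigenvalue is real, by the parity of `ψ`
    have hre : (((G x / (Complex.I ^ n * r)).re : ℝ) : ℂ) = G x / (Complex.I ^ n * r) := by
      refine Complex.conj_eq_iff_re.1 ?_
      rw [map_div₀, hGdef, star_fourierInt_of_parity hpar, map_mul, map_pow, Complex.conj_I,
        Complex.conj_ofReal, neg_pow Complex.I, mul_assoc, mul_div_mul_left]
      exact pow_ne_zero _ (neg_ne_zero.2 one_ne_zero)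
    rw [hre, (hseries x hx).tsum_eq, hμn, Complex.ofReal_div, ← hA]
    field_simp
  · obtain ⟨C, R, hC, hR, hb⟩ := exists_norm_fourierInt_gegP_le hα c (1 : ℝ)
    refine isBigO_pow_of_norm_le hβ hR
      (C := ‖((c ^ (α + 1 / 2) : ℝ) : ℂ) * (Complex.I ^ n * A)⁻¹‖ * C) (by positivity)
      (fun k => ?_) hρ
    rw [hnum, gegSeriesCoeff_mul_besselJ_div hα n _ ψ (by simpa using hc.ne'), ← mul_assoc,
      norm_mul, norm_mul _ (fourierInt c _ _), Complex.norm_real, Real.norm_eq_abs]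
    calc _ ≤ ‖((c ^ (α + 1 / 2) : ℝ) : ℂ) * (Complex.I ^ n * A)⁻¹‖ *
          (|gegCoeff α ψ k| * (C * R ^ k)) := by
          gcongr
          exact hb k
      _ = _ := by ring
  · obtain ⟨C, R, hC, hR, hb⟩ := exists_gegP_bound hα
    refine isBigO_pow_of_norm_le hβ hR hC.le (fun k => ?_) hρ
    rw [hden, norm_mul, Real.norm_eq_abs, Real.norm_eq_abs]
    exact mul_le_mul_of_nonneg_left (hb k 1 h1) (abs_nonneg _)
  · rw [hdens.tsum_eq]
    exact hψ1
  · have hψ1' : (ψ 1 : ℂ) ≠ 0 := Complex.ofReal_ne_zero.2 hψ1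
    rw [hdens.tsum_eq, hnums.tsum_eq, hG 1 h1, Real.div_rpow two_pos.le hc.le,
      ← mul_div_assoc √Real.pi, Complex.ofReal_div, ← hA]
    generalize c ^ (α + 1 / 2) = q at hcα0 ⊢
    field_simp
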